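/- **Setting.** Let $h=\{h_n:n\ge 0\}$ be an offspring distribution that is subcritical, $\sum_{n\ge1} n h_n<1$, and has an exponential tail: for some $a>0$, $\sum_{l\ge n}h_l\le e^{-an}$ for every $n\ge 0$. Let $1<q\le Q$ and let $\nu$ be a probability law supported in $[q,Q]$. Under $\mathbb P_{h,\nu}$, $T$ is a Galton–Watson tree with offspring law $h$ (vertex set $V(T)$, root $\phi$), and the edges $e$ of $T$ carry independent biases $\beta_e$ of law $\nu$. For $v\in V(T)$ let $\omega(v)$ be the product of the biases of the edges on the path from $\phi$ to $v$ (so $\omega(\phi)=1$), and let $\omega(T)=\sum_{v\in V(T)}\omega(v)$. For $u>0$ write $\mathbb P_{h,\nu,u}=\mathbb P_{h,\nu}(\,\cdot\mid\omega(T)>u)$. A vertex $v\ne\phi$ of a finite rooted tree $T$ is a *cutpoint* if it is not a leaf and every other vertex at the same distance from $\phi$ is a leaf. Let $r(T)$ be one plus the number of cutpoints, let $d_1<\dots<d_{r(T)-1}$ be the distances of the cutpoints from $\phi$, and put $d_0=0$ and $d_{r(T)}=D(T)$, the maximal distance of a vertex from $\phi$. For $1\le i\le r(T)$ the $i$-th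 component $C_i$ is the subgraph of $T$ induced by the vertices at distance at least $d_{i-1}$ and at most $d_i$ from $\phi$; set $C_i=\emptyset$ for $i>r(T)$. **Proposition.** There exist $c>0$ and $k_0\in\mathbb N$, depending only on $h$ and $\nu$, such that for all $u>0$, all $i\ge1$ and all $k\ge k_0$, $$\mathbb P_{h,\nu,u}\big(|V(C_i)|\ge k\big)\le e^{-ck}.$$ (If $h_0=1$, the conditioning event is null for $u\ge 1$, and nothing is claimed for such $u$.) -/

import Mathlib

open MeasureTheory
open scoped ENNReal

/-! Vertices of rooted ordered trees are finite words of natural numbers: the root is the empty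
word `[]`, the parent of `w ++ [j]` is `w`, and the distance of `w` from the root is its length.
The children of a vertex with `m` offspring are numbered `0, …, m - 1`. -/

namespace RenewalTree

section Law

/-- The data from which a weighted tree is read off: to every word `w` it attaches the number of
offspring `(x w).1` of `w` and the bias `(x w).2` of the edge between `w` and its parent. -/
abbrev Marks : Type := List ℕ → ℕ × ℝ

/-- The vertex set `V(T)` of the tree with marks `x`. -/
def vertices (x : Marks) : Set (List ℕ) :=
  {w | ∀ (p : List ℕ) (j : ℕ), (p ++ [j]) <+: w → j < (x p).1}

/-- `ω(v)`: the product of the biases of the edges along the path from the root to `v`. -/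
def weight (x : Marks) (v : List ℕ) : ℝ :=
  ∏ n ∈ Finset.range v.length, (x (v.take (n + 1))).2

/-- `ω(T) = ∑_{v ∈ V(T)} ω(v)`; its value is in `[0, ∞]` so that it is meaningful also on the
null event that the tree is infinite. -/
noncomputable def totalWeight (x : Marks) : ℝ≥0∞ :=
  ∑' v : vertices x, ENNReal.ofReal (weight x v)

/-- The Galton-Watson tree with offspring distribution `h` whose edges carry independent biases
of law `ν`: all the offspring numbers and all the biases are independent. -/
noncomputable def law (h : PMF ℕ) (ν : Measure ℝ) [IsProbabilityMeasure ν] : Measure Marks :=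
  Measure.infinitePi fun _ : List ℕ => h.toMeasure.prod ν

/-- The law of the weighted Galton-Watson tree given that `ω(T) > u`. -/
noncomputable def condLaw (h : PMF ℕ) (ν : Measure ℝ) [IsProbabilityMeasure ν] (u : ℝ) :
    Measure Marks :=
  ProbabilityTheory.cond (law h ν) {x | ENNReal.ofReal u < totalWeight x}

end Law

section Decomposition

/-- `v` is a leaf of the tree with vertex set `V`: it is a vertex without offspring. -/
def IsLeaf (V : Set (List ℕ)) (v : List ℕ) : Prop :=
  v ∈ V ∧ ∀ j : ℕ, v ++ [j] ∉ V

/-- A cutpoint is a vertex other than the root that is not a leaf and such that any other vertex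
at the same distance from the root is a leaf. -/
def IsCutpoint (V : Set (List ℕ)) (v : List ℕ) : Prop :=
  v ∈ V ∧ v ≠ [] ∧ ¬ IsLeaf V v ∧ ∀ w ∈ V, w.length = v.length → w ≠ v → IsLeaf V w

/-- Distinct cutpoints lie at distinct distances from the root, so that the cutpoints may be
listed in increasing order of that distance. -/
theorem IsCutpoint.eq_of_length_eq {V : Set (List ℕ)} {v w : List ℕ}
    (hv : IsCutpoint V v) (hw : IsCutpoint V w) (hvw : v.length = w.length) : v = w := by
  by_contra hne
  exact hv.2.2.1 (hw.2.2.2 v hv.1 hvw hne)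

/-- The depth `D(T)`: the maximal distance of a vertex from the root. -/
noncomputable def depth (V : Set (List ℕ)) : ℕ :=
  sSup (List.length '' V)

/-- `r(T)`: the number of cutpoints plus one. -/
noncomputable def numComponents (V : Set (List ℕ)) : ℕ :=
  {v | IsCutpoint V v}.ncard + 1

/-- `d_0 = 0`, `d_i` is the distance from the root of the `i`-th cutpoint for `1 ≤ i < r(T)`, and
`d_{r(T)} = D(T)`. -/
noncomputable def cutDepth (V : Set (List ℕ)) (i : ℕ) : ℕ :=
  if i = 0 then 0
  else if i < numComponents V then
    Nat.nth (fun n => ∃ v, IsCutpoint V v ∧ v.length = n) (i - 1)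
  else depth V

/-- The vertex set of the `i`-th component `C_i`, `1 ≤ i ≤ r(T)`: the vertices at a distance from
the root of at least `d_{i-1}` and at most `d_i`; it is empty if `i > r(T)` (or `i = 0`). -/
def component (V : Set (List ℕ)) (i : ℕ) : Set (List ℕ) :=
  {v | v ∈ V ∧ 1 ≤ i ∧ i ≤ numComponents V ∧
    cutDepth V (i - 1) ≤ v.length ∧ v.length ≤ cutDepth V i}

end Decomposition

end RenewalTree

/-! Give the root a bias too, as if an edge hung below it, and let F(t) be the probability that the
resulting planted weight exceeds t. No asymptotics of F are known or needed: every estimate has the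
form "probability ≤ small factor times F(t)", uniformly in t, so conditioning on a large weight
costs nothing.

Renewal. Let v be the vertex where the component with index m + 1 starts, m ≥ 1. That every other
vertex at its level is a leaf, and that m - 1 cutpoints precede it, does not involve the subtree at
v. Given everything outside this subtree, the total weight is A + P·W, with W the planted weight of
a fresh copy of the tree, so "total weight > u" becomes "W > s" for some s. It therefore suffices to
show that, for the planted tree and every s, the event that the part up to the first cutpoint
(`early`) has at least k vertices and the weight exceeds s has probability at most Cθ^k times that
of {W > s, root not a leaf} (`exists_law_early_le`). Summing over the disjoint choices of v gives
the bound (`law_isStart_succ_le`). The other vertices at the level of v belong to the first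
component seen from the preceding start, which is why k/2 and two starts occur
(`exists_le_encard_early`). For the first component, the absent root bias is absorbed by regularity
of F.

First component of size j. If the weight exceeds t, either one of the j vertices has weight above
t/(2j), or the subtree at the first cutpoint contributes more than t/2 (`lt_planted_cases`). Let v
be the vertex in question and compare its level with n = j/D. At low level, the existence of j
vertices costs κ^j by exponential moments of the total progeny, while the biases up to v gain at
most a factor Q^(n+1) in the threshold (`law_early_le`). At high level, a long path to v carries the
weight although no intermediate level is a cutpoint level, and this must be shown to be
exponentially unlikely relative to F(t).

Long uncut paths. Let p_s be the expected number of children of the root whose siblings' trees have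
maximal height s, and m = Σ p_s. Choosing one child per generation gives, after n steps, m^n times F
at t divided by n random biases. Without a cutpoint, the time until the off-path subtrees seen so
far die out is a chain r ↦ max(r - 1, H) avoiding 0, with H of law p_s/m; a Lyapunov function
(`exists_drift`) makes the expected number of such paths O((mρ)^n), ρ < 1 (`lintegral_cover_le`).
Conversely, the event that a single vertex of level n is not a leaf contains at most one such path,
and the requirements on the siblings weaken with the distance to level n; hence F(t) is at least
c(mσ)^n times the same rescaled tail for every σ < 1 (`exists_tailF_ge`). With σ = √ρ the quotient
is O(σ^n).

Regularity. The case n = 1 of that lower bound gives F(t/q) ≤ B·F(t). Thus replacing t by t/(2j) or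
t/(2jQ^(n+1)) costs powers of B, and a large D makes them smaller than the gains (`exists_scale`).
-/

namespace RenewalTree

/-! ### Independence of the marks: grafting and branching -/

section MeasureTools

/-- The marks of the subtree rooted at `v`. -/
def sub (x : Marks) (v : List ℕ) : Marks := fun w => x (v ++ w)

/-- The marks of the subtree rooted at the `j`-th child of the root. -/
def child (x : Marks) (j : ℕ) : Marks := fun w => x (j :: w)

/-- Replace the subtree at `v` in `x` by `y`. -/
def glue (v : List ℕ) (x y : Marks) : Marks :=
  fun w => if v <+: w then y (w.drop v.length) else x w

/-- Marks with a given root mark and given families of marks for the children. -/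
def build (m : ℕ × ℝ) (T : ℕ → Marks) : Marks
  | [] => m
  | j :: w => T j w

/-- Replace the bias at the root. -/
def setBias (x : Marks) (b : ℝ) : Marks := build ((x []).1, b) (child x)

theorem measurable_sub (v : List ℕ) : Measurable fun x : Marks => sub x v :=
  measurable_pi_lambda _ fun _ => measurable_pi_apply _

theorem measurable_child (j : ℕ) : Measurable fun x : Marks => child x j :=
  measurable_pi_lambda _ fun _ => measurable_pi_apply _

theorem measurable_glue (v : List ℕ) : Measurable fun p : Marks × Marks => glue v p.1 p.2 := by
  refine measurable_pi_lambda _ fun w => ?_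
  by_cases h : v <+: w
  · simp only [glue, h, if_true]
    fun_prop
  · simp only [glue, h, if_false]
    fun_prop

theorem measurable_build : Measurable fun p : (ℕ × ℝ) × (ℕ → Marks) => build p.1 p.2 := by
  refine measurable_pi_lambda _ fun w => ?_
  cases w with
  | nil => exact measurable_fst
  | cons j w =>
    exact (measurable_pi_apply w).comp ((measurable_pi_apply j).comp measurable_snd)

theorem measurable_setBias : Measurable fun p : Marks × ℝ => setBias p.1 p.2 := by
  refine measurable_build.comp (Measurable.prodMk (Measurable.prodMk ?_ measurable_snd) ?_)
  · exact measurable_fst.comp ((measurable_pi_apply _).comp measurable_fst)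
  · exact measurable_pi_lambda _ fun j => (measurable_child j).comp measurable_fst

theorem sub_glue (v : List ℕ) (x y : Marks) : sub (glue v x y) v = y := by
  funext w
  simp [sub, glue]

theorem glue_nil (x y : Marks) : glue [] x y = y := by
  funext w
  simp [glue]

theorem sub_nil (x : Marks) : sub x [] = x := rfl

theorem sub_cons (x : Marks) (j : ℕ) (v : List ℕ) : sub x (j :: v) = sub (child x j) v := rfl

theorem child_build (m : ℕ × ℝ) (T : ℕ → Marks) : child (build m T) = T := rfl

variable (h : PMF ℕ) (ν : Measure ℝ) [IsProbabilityMeasure ν]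

instance : IsProbabilityMeasure (law h ν) := by
  unfold law; infer_instance

theorem law_pi (s : Finset (List ℕ)) (t : List ℕ → Set (ℕ × ℝ)) (ht : ∀ i, MeasurableSet (t i)) :
    law h ν (Set.pi s t) = ∏ i ∈ s, (h.toMeasure.prod ν) (t i) := by
  unfold law
  rw [Measure.infinitePi_pi]
  exact fun i _ => ht i

/-- Every word carries a mark, whether or not it is a vertex, so the marks at and below a fixed `v`
form an independent copy of the whole family. This is the source of all independence between a
subtree and its surroundings; it is checked on boxes. -/
theorem map_glue (v : List ℕ) :
    ((law h ν).prod (law h ν)).map (fun p => glue v p.1 p.2) = law h ν := by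
  refine Measure.eq_infinitePi _ fun s t ht => ?_
  classical
  rw [Measure.map_apply (measurable_glue v)
    (MeasurableSet.pi s.countable_toSet fun i _ => ht i)]
  set s₁ := s.filter (fun w => ¬ v <+: w)
  set s₂ := (s.filter (fun w => v <+: w)).image (fun w => w.drop v.length)
  have key : (fun p : Marks × Marks => glue v p.1 p.2) ⁻¹' (Set.pi s t) =
      (Set.pi s₁ t) ×ˢ (Set.pi s₂ fun w => t (v ++ w)) := by
    ext ⟨x, y⟩
    simp only [Set.mem_preimage, Set.mem_pi, Finset.mem_coe, Set.mem_prod, s₁, s₂,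
      Finset.mem_filter, Finset.mem_image]
    constructor
    · intro H
      refine ⟨fun w hw => ?_, ?_⟩
      · have := H w hw.1
        simpa [glue, hw.2] using this
      · rintro _ ⟨w, ⟨hw, ⟨w, rfl⟩⟩, rfl⟩
        have := H _ hw
        simpa [glue] using this
    · rintro ⟨H1, H2⟩ w hw
      by_cases hv : v <+: w
      · obtain ⟨w, rfl⟩ := hv
        have := H2 w ⟨v ++ w, ⟨hw, by simp⟩, by simp⟩
        simpa [glue] using this
      · simpa [glue, hv] using H1 w ⟨hw, hv⟩
  rw [key, Measure.prod_prod, law_pi h ν _ _ ht, law_pi h ν _ _ fun i => ht _,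
    ← Finset.prod_filter_not_mul_prod_filter s (fun w => v <+: w)]
  congr 1
  rw [Finset.prod_image]
  · refine Finset.prod_congr rfl fun w hw => ?_
    obtain ⟨w, rfl⟩ := (Finset.mem_filter.1 hw).2
    simp
  · intro a ha b hb hab
    obtain ⟨a, rfl⟩ := (Finset.mem_filter.1 ha).2
    obtain ⟨b, rfl⟩ := (Finset.mem_filter.1 hb).2
    simpa using hab

/-- The law of the family of the subtrees at the children of the root. -/
noncomputable def forest : Measure (ℕ → Marks) := Measure.infinitePi fun _ : ℕ => law h ν

instance : IsProbabilityMeasure (forest h ν) := by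
  unfold forest; infer_instance

/-- The branching property: the root mark and the families of marks at the children are independent,
the latter distributed as the whole. -/
theorem map_build :
    ((h.toMeasure.prod ν).prod (forest h ν)).map (fun p => build p.1 p.2) = law h ν := by
  refine Measure.eq_infinitePi _ fun s t ht => ?_
  classical
  rw [Measure.map_apply measurable_build
    (MeasurableSet.pi s.countable_toSet fun i _ => ht i)]
  set s₁ := s.erase []
  set J := s₁.image List.headI
  set S : ℕ → Finset (List ℕ) := fun j => (s₁.filter (fun w => w.headI = j)).image List.tail
  set t₀ : Set (ℕ × ℝ) := if [] ∈ s then t [] else Set.univ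
  have hcons : ∀ w ∈ s₁, ∃ j w', w = j :: w' := fun w hw =>
    List.exists_cons_of_ne_nil (Finset.ne_of_mem_erase hw)
  have key : (fun p : (ℕ × ℝ) × (ℕ → Marks) => build p.1 p.2) ⁻¹' (Set.pi s t) =
      t₀ ×ˢ (Set.pi J fun j => Set.pi (S j) fun w => t (j :: w)) := by
    ext ⟨m, T⟩
    simp only [Set.mem_preimage, Set.mem_pi, Finset.mem_coe, Set.mem_prod]
    constructor
    · intro H
      refine ⟨?_, ?_⟩
      · by_cases h0 : [] ∈ s
        · simpa [t₀, h0, build] using H [] h0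
        · simp [t₀, h0]
      · intro j _ w hw
        obtain ⟨w', hw', rfl⟩ := Finset.mem_image.1 hw
        obtain ⟨hw2, hj⟩ := Finset.mem_filter.1 hw'
        obtain ⟨i, w, rfl⟩ := hcons w' hw2
        simp only [List.headI_cons] at hj
        subst hj
        simpa [build] using H _ (Finset.mem_of_mem_erase hw2)
    · rintro ⟨H1, H2⟩ w hw
      cases w with
      | nil => simpa [t₀, hw, build] using H1
      | cons j w =>
        have hw1 : j :: w ∈ s₁ := Finset.mem_erase.2 ⟨by simp, hw⟩
        exact H2 j (Finset.mem_image.2 ⟨_, hw1, rfl⟩) w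
          (Finset.mem_image.2 ⟨_, Finset.mem_filter.2 ⟨hw1, rfl⟩, rfl⟩)
  have hm0 : (h.toMeasure.prod ν) t₀ =
      if [] ∈ s then (h.toMeasure.prod ν) (t []) else 1 := by
    by_cases h0 : [] ∈ s <;> simp [t₀, h0]
  have hfor : forest h ν (Set.pi J fun j => Set.pi (S j) fun w => t (j :: w)) =
      ∏ w ∈ s₁, (h.toMeasure.prod ν) (t w) := by
    unfold forest
    rw [Measure.infinitePi_pi]
    · rw [← Finset.prod_fiberwise_of_maps_to
        (fun w hw => Finset.mem_image_of_mem List.headI hw : ∀ w ∈ s₁, w.headI ∈ J)]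
      refine Finset.prod_congr rfl fun j _ => ?_
      rw [law_pi h ν _ _ fun i => ht _, Finset.prod_image]
      · refine Finset.prod_congr rfl fun w hw => ?_
        obtain ⟨hw', hj⟩ := Finset.mem_filter.1 hw
        obtain ⟨i, w, rfl⟩ := hcons w hw'
        simp only [List.headI_cons] at hj
        subst hj
        rfl
      · intro a ha b hb hab
        obtain ⟨ha', hja⟩ := Finset.mem_filter.1 ha
        obtain ⟨hb', hjb⟩ := Finset.mem_filter.1 hb
        obtain ⟨i, a, rfl⟩ := hcons a ha'
        obtain ⟨i', b, rfl⟩ := hcons b hb'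
        simp_all
    · exact fun j _ => MeasurableSet.pi (S j).countable_toSet fun i _ => ht _
  rw [key, Measure.prod_prod, hm0, hfor]
  by_cases h0 : [] ∈ s
  · rw [if_pos h0]
    exact Finset.mul_prod_erase s (fun w => (h.toMeasure.prod ν) (t w)) h0
  · rw [if_neg h0, one_mul, show s₁ = s from Finset.erase_eq_of_notMem h0]

theorem lintegral_build {f : Marks → ℝ≥0∞} (hf : Measurable f) :
    ∫⁻ x, f x ∂(law h ν) = ∫⁻ m, ∫⁻ T, f (build m T) ∂(forest h ν) ∂(h.toMeasure.prod ν) := by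
  conv_lhs => rw [← map_build]
  rw [lintegral_map hf measurable_build]
  exact lintegral_prod _ (hf.comp measurable_build).aemeasurable

theorem lintegral_glue (v : List ℕ) {f : Marks → ℝ≥0∞} (hf : Measurable f) :
    ∫⁻ x, f x ∂(law h ν) = ∫⁻ x, ∫⁻ y, f (glue v x y) ∂(law h ν) ∂(law h ν) := by
  conv_lhs => rw [← map_glue h ν v]
  rw [lintegral_map hf (measurable_glue v)]
  exact lintegral_prod _ (hf.comp (measurable_glue v)).aemeasurable

theorem lintegral_setBias {f : Marks → ℝ≥0∞} (hf : Measurable f) :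
    ∫⁻ x, f x ∂(law h ν) = ∫⁻ x, ∫⁻ b, f (setBias x b) ∂ν ∂(law h ν) := by
  have hf' : Measurable fun p : (ℕ × ℝ) × (ℕ → Marks) => f (build p.1 p.2) :=
    hf.comp measurable_build
  have hfb : Measurable fun p : Marks × ℝ => f (setBias p.1 p.2) := hf.comp measurable_setBias
  rw [lintegral_build h ν hf, lintegral_build h ν (Measurable.lintegral_prod_right' hfb),
    lintegral_prod _ (Measurable.lintegral_prod_right' hf').aemeasurable,
    lintegral_prod]
  · refine lintegral_congr fun n => ?_
    simp only [setBias, build, child_build]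
    rw [lintegral_const, measure_univ, mul_one, lintegral_lintegral_swap]
    exact (hf.comp (measurable_build.comp (Measurable.prodMk
      (Measurable.prodMk measurable_const measurable_fst) measurable_snd))).aemeasurable
  · refine Measurable.aemeasurable ?_
    refine Measurable.lintegral_prod_right' (f := fun q : (ℕ × ℝ) × (ℕ → Marks) =>
      ∫⁻ b, f (setBias (build q.1 q.2) b) ∂ν) ?_
    exact (Measurable.lintegral_prod_right' hfb).comp measurable_build

/-- The bias of the root and the subtree at the `j`-th child are independent of any event that
depends on the remaining marks only. -/
theorem lintegral_indicator_bias_child (j : ℕ) {K : Set Marks} (hK : MeasurableSet K)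
    (hKb : ∀ x b y, glue [j] (setBias x b) y ∈ K ↔ x ∈ K)
    {g : ℝ × Marks → ℝ≥0∞} (hg : Measurable g) :
    ∫⁻ x, K.indicator (fun x => g ((x []).2, child x j)) x ∂(law h ν) =
      law h ν K * ∫⁻ b, ∫⁻ y, g (b, y) ∂(law h ν) ∂ν := by
  have hmeas : Measurable fun x : Marks => g ((x []).2, child x j) :=
    hg.comp ((measurable_snd.comp (measurable_pi_apply _)).prodMk (measurable_child j))
  have hF := hmeas.indicator hK
  have hFg : Measurable fun p : Marks × Marks =>
      K.indicator (fun x => g ((x []).2, child x j)) (glue [j] p.1 p.2) :=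
    hF.comp (measurable_glue [j])
  rw [lintegral_glue h ν [j] hF,
    lintegral_setBias h ν (Measurable.lintegral_prod_right' hFg)]
  have hpt : ∀ x b y, K.indicator (fun x => g ((x []).2, child x j)) (glue [j] (setBias x b) y) =
      K.indicator 1 x * g (b, y) := by
    intro x b y
    have h1 : child (glue [j] (setBias x b) y) j = y := sub_glue [j] _ y
    have h2 : (glue [j] (setBias x b) y []).2 = b := by simp [glue, setBias, build]
    by_cases hx : x ∈ K
    · rw [Set.indicator_of_mem ((hKb x b y).2 hx), Set.indicator_of_mem hx, h1, h2]; simp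
    · rw [Set.indicator_of_notMem (fun h => hx ((hKb x b y).1 h)), Set.indicator_of_notMem hx]
      simp
  simp only [hpt]
  have hg1 : ∀ b, Measurable fun y => g (b, y) := fun b => hg.comp measurable_prodMk_left
  have : ∀ x, ∫⁻ b, ∫⁻ y, K.indicator (1 : Marks → ℝ≥0∞) x * g (b, y) ∂(law h ν) ∂ν =
      K.indicator 1 x * ∫⁻ b, ∫⁻ y, g (b, y) ∂(law h ν) ∂ν := by
    intro x
    rw [← lintegral_const_mul _ (Measurable.lintegral_prod_right' hg)]
    exact lintegral_congr fun b => lintegral_const_mul _ (hg1 b)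
  simp only [this]
  rw [lintegral_mul_const _ (measurable_one.indicator hK), lintegral_indicator_one hK]

end MeasureTools

/-! ### Vertices, heights, and the exponential tail of the total progeny -/

section TreeSize

/-- The number of offspring of the root. -/
def offs (x : Marks) : ℕ := (x []).1

theorem measurable_offs : Measurable offs :=
  measurable_fst.comp (measurable_pi_apply _)

theorem nil_mem_vertices (x : Marks) : [] ∈ vertices x := by
  intro p j h
  simp at h

theorem cons_mem_vertices {x : Marks} {j : ℕ} {w : List ℕ} :
    j :: w ∈ vertices x ↔ j < offs x ∧ w ∈ vertices (child x j) := by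
  constructor
  · intro H
    refine ⟨H [] j (by simp), fun p i hp => H (j :: p) i (by simpa using hp)⟩
  · rintro ⟨h1, h2⟩ p i hp
    cases p with
    | nil =>
      have : i = j := by simpa using hp
      exact this ▸ h1
    | cons k p =>
      have : k = j ∧ p ++ [i] <+: w := by simpa using hp
      obtain rfl := this.1
      exact h2 p i this.2

theorem append_mem_vertices {x : Marks} {v w : List ℕ} :
    v ++ w ∈ vertices x ↔ v ∈ vertices x ∧ w ∈ vertices (sub x v) := by
  induction v generalizing x with
  | nil => simp [nil_mem_vertices, sub_nil]
  | cons j v ih => simp [cons_mem_vertices, ih, sub_cons, and_assoc]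

theorem singleton_mem_vertices {x : Marks} {j : ℕ} : [j] ∈ vertices x ↔ j < offs x := by
  simp [cons_mem_vertices, nil_mem_vertices]

theorem mem_vertices_of_prefix {x : Marks} {v w : List ℕ} (h : v <+: w) (hw : w ∈ vertices x) :
    v ∈ vertices x := by
  obtain ⟨u, rfl⟩ := h
  exact (append_mem_vertices.1 hw).1

theorem measurableSet_mem_vertices (w : List ℕ) : MeasurableSet {x | w ∈ vertices x} := by
  induction w with
  | nil => simp [nil_mem_vertices]
  | cons j w ih =>
    simp only [cons_mem_vertices]
    exact (measurable_offs measurableSet_Ioi).inter (measurable_child j ih)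

/-- There is no vertex at distance `n` from the root. -/
def Ext : ℕ → Marks → Prop
  | 0, _ => False
  | n + 1, x => ∀ i < offs x, Ext n (child x i)

theorem Ext.succ {n : ℕ} {x : Marks} (hx : Ext n x) : Ext (n + 1) x := by
  induction n generalizing x with
  | zero => exact hx.elim
  | succ n ih => exact fun i hi => ih (hx i hi)

theorem Ext.mono {m n : ℕ} (hmn : m ≤ n) {x : Marks} (hx : Ext m x) : Ext n x := by
  induction hmn with
  | refl => exact hx
  | step _ ih => exact ih.succ

theorem measurableSet_ext (n : ℕ) : MeasurableSet {x | Ext n x} := by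
  induction n with
  | zero => simp [Ext]
  | succ n ih =>
    simp only [Ext, Set.ofPred_forall]
    refine MeasurableSet.iInter fun i => ?_
    have : {x : Marks | i < offs x → Ext n (child x i)} =
        {x | i < offs x}ᶜ ∪ {x | Ext n (child x i)} := by
      ext x; simp [imp_iff_not_or]
    simp only [this]
    exact (measurable_offs measurableSet_Ioi).compl.union (measurable_child i ih)

theorem Ext.length_lt {n : ℕ} {x : Marks} (hx : Ext n x) {w : List ℕ} (hw : w ∈ vertices x) :
    w.length < n := by
  induction n generalizing x w with
  | zero => exact hx.elim
  | succ n ih =>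
    cases w with
    | nil => simp
    | cons j w =>
      obtain ⟨hj, hw⟩ := cons_mem_vertices.1 hw
      simpa using ih (hx j hj) hw

theorem ext_of_forall_length_lt {n : ℕ} {x : Marks} (hx : ∀ w ∈ vertices x, w.length < n) :
    Ext n x := by
  induction n generalizing x with
  | zero => exact absurd (hx [] (nil_mem_vertices x)) (by simp)
  | succ n ih =>
    intro i hi
    refine ih fun w hw => ?_
    simpa using hx (i :: w) (cons_mem_vertices.2 ⟨hi, hw⟩)

/-- The number of vertices at a distance less than `n` from the root. -/
def size : ℕ → Marks → ℕ
  | 0, _ => 0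
  | n + 1, x => 1 + ∑ j ∈ Finset.range (offs x), size n (child x j)

theorem measurable_size (n : ℕ) : Measurable (size n) := by
  induction n with
  | zero => exact measurable_const
  | succ n ih =>
    have h1 : ∀ k : ℕ, Measurable fun x : Marks =>
        1 + ∑ j ∈ Finset.range k, size n (child x j) := fun k =>
      measurable_const.add (Finset.measurable_sum _ fun j _ => ih.comp (measurable_child j))
    have h2 : Measurable fun p : Marks × ℕ =>
        1 + ∑ j ∈ Finset.range p.2, size n (child p.1 j) :=
      measurable_from_prod_countable_left h1
    exact h2.comp (measurable_id.prodMk measurable_offs)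

theorem tsum_list (g : List ℕ → ℝ≥0∞) : ∑' v, g v = g [] + ∑' j, ∑' w, g (j :: w) := by
  let e : Unit ⊕ (ℕ × List ℕ) ≃ List ℕ :=
    { toFun := Sum.elim (fun _ => []) fun p => p.1 :: p.2
      invFun := fun l => match l with
        | [] => Sum.inl ()
        | j :: w => Sum.inr (j, w)
      left_inv := by rintro (_ | ⟨j, w⟩) <;> rfl
      right_inv := by rintro (_ | ⟨j, w⟩) <;> rfl }
  rw [← e.tsum_eq, ENNReal.summable.tsum_sum ENNReal.summable]
  congr 1
  · simp [e]
  · rw [ENNReal.summable.tsum_prod' fun _ => ENNReal.summable]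
    rfl

open Classical in
theorem tsum_size (n : ℕ) (x : Marks) :
    ∑' v : List ℕ, (if v ∈ vertices x ∧ v.length < n then 1 else 0 : ℝ≥0∞) = size n x := by
  induction n generalizing x with
  | zero => simp [size]
  | succ n ih =>
    rw [tsum_list]
    simp only [nil_mem_vertices, List.length_nil, Nat.succ_pos, and_self, if_true,
      cons_mem_vertices, List.length_cons, Nat.succ_lt_succ_iff, size]
    push_cast
    congr 1
    rw [tsum_eq_sum (s := Finset.range (offs x))]
    · refine Finset.sum_congr rfl fun j hj => ?_
      rw [← ih]
      simp [Finset.mem_range.1 hj]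
    · intro j hj
      simp only [Finset.mem_range] at hj
      simp [hj]

theorem exists_le_size {x : Marks} {j : ℕ} (hj : (j : ℕ∞) ≤ (vertices x).encard) :
    ∃ n, j ≤ size n x := by
  classical
  obtain ⟨t, ht, htj⟩ := Set.exists_subset_encard_eq hj
  have hfin : t.Finite := Set.finite_of_encard_eq_coe htj
  obtain ⟨n, hn⟩ : ∃ n, ∀ v ∈ t, v.length < n := by
    obtain ⟨n, hn⟩ := (hfin.image List.length).bddAbove
    exact ⟨n + 1, fun v hv => Nat.lt_succ_of_le (hn ⟨v, hv, rfl⟩)⟩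
  refine ⟨n, ?_⟩
  have h1 : ((t.encard : ℕ∞) : ℝ≥0∞) ≤ size n x := by
    rw [← ENNReal.tsum_set_one, ← tsum_size, tsum_subtype t (fun _ => (1 : ℝ≥0∞))]
    refine ENNReal.tsum_le_tsum fun v => ?_
    by_cases hv : v ∈ t
    · simp [hv, ht hv, hn v hv]
    · simp [hv]
  rw [htj] at h1
  exact_mod_cast h1

theorem size_le_encard (n : ℕ) (x : Marks) : (size n x : ℕ∞) ≤ (vertices x).encard := by
  classical
  have h1 : (size n x : ℝ≥0∞) ≤ ((vertices x).encard : ℕ∞) := by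
    rw [← ENNReal.tsum_set_one, ← tsum_size, tsum_subtype (vertices x) (fun _ => (1 : ℝ≥0∞))]
    refine ENNReal.tsum_le_tsum fun v => ?_
    by_cases hv : v ∈ vertices x
    · simp only [hv, true_and, Set.indicator_of_mem]
      split_ifs <;> simp
    · simp [hv]
  exact_mod_cast h1

theorem size_mono (x : Marks) : Monotone fun n => size n x := by
  classical
  intro m n hmn
  have h1 : (size m x : ℝ≥0∞) ≤ size n x := by
    rw [← tsum_size, ← tsum_size]
    refine ENNReal.tsum_le_tsum fun v => ?_
    by_cases hv : v ∈ vertices x ∧ v.length < m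
    · rw [if_pos hv, if_pos ⟨hv.1, hv.2.trans_le hmn⟩]
    · simp [hv]
  exact_mod_cast h1

variable (h : PMF ℕ) (ν : Measure ℝ) [IsProbabilityMeasure ν]

theorem lintegral_toMeasure (g : ℕ → ℝ≥0∞) : ∫⁻ n, g n ∂h.toMeasure = ∑' n, h n * g n := by
  rw [lintegral_countable']
  refine tsum_congr fun n => ?_
  rw [PMF.toMeasure_apply_singleton h n (measurableSet_singleton n), mul_comm]

theorem lintegral_forest_prod (k : ℕ) {g : Marks → ℝ≥0∞} (hg : Measurable g) :
    ∫⁻ T, ∏ j ∈ Finset.range k, g (T j) ∂(forest h ν) = (∫⁻ x, g x ∂(law h ν)) ^ k := by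
  have hind : ProbabilityTheory.iIndepFun (fun (j : ℕ) (T : ℕ → Marks) => g (T j))
      (forest h ν) :=
    ProbabilityTheory.iIndepFun_infinitePi (P := fun _ : ℕ => law h ν) (X := fun _ => g)
      fun _ => hg
  rw [ProbabilityTheory.lintegral_prod_eq_prod_lintegral_of_indepFun _ _ hind
    fun j => hg.comp (measurable_pi_apply j), Finset.prod_congr rfl (g := fun _ =>
    ∫⁻ x, g x ∂(law h ν)), Finset.prod_const, Finset.card_range]
  intro j _
  exact (measurePreserving_eval_infinitePi (fun _ : ℕ => law h ν) j).lintegral_comp hg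

/-- With G the offspring generating function, branching gives E[L^size (n+1)] = L·G(E[L^size n]).
Since `Y` is a supersolution of y = L·G(y), the induction never leaves [0, Y]. -/
theorem lintegral_pow_size_le {L Y : ℝ≥0∞} (hY : 1 ≤ Y) (hLY : L * ∑' k, h k * Y ^ k ≤ Y)
    (n : ℕ) : ∫⁻ x, L ^ size n x ∂(law h ν) ≤ Y := by
  have hmeas : ∀ n, Measurable fun x : Marks => L ^ size n x := fun n =>
    (measurable_from_top (f := fun k : ℕ => L ^ k)).comp (measurable_size n)
  induction n with
  | zero => simpa [size] using hY
  | succ n ih =>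
    refine le_trans ?_ hLY
    rw [lintegral_build h ν (hmeas _)]
    have h1 : ∀ m : ℕ × ℝ, ∫⁻ T, L ^ size (n + 1) (build m T) ∂(forest h ν) =
        L * (∫⁻ x, L ^ size n x ∂(law h ν)) ^ m.1 := by
      intro m
      rw [← lintegral_forest_prod h ν m.1 (hmeas n), ← lintegral_const_mul]
      · refine lintegral_congr fun T => ?_
        simp [size, offs, build, child_build, pow_add, Finset.prod_pow_eq_pow_sum]
      · exact Finset.measurable_prod _ fun j _ => (hmeas n).comp (measurable_pi_apply j)
    simp only [h1]
    rw [lintegral_prod]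
    · simp only [lintegral_const, measure_univ, mul_one]
      rw [lintegral_toMeasure, ← ENNReal.tsum_mul_left]
      refine ENNReal.tsum_le_tsum fun k => ?_
      rw [mul_left_comm]
      gcongr
    · exact ((measurable_from_top (f := fun k : ℕ => L *
        (∫⁻ x, L ^ size n x ∂(law h ν)) ^ k)).comp measurable_fst).aemeasurable

theorem measurableSet_le_encard {S : Marks → Set (List ℕ)}
    (hS : ∀ w, MeasurableSet {x | w ∈ S x}) (j : ℕ) :
    MeasurableSet {x | (j : ℕ∞) ≤ (S x).encard} := by
  have : {x | (j : ℕ∞) ≤ (S x).encard} =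
      ⋃ F ∈ {F : Finset (List ℕ) | F.card = j}, ⋂ w ∈ F, {x | w ∈ S x} := by
    ext x
    simp only [Set.mem_ofPred_eq, Set.mem_iUnion, Set.mem_iInter, exists_prop]
    constructor
    · intro hj
      obtain ⟨t, ht, htj⟩ := Set.exists_subset_encard_eq hj
      have hfin : t.Finite := Set.finite_of_encard_eq_coe htj
      refine ⟨hfin.toFinset, ?_, fun w hw => ht (hfin.mem_toFinset.1 hw)⟩
      have := hfin.encard_eq_coe_toFinset_card
      rw [htj] at this
      exact_mod_cast this.symm
    · rintro ⟨F, rfl, hF⟩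
      rw [← Set.encard_coe_eq_coe_finsetCard]
      exact Set.encard_le_encard hF
  rw [this]
  exact MeasurableSet.biUnion (Set.to_countable _) fun F _ =>
    MeasurableSet.biInter F.countable_toSet fun w _ => hS w

theorem exists_nat_le_mul_pow {b : ℝ} (hb : 1 < b) :
    ∃ C : ℝ, 0 < C ∧ ∀ i : ℕ, (i : ℝ) ≤ C * b ^ i := by
  refine ⟨1 / (b - 1), by have := sub_pos.2 hb; positivity, fun i => ?_⟩
  have h1 := one_add_mul_le_pow (a := b - 1) (by linarith) i
  have h2 : 0 < b - 1 := by linarith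
  rw [add_sub_cancel] at h1
  rw [div_mul_eq_mul_div, one_mul, le_div_iff₀ h2]
  linarith

/-- The sum over `v` is E[|T|; |T| ≥ j]. Exponential moments control it, and it is the form needed
later, when a union bound runs over all possible cutpoints. -/
theorem exists_tsum_measure_le {L Y : ℝ} (hL : 1 < L) (hY : 1 ≤ Y)
    (hLY : ENNReal.ofReal L * ∑' k, h k * ENNReal.ofReal Y ^ k ≤ ENNReal.ofReal Y) :
    ∃ κ C : ℝ, 0 < κ ∧ κ < 1 ∧ 0 < C ∧ ∀ j : ℕ,
      ∑' v : List ℕ, law h ν {x | v ∈ vertices x ∧ (j : ℕ∞) ≤ (vertices x).encard} ≤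
        ENNReal.ofReal (C * κ ^ j) := by
  classical
  -- One factor `b ^ i` of `L ^ i` absorbs the linear factor `i`, the other one yields the decay
  -- `b⁻¹ ^ j` for `i ≥ j`.
  set b := Real.sqrt L
  have hb : 1 < b := by rw [Real.lt_sqrt] <;> linarith
  have hb0 : 0 < b := by linarith
  have hbb : b * b = L := Real.mul_self_sqrt (by linarith)
  obtain ⟨C, hC, hCi⟩ := exists_nat_le_mul_pow hb
  refine ⟨b⁻¹, C * Y, by positivity, inv_lt_one_of_one_lt₀ hb, by positivity, fun j => ?_⟩
  have hreal : ∀ i : ℕ, j ≤ i → (i : ℝ) ≤ C * b⁻¹ ^ j * L ^ i := by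
    intro i hij
    refine (hCi i).trans ?_
    rw [mul_assoc]
    gcongr
    rw [← hbb, mul_pow, inv_pow, ← div_eq_inv_mul, mul_div_assoc]
    refine le_mul_of_one_le_right (by positivity) ?_
    rw [one_le_div (by positivity)]
    exact pow_le_pow_right₀ hb.le hij
  have hmS : ∀ n, MeasurableSet {x : Marks | j ≤ size n x} := fun n =>
    measurable_size n measurableSet_Ici
  have hmA : ∀ n v, MeasurableSet {x : Marks | (v ∈ vertices x ∧ v.length < n) ∧ j ≤ size n x} :=
    fun n v => by
      refine MeasurableSet.inter ?_ (hmS n)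
      exact (measurableSet_mem_vertices v).inter (MeasurableSet.const _)
  have hn : ∀ n, ∑' v : List ℕ, law h ν {x | (v ∈ vertices x ∧ v.length < n) ∧ j ≤ size n x} ≤
      ENNReal.ofReal (C * Y * b⁻¹ ^ j) := by
    intro n
    have h1 : ∀ v : List ℕ, law h ν {x | (v ∈ vertices x ∧ v.length < n) ∧ j ≤ size n x} =
        ∫⁻ x, (if v ∈ vertices x ∧ v.length < n then 1 else 0) *
          (if j ≤ size n x then 1 else 0) ∂(law h ν) := by
      intro v
      rw [← lintegral_indicator_one (hmA n v)]
      refine lintegral_congr fun x => ?_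
      by_cases h1 : v ∈ vertices x ∧ v.length < n <;> by_cases h2 : j ≤ size n x <;>
        simp [h1, h2]
    simp only [h1]
    rw [← lintegral_tsum]
    · have h2 : ∀ x : Marks, ∑' v : List ℕ, ((if v ∈ vertices x ∧ v.length < n then 1 else 0) *
          (if j ≤ size n x then 1 else 0) : ℝ≥0∞) ≤
          ENNReal.ofReal (C * b⁻¹ ^ j) * ENNReal.ofReal L ^ size n x := by
        intro x
        rw [ENNReal.tsum_mul_right, tsum_size]
        split_ifs with hj
        · rw [mul_one, ← ENNReal.ofReal_pow (by linarith), ← ENNReal.ofReal_mul (by positivity),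
            ← ENNReal.ofReal_natCast]
          exact ENNReal.ofReal_le_ofReal (hreal _ hj)
        · simp
      refine (lintegral_mono h2).trans ?_
      rw [lintegral_const_mul' _ _ ENNReal.ofReal_ne_top]
      refine (mul_le_mul_right (lintegral_pow_size_le h ν (by simpa using hY) hLY n) _).trans ?_
      rw [← ENNReal.ofReal_mul (by positivity)]
      refine ENNReal.ofReal_le_ofReal (le_of_eq (by ring))
    · intro v
      refine (Measurable.mul ?_ ?_).aemeasurable
      · exact Measurable.ite ((measurableSet_mem_vertices v).inter (MeasurableSet.const _))
          measurable_const measurable_const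
      · exact Measurable.ite (hmS n) measurable_const measurable_const
  -- The bound is uniform in the truncation level `n`; on each finite set of words the truncated
  -- events increase to the full ones.
  rw [ENNReal.tsum_eq_iSup_sum]
  refine iSup_le fun F => ?_
  have hlim : Filter.Tendsto (fun n => ∑ v ∈ F,
      law h ν {x | (v ∈ vertices x ∧ v.length < n) ∧ j ≤ size n x}) Filter.atTop
      (nhds (∑ v ∈ F, law h ν {x | v ∈ vertices x ∧ (j : ℕ∞) ≤ (vertices x).encard})) := by
    refine tendsto_finsetSum _ fun v _ => ?_
    have hU : {x : Marks | v ∈ vertices x ∧ (j : ℕ∞) ≤ (vertices x).encard} =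
        ⋃ n, {x | (v ∈ vertices x ∧ v.length < n) ∧ j ≤ size n x} := by
      ext x
      simp only [Set.mem_ofPred_eq, Set.mem_iUnion]
      constructor
      · rintro ⟨hv, hj⟩
        obtain ⟨n, hn⟩ := exists_le_size hj
        exact ⟨max n (v.length + 1), ⟨hv, by simp⟩,
          hn.trans (size_mono x (le_max_left _ _))⟩
      · rintro ⟨n, ⟨hv, -⟩, hj⟩
        exact ⟨hv, le_trans (by exact_mod_cast hj) (size_le_encard n x)⟩
    rw [hU]
    refine tendsto_measure_iUnion_atTop ?_
    intro m n hmn x hx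
    exact ⟨⟨hx.1.1, hx.1.2.trans_le hmn⟩, hx.2.trans (size_mono x hmn)⟩
  refine le_of_tendsto hlim (Filter.Eventually.of_forall fun n => ?_)
  exact (ENNReal.sum_le_tsum F).trans (hn n)

end TreeSize

/-! ### The weight with a virtual root edge, and its dependence on a subtree -/

section PlantedWeight

/-- The bias attached to the root, that is to say, the bias of a virtual edge below the root. -/
noncomputable def bias (x : Marks) : ℝ≥0∞ := ENNReal.ofReal (x []).2

/-- The product of the biases attached to the proper prefixes of a word. -/
noncomputable def pref : List ℕ → Marks → ℝ≥0∞
  | [], _ => 1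
  | j :: v, x => bias x * pref v (child x j)

/-- The product of the biases attached to the prefixes of a word. -/
noncomputable def plantedWeight (v : List ℕ) (x : Marks) : ℝ≥0∞ := pref v x * bias (sub x v)

open Classical in
/-- The total weight of the tree, the virtual edge below the root being taken into account. -/
noncomputable def planted (x : Marks) : ℝ≥0∞ :=
  ∑' v : List ℕ, if v ∈ vertices x then plantedWeight v x else 0

theorem measurable_bias : Measurable bias :=
  ENNReal.measurable_ofReal.comp (measurable_snd.comp (measurable_pi_apply _))

theorem measurable_pref (v : List ℕ) : Measurable (pref v) := by
  induction v with
  | nil => exact measurable_const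
  | cons j v ih => exact measurable_bias.mul (ih.comp (measurable_child j))

theorem measurable_plantedWeight (v : List ℕ) : Measurable (plantedWeight v) :=
  (measurable_pref v).mul (measurable_bias.comp (measurable_sub v))

theorem measurable_planted : Measurable planted := by
  unfold planted
  exact Measurable.tsum fun v =>
    Measurable.ite (measurableSet_mem_vertices v) (measurable_plantedWeight v) measurable_const

theorem plantedWeight_cons (j : ℕ) (v : List ℕ) (x : Marks) :
    plantedWeight (j :: v) x = bias x * plantedWeight v (child x j) := by
  simp [plantedWeight, pref, sub_cons, mul_assoc]

theorem plantedWeight_append (v w : List ℕ) (x : Marks) :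
    plantedWeight (v ++ w) x = pref v x * plantedWeight w (sub x v) := by
  induction v generalizing x with
  | nil => simp [pref, sub_nil]
  | cons j v ih => simp [plantedWeight_cons, ih, pref, sub_cons, mul_assoc]

theorem planted_eq (x : Marks) :
    planted x = bias x * (1 + ∑ j ∈ Finset.range (offs x), planted (child x j)) := by
  classical
  rw [planted, tsum_list, mul_add, mul_one, Finset.mul_sum]
  simp only [nil_mem_vertices, if_true, cons_mem_vertices, plantedWeight_cons]
  congr 1
  · simp [plantedWeight, pref, sub_nil]
  · rw [tsum_eq_sum (s := Finset.range (offs x))]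
    · refine Finset.sum_congr rfl fun j hj => ?_
      simp [Finset.mem_range.1 hj, planted, ← ENNReal.tsum_mul_left]
    · intro j hj
      simp only [Finset.mem_range] at hj
      simp [hj]

theorem bias_le_planted (x : Marks) : bias x ≤ planted x := by
  rw [planted_eq, mul_add, mul_one]
  exact le_self_add

theorem bias_mul_planted_child_le {x : Marks} {j : ℕ} (hj : j < offs x) :
    bias x * planted (child x j) ≤ planted x := by
  rw [planted_eq x]
  refine mul_le_mul_right ?_ _
  exact (Finset.single_le_sum (f := fun i => planted (child x i)) (fun _ _ => zero_le)
    (Finset.mem_range.2 hj)).trans le_add_self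

theorem plantedWeight_le (v : List ℕ) (x : Marks) :
    plantedWeight v x ≤ pref v x * planted (sub x v) := by
  unfold plantedWeight
  gcongr
  exact bias_le_planted _

theorem offs_glue_cons (j : ℕ) (v : List ℕ) (x y : Marks) :
    offs (glue (j :: v) x y) = offs x := by
  simp [offs, glue]

theorem bias_glue_cons (j : ℕ) (v : List ℕ) (x y : Marks) :
    bias (glue (j :: v) x y) = bias x := by
  simp [bias, glue]

theorem child_glue_cons_self (j : ℕ) (v : List ℕ) (x y : Marks) :
    child (glue (j :: v) x y) j = glue v (child x j) y := by
  funext w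
  simp [child, glue]

theorem child_glue_cons_of_ne {i j : ℕ} (hij : i ≠ j) (v : List ℕ) (x y : Marks) :
    child (glue (j :: v) x y) i = child x i := by
  funext w
  simp [child, glue, hij.symm]

theorem mem_vertices_glue_self {v : List ℕ} {x y : Marks} :
    v ∈ vertices (glue v x y) ↔ v ∈ vertices x := by
  induction v generalizing x with
  | nil => simp [nil_mem_vertices]
  | cons j v ih =>
    rw [cons_mem_vertices, cons_mem_vertices, offs_glue_cons, child_glue_cons_self, ih]

/-- Only the words at or below `v` feel the graft, and their weights all contain the factor `pref v
x`. Hence a condition on the total weight turns into a threshold for the weight of the graft. -/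
theorem exists_planted_glue {v : List ℕ} {x : Marks} (hv : v ∈ vertices x) :
    ∃ A : ℝ≥0∞, ∀ y, planted (glue v x y) = A + pref v x * planted y := by
  induction v generalizing x with
  | nil => exact ⟨0, fun y => by simp [pref, glue_nil]⟩
  | cons j v ih =>
    obtain ⟨hj, hv⟩ := cons_mem_vertices.1 hv
    obtain ⟨A, hA⟩ := ih hv
    refine ⟨bias x * (1 + ∑ i ∈ (Finset.range (offs x)).erase j, planted (child x i)) +
      bias x * A, fun y => ?_⟩
    rw [planted_eq, offs_glue_cons, bias_glue_cons,
      ← Finset.add_sum_erase _ _ (Finset.mem_range.2 hj), child_glue_cons_self, hA,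
      Finset.sum_congr rfl fun i hi => by
        rw [child_glue_cons_of_ne (Finset.ne_of_mem_erase hi)], pref]
    ring

theorem tsum_append (v : List ℕ) (g : List ℕ → ℝ≥0∞) [DecidablePred fun u => v <+: u] :
    ∑' u, (if v <+: u then g u else 0) = ∑' w, g (v ++ w) := by
  have hinj : Function.Injective fun w : List ℕ => v ++ w := fun a b hab => by simpa using hab
  rw [← hinj.tsum_eq (f := fun u => if v <+: u then g u else 0)]
  · simp
  · intro u hu
    by_cases hvu : v <+: u
    · obtain ⟨w, rfl⟩ := hvu
      exact ⟨w, rfl⟩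
    · simp [hvu] at hu

open Classical in
theorem pref_mul_planted_sub {v : List ℕ} {x : Marks} (hv : v ∈ vertices x) :
    pref v x * planted (sub x v) =
      ∑' u, if v <+: u then (if u ∈ vertices x then plantedWeight u x else 0) else 0 := by
  rw [tsum_append v fun u => if u ∈ vertices x then plantedWeight u x else 0, planted,
    ← ENNReal.tsum_mul_left]
  refine tsum_congr fun w => ?_
  simp only [append_mem_vertices, hv, true_and, plantedWeight_append]
  split_ifs <;> simp

theorem offs_setBias (x : Marks) (b : ℝ) : offs (setBias x b) = offs x := rfl

theorem vertices_setBias (x : Marks) (b : ℝ) : vertices (setBias x b) = vertices x := by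
  ext w
  cases w with
  | nil => simp [nil_mem_vertices]
  | cons j w =>
    rw [cons_mem_vertices, cons_mem_vertices, offs_setBias]
    rfl

theorem ofReal_prod_bias {x : Marks} (hx : ∀ w, 0 ≤ (x w).2) (w : List ℕ) :
    ENNReal.ofReal (∏ n ∈ Finset.range (w.length + 1), (x (w.take n)).2) = plantedWeight w x := by
  induction w generalizing x with
  | nil => simp [plantedWeight, pref, sub_nil, bias]
  | cons j w ih =>
    rw [Finset.prod_range_succ', ENNReal.ofReal_mul' (hx _), plantedWeight_cons,
      ← ih (x := child x j) fun w => hx (j :: w), mul_comm]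
    rfl

/-- Setting the virtual bias to one removes the virtual edge. Nonnegativity is needed because
`ENNReal.ofReal` is multiplicative only up to truncation of negative numbers. -/
theorem totalWeight_eq {x : Marks} (hx : ∀ w, 0 ≤ (x w).2) :
    totalWeight x = planted (setBias x 1) := by
  classical
  rw [totalWeight, planted, vertices_setBias,
    tsum_subtype (vertices x) (fun v => ENNReal.ofReal (weight x v))]
  refine tsum_congr fun v => ?_
  rw [Set.indicator_apply]
  refine if_congr Iff.rfl ?_ rfl
  cases v with
  | nil => simp [weight, plantedWeight, pref, sub_nil, bias, setBias, build]
  | cons j w =>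
    rw [plantedWeight_cons]
    have h1 : bias (setBias x 1) = 1 := by simp [bias, setBias, build]
    have h2 : child (setBias x 1) j = child x j := rfl
    rw [h1, one_mul, h2, ← ofReal_prod_bias (x := child x j) fun w => hx (j :: w)]
    rfl

theorem planted_eq_bias_mul {x : Marks} :
    planted x = bias x * planted (setBias x 1) := by
  have h1 : bias (setBias x 1) = 1 := by simp [bias, setBias, build]
  rw [planted_eq, planted_eq (setBias x 1), h1, one_mul]
  rfl

/-- All the biases are in `[q, Q]`. -/
def Biased (q Q : ℝ) (x : Marks) : Prop := ∀ w, q ≤ (x w).2 ∧ (x w).2 ≤ Q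

theorem Biased.child {q Q : ℝ} {x : Marks} (hx : Biased q Q x) (j : ℕ) :
    Biased q Q (child x j) := fun w => hx (j :: w)

theorem Biased.sub {q Q : ℝ} {x : Marks} (hx : Biased q Q x) (v : List ℕ) :
    Biased q Q (sub x v) := fun w => hx (v ++ w)

theorem Biased.bias_le {q Q : ℝ} {x : Marks} (hx : Biased q Q x) : bias x ≤ ENNReal.ofReal Q :=
  ENNReal.ofReal_le_ofReal (hx []).2

theorem Biased.le_bias {q Q : ℝ} {x : Marks} (hx : Biased q Q x) : ENNReal.ofReal q ≤ bias x :=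
  ENNReal.ofReal_le_ofReal (hx []).1

theorem Biased.pref_le {q Q : ℝ} {x : Marks} (hx : Biased q Q x) (v : List ℕ) :
    pref v x ≤ ENNReal.ofReal Q ^ v.length := by
  induction v generalizing x with
  | nil => simp [pref]
  | cons j v ih =>
    rw [pref, List.length_cons, pow_succ, mul_comm]
    exact mul_le_mul' (ih (hx.child j)) hx.bias_le

theorem Biased.pref_pos {q Q : ℝ} (hq : 0 < q) {x : Marks} (hx : Biased q Q x) (v : List ℕ) :
    pref v x ≠ 0 := by
  induction v generalizing x with
  | nil => simp [pref]
  | cons j v ih =>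
    rw [pref]
    refine mul_ne_zero ?_ (ih (hx.child j))
    exact ((ENNReal.ofReal_pos.2 hq).trans_le hx.le_bias).ne'

theorem pref_ne_top (v : List ℕ) (x : Marks) : pref v x ≠ ⊤ := by
  induction v generalizing x with
  | nil => simp [pref]
  | cons j v ih => exact ENNReal.mul_ne_top ENNReal.ofReal_ne_top (ih _)

theorem Biased.plantedWeight_le {q Q : ℝ} {x : Marks} (hx : Biased q Q x) (v : List ℕ) :
    plantedWeight v x ≤ ENNReal.ofReal Q ^ (v.length + 1) := by
  rw [pow_succ]
  exact mul_le_mul' (hx.pref_le v) (hx.sub v).bias_le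

theorem ae_biased (h : PMF ℕ) (ν : Measure ℝ) [IsProbabilityMeasure ν] {q Q : ℝ}
    (hν : ν (Set.Icc q Q)ᶜ = 0) : ∀ᵐ x ∂(law h ν), Biased q Q x := by
  unfold Biased
  rw [ae_all_iff]
  intro w
  have h1 : MeasurePreserving (fun x : Marks => (x w).2) (law h ν) ν :=
    (measurePreserving_snd (μ := h.toMeasure) (ν := ν)).comp
      (measurePreserving_eval_infinitePi (fun _ : List ℕ => h.toMeasure.prod ν) w)
  exact h1.quasiMeasurePreserving.ae (p := fun b => q ≤ b ∧ b ≤ Q) hν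

end PlantedWeight

/-! ### Consequences of subcriticality and of the exponential offspring tail -/

section Offspring

variable {h : PMF ℕ} {a : ℝ}

theorem apply_le_of_tail
    (htail : ∀ n : ℕ, h.toMeasure (Set.Ici n) ≤ ENNReal.ofReal (Real.exp (-(a * n)))) (n : ℕ) :
    (h n).toReal ≤ Real.exp (-a) ^ n := by
  rw [← Real.exp_nat_mul, mul_comm, neg_mul]
  refine ENNReal.toReal_le_of_le_ofReal (Real.exp_pos _).le (le_trans ?_ (htail n))
  rw [← PMF.toMeasure_apply_singleton h n (measurableSet_singleton n)]
  exact measure_mono (by simp)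

theorem tsum_sq_ne_top (ha : 0 < a)
    (htail : ∀ n : ℕ, h.toMeasure (Set.Ici n) ≤ ENNReal.ofReal (Real.exp (-(a * n)))) :
    ∑' n, h n * (n : ℝ≥0∞) ^ 2 ≠ ⊤ := by
  have hr : Real.exp (-a) < 1 := Real.exp_lt_one_iff.2 (by linarith)
  have hs : Summable fun n : ℕ => (n : ℝ) ^ 2 * Real.exp (-a) ^ n :=
    summable_pow_mul_geometric_of_norm_lt_one 2 (by
      rw [Real.norm_of_nonneg (Real.exp_pos _).le]; exact hr)
  refine ne_top_of_le_ne_top hs.tsum_ofReal_ne_top (ENNReal.tsum_le_tsum fun n => ?_)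
  rw [ENNReal.ofReal_mul (by positivity), mul_comm, ENNReal.ofReal_pow (by positivity),
    ENNReal.ofReal_natCast, ← ENNReal.ofReal_toReal (h.apply_ne_top n)]
  gcongr
  exact apply_le_of_tail htail n

/-- The generating function has slope less than one at 1 and extends analytically beyond 1, so its
graph lies strictly below the diagonal just to the right of 1; this leaves room for a factor `L >
1`. The series `∑ p k * k * y ^ k` stands in for the derivative. -/
theorem exists_generating_le (hmean : ∑' n : ℕ, (n : ℝ≥0∞) * h n < 1) (ha : 0 < a)
    (htail : ∀ n : ℕ, h.toMeasure (Set.Ici n) ≤ ENNReal.ofReal (Real.exp (-(a * n)))) :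
    ∃ L Y : ℝ, 1 < L ∧ 1 ≤ Y ∧
      ENNReal.ofReal L * ∑' k, h k * ENNReal.ofReal Y ^ k ≤ ENNReal.ofReal Y := by
  set p : ℕ → ℝ := fun k => (h k).toReal
  have hp0 : ∀ k, 0 ≤ p k := fun k => ENNReal.toReal_nonneg
  have hofp : ∀ k, ENNReal.ofReal (p k) = h k := fun k => ENNReal.ofReal_toReal (h.apply_ne_top k)
  set y₀ := Real.exp (a / 2)
  have hy₀ : 1 < y₀ := Real.one_lt_exp_iff.2 (by linarith)
  set r := Real.exp (-(a / 2))
  have hr : r < 1 := Real.exp_lt_one_iff.2 (by linarith)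
  have hr0 : 0 < r := Real.exp_pos _
  have hry : Real.exp (-a) * y₀ = r := by
    rw [← Real.exp_add]; congr 1; ring
  have hs : Summable fun n : ℕ => (n : ℝ) ^ 1 * r ^ n :=
    summable_pow_mul_geometric_of_norm_lt_one 1 (by rwa [Real.norm_of_nonneg hr0.le])
  have hbd : ∀ (k : ℕ) (y : ℝ), y ∈ Set.Icc 0 y₀ → p k * y ^ k ≤ r ^ k := by
    intro k y hy
    rw [← hry, mul_pow]
    have := apply_le_of_tail htail k
    have h2 := pow_le_pow_left₀ hy.1 hy.2 k
    have h3 := pow_nonneg hy.1 k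
    gcongr
  have hbd' : ∀ (k : ℕ) (y : ℝ), y ∈ Set.Icc 0 y₀ → ‖p k * k * y ^ k‖ ≤ (k : ℝ) ^ 1 * r ^ k := by
    intro k y hy
    have h3 := pow_nonneg hy.1 k
    rw [Real.norm_of_nonneg (by have := hp0 k; positivity)]
    have := hbd k y hy
    calc p k * k * y ^ k = k * (p k * y ^ k) := by ring
      _ ≤ k * r ^ k := by gcongr
      _ = _ := by ring
  have hcont : ContinuousOn (fun y : ℝ => ∑' k : ℕ, p k * k * y ^ k) (Set.Icc 0 y₀) :=
    continuousOn_tsum (fun k => by fun_prop) hs hbd'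
  have hF1 : ∑' k : ℕ, p k * k * (1 : ℝ) ^ k < 1 := by
    have h1 : ENNReal.ofReal (∑' k : ℕ, p k * k * (1 : ℝ) ^ k) = ∑' n : ℕ, (n : ℝ≥0∞) * h n := by
      rw [ENNReal.ofReal_tsum_of_nonneg]
      · refine tsum_congr fun k => ?_
        rw [one_pow, mul_one, ENNReal.ofReal_mul (hp0 k), hofp, ENNReal.ofReal_natCast, mul_comm]
      · intro k
        have := hp0 k
        positivity
      · exact Summable.of_norm_bounded hs fun k => hbd' k 1 ⟨by norm_num, hy₀.le⟩
    rw [← h1] at hmean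
    exact ENNReal.ofReal_lt_one.1 hmean
  obtain ⟨y, hy1, hy2⟩ : ∃ y ∈ Set.Ioo (1 : ℝ) y₀, ∑' k : ℕ, p k * k * y ^ k < 1 := by
    have hc : ContinuousWithinAt (fun y : ℝ => ∑' k : ℕ, p k * k * y ^ k) (Set.Ioo 1 y₀) 1 :=
      (hcont 1 ⟨by norm_num, hy₀.le⟩).mono fun z hz => ⟨by linarith [hz.1], hz.2.le⟩
    have hev := hc.eventually (gt_mem_nhds hF1)
    have : (nhdsWithin (1 : ℝ) (Set.Ioo 1 y₀)).NeBot := by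
      rw [nhdsWithin_Ioo_eq_nhdsGT hy₀]; infer_instance
    obtain ⟨y, hy, hy'⟩ := (hev.and self_mem_nhdsWithin).exists
    exact ⟨y, hy', hy⟩
  set F := ∑' k : ℕ, p k * k * y ^ k
  have hyI : y ∈ Set.Icc 0 y₀ := ⟨by linarith [hy1.1], hy1.2.le⟩
  have hy0 : 0 < y := by linarith [hy1.1]
  have hF0 : 0 ≤ F := tsum_nonneg fun k => by have := hp0 k; positivity
  have hsum1 : Summable fun k : ℕ => p k * y ^ k := by
    refine Summable.of_nonneg_of_le (fun k => by have := hp0 k; positivity)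
      (fun k => hbd k y hyI) (summable_geometric_of_lt_one hr0.le hr)
  have hsumF : Summable fun k : ℕ => p k * k * y ^ k :=
    Summable.of_norm_bounded hs fun k => hbd' k y hyI
  have hsump : HasSum p 1 := by
    have := h.tsum_coe
    have h2 : Summable p := ENNReal.summable_toReal (by rw [this]; simp)
    rw [h2.hasSum_iff, ← ENNReal.tsum_toReal_eq h.apply_ne_top, this]
    rfl
  have hG : ∑' k, p k * y ^ k ≤ 1 + (y - 1) * F := by
    have hs3 : HasSum (fun k => p k + (y - 1) * (p k * k * y ^ k)) (1 + (y - 1) * F) :=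
      hsump.add (hsumF.hasSum.mul_left _)
    refine hasSum_le (fun k => ?_) hsum1.hasSum hs3
    -- A convexity bound obtained from Bernoulli's inequality for `y⁻¹`; summed against `p`, it
    -- bounds the generating function by `1 + (y - 1) * F`, which is less than `y` because `F < 1`.
    have hbern : y ^ k ≤ 1 + (y - 1) * (k * y ^ k) := by
      have h1 := one_add_mul_le_pow (a := y⁻¹ - 1) (by have := inv_pos.2 hy0; linarith) k
      rw [add_sub_cancel] at h1
      have h2 : (1 + k * (y⁻¹ - 1)) * y ^ k ≤ y⁻¹ ^ k * y ^ k := by gcongr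
      rw [← mul_pow, inv_mul_cancel₀ hy0.ne', one_pow] at h2
      have h3 : 1 - y ≤ y⁻¹ - 1 := by
        have : 0 ≤ y⁻¹ * (y - 1) ^ 2 := by positivity
        have e : y⁻¹ * (y - 1) ^ 2 = y - 2 + y⁻¹ := by field_simp; ring
        linarith
      have h4 : (k : ℝ) * y ^ k * (1 - y) ≤ k * y ^ k * (y⁻¹ - 1) := by gcongr
      nlinarith
    have := mul_le_mul_of_nonneg_left hbern (hp0 k)
    nlinarith
  have hden : 0 < 1 + (y - 1) * F := by
    have := mul_nonneg (sub_pos.2 hy1.1).le hF0; linarith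
  refine ⟨y / (1 + (y - 1) * F), y, ?_, hy1.1.le, ?_⟩
  · rw [one_lt_div hden]
    nlinarith [hy1.1]
  · have h1 : ∑' k, h k * ENNReal.ofReal y ^ k = ENNReal.ofReal (∑' k, p k * y ^ k) := by
      rw [ENNReal.ofReal_tsum_of_nonneg (fun k => by have := hp0 k; positivity) hsum1]
      refine tsum_congr fun k => ?_
      rw [ENNReal.ofReal_mul (hp0 k), hofp, ENNReal.ofReal_pow hy0.le]
    rw [h1, ← ENNReal.ofReal_mul (by positivity)]
    refine ENNReal.ofReal_le_ofReal ?_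
    rw [div_mul_eq_mul_div, div_le_iff₀ hden]
    gcongr

end Offspring

/-! ### A drift function for the chain of residual heights -/

section Lyapunov

/-- A drift function for the Markov chain `r ↦ max (r - 1) H`, killed at `0`, where `H` is a
random variable that has an exponential moment and vanishes with positive probability. -/
theorem exists_drift {p : ℕ → ℝ} (hp : ∀ s, 0 ≤ p s) (hp0 : 0 < p 0) {l : ℝ} (hl : 1 < l)
    (hs : Summable fun s => p s * l ^ s) :
    ∃ ρ : ℝ, 0 < ρ ∧ ρ < 1 ∧ ∃ V : ℕ → ℝ, V 0 = 0 ∧ (∀ r, 1 ≤ V (r + 1)) ∧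
      ∀ r, Summable (fun s => p s * V (max r s)) ∧
        ∑' s, p s * V (max r s) ≤ ρ * (∑' s, p s) * V (r + 1) := by
  have hl0 : 0 < l := by linarith
  have hsp : Summable p := hs.of_nonneg_of_le hp fun s =>
    le_mul_of_one_le_right (hp s) (one_le_pow₀ hl.le)
  set m := ∑' s, p s with hm
  have hm0 : 0 < m := hsp.tsum_pos hp 0 hp0
  set P : ℕ → ℝ := fun r => ∑ s ∈ Finset.range (r + 1), p s with hP
  have hP0 : ∀ r, 0 < P r := fun r => hp0.trans_le
    (Finset.single_le_sum (fun s _ => hp s) (Finset.mem_range.2 (Nat.succ_pos r)))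
  have hPm : ∀ r, P r ≤ m := fun r => hsp.sum_le_tsum _ fun s _ => hp s
  -- `π r` is the probability that the chain goes straight down from `r` to `0`. Thus `1 - π` does
  -- not increase on average along the chain, and the amount lost is `gain r`.
  set π : ℕ → ℝ := fun r => ∏ i ∈ Finset.range r, (P i / m) with hπ
  have hπ0 : ∀ r, 0 < π r := fun r => Finset.prod_pos fun i _ => div_pos (hP0 i) hm0
  have hπ1 : ∀ r, π r ≤ 1 := fun r =>
    Finset.prod_le_one (fun i _ => (div_pos (hP0 i) hm0).le) fun i _ => (div_le_one hm0).2 (hPm i)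
  have hπs : ∀ r, P r * π r = m * π (r + 1) := by
    intro r
    simp only [hπ, Finset.prod_range_succ]
    field_simp
  -- The exponential part of `V`: one downward step multiplies it by at most `l⁻¹`, which beats the
  -- jumps when the state is large.
  let E : ℕ → ℝ := fun a => if a = 0 then 0 else l ^ (a - 1)
  have hE0 : ∀ a, 0 ≤ E a := fun a => by simp only [E]; split_ifs <;> positivity
  have hEl : ∀ a, E a ≤ l⁻¹ * l ^ a := by
    intro a
    cases a with
    | zero => simp [E, hl0.le]
    | succ a => simp [E, pow_succ']; field_simp; simp
  have hEl' : ∀ a, E a ≤ l ^ a := fun a => (hEl a).trans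
    (mul_le_of_le_one_left (by positivity) (inv_le_one_of_one_le₀ hl.le))
  set η := (1 - l⁻¹) / 2 with hη
  have hη0 : 0 < η := by have := inv_lt_one_of_one_lt₀ hl; rw [hη]; linarith
  have hη1 : η < 1 := by have := inv_pos.2 hl0; rw [hη]; linarith
  set gain : ℕ → ℝ := fun r => ∑' s, if r < s then p s * π s else 0 with hgain
  set tail : ℕ → ℝ := fun r => ∑' s, if r < s then p s * E s else 0 with htail
  have hsg : ∀ r, Summable fun s => if r < s then p s * π s else 0 := by
    intro r
    refine hsp.of_nonneg_of_le (fun s => ?_) fun s => ?_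
    · split_ifs
      · exact mul_nonneg (hp s) (hπ0 s).le
      · exact le_rfl
    · split_ifs
      · exact mul_le_of_le_one_right (hp s) (hπ1 s)
      · exact hp s
  have hst : ∀ r, Summable fun s => if r < s then p s * E s else 0 := by
    intro r
    refine hs.of_nonneg_of_le (fun s => ?_) fun s => ?_
    · split_ifs
      · exact mul_nonneg (hp s) (hE0 s)
      · exact le_rfl
    · split_ifs
      · exact mul_le_mul_of_nonneg_left (hEl' s) (hp s)
      · have := hp s; positivity
  have hgs0 : ∀ r s, 0 ≤ if r < s then p s * π s else 0 := fun r s => by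
    split_ifs
    · exact mul_nonneg (hp s) (hπ0 s).le
    · exact le_rfl
  have hg0 : ∀ r, 0 ≤ gain r := fun r => tsum_nonneg (hgs0 r)
  have ht0 : ∀ r, 0 ≤ tail r := fun r => tsum_nonneg fun s => by
    split_ifs
    · exact mul_nonneg (hp s) (hE0 s)
    · exact le_rfl
  have hgt : ∀ r, tail r ≤ tail r / gain r * gain r := by
    intro r
    -- If the gain vanishes then, since `π > 0`, no jump above `r` is possible and `tail r` vanishes
    -- too; so the quotient is harmless even with the convention `x / 0 = 0`.
    rcases (hg0 r).eq_or_lt with h0 | h0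
    · have hz : ∀ s, r < s → p s = 0 := by
        intro s hrs
        have h1 : HasSum (fun s => if r < s then p s * π s else 0) 0 := by
          have := (hsg r).hasSum
          rwa [show (∑' s, if r < s then p s * π s else 0) = 0 from h0.symm] at this
        have h2 := congrFun ((hasSum_zero_iff_of_nonneg (hgs0 r)).1 h1) s
        simp only [hrs, if_true, Pi.zero_apply, mul_eq_zero, (hπ0 s).ne', or_false] at h2
        exact h2
      have : tail r = 0 := by
        simp only [htail]
        refine (tsum_congr fun s => ?_).trans tsum_zero
        split_ifs with hrs
        · rw [hz s hrs, zero_mul]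
        · rfl
      rw [this]; simp
    · rw [div_mul_cancel₀ _ h0.ne']
  have htS : ∀ r, tail r ≤ ∑' s, p s * l ^ s := by
    intro r
    refine (hst r).tsum_le_tsum (fun s => ?_) hs
    split_ifs
    · exact mul_le_mul_of_nonneg_left (hEl' s) (hp s)
    · have := hp s; positivity
  -- From `r₀` on, the jump term is absorbed by half of the exponential contraction `1 - l⁻¹ = 2 *
  -- η`; for the finitely many smaller states it is absorbed by `D` times the gain of `1 - π`.
  obtain ⟨r₀, hr₀⟩ : ∃ r₀ : ℕ, (∑' s, p s * l ^ s) / (m * η) < l ^ r₀ :=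
    pow_unbounded_of_one_lt _ hl
  set D := ∑ r ∈ Finset.range r₀, tail r / gain r with hD
  have hDr : ∀ r, 0 ≤ tail r / gain r := fun r => div_nonneg (ht0 r) (hg0 r)
  have hD0 : 0 ≤ D := Finset.sum_nonneg fun r _ => hDr r
  have hdrift : ∀ r, tail r ≤ D * gain r + m * η * l ^ r := by
    intro r
    by_cases hr : r < r₀
    · have h1 : tail r / gain r ≤ D :=
        Finset.single_le_sum (fun r _ => hDr r) (Finset.mem_range.2 hr)
      have h2 := mul_le_mul_of_nonneg_right h1 (hg0 r)
      have : 0 ≤ m * η * l ^ r := by positivity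
      linarith [hgt r]
    · have h1 : l ^ r₀ ≤ l ^ r := pow_le_pow_right₀ hl.le (not_lt.1 hr)
      rw [div_lt_iff₀ (by positivity)] at hr₀
      have h2 : l ^ r₀ * (m * η) ≤ l ^ r * (m * η) := by gcongr
      have h3 := mul_nonneg hD0 (hg0 r)
      linarith [htS r]
  set V : ℕ → ℝ := fun a => D * (1 - π a) + E a with hV
  have hsV : ∀ r, Summable fun s => p s * V (max r s) := by
    intro r
    refine Summable.of_nonneg_of_le (fun s => mul_nonneg (hp s) (add_nonneg
      (mul_nonneg hD0 (sub_nonneg.2 (hπ1 _))) (hE0 _))) (fun s => ?_)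
      (((hsp.mul_left D)).add (hs.mul_left (l ^ r)))
    have h1 : D * (1 - π (max r s)) ≤ D := by
      have := mul_nonneg hD0 (hπ0 (max r s)).le
      linarith
    have h2 : E (max r s) ≤ l ^ r * l ^ s := by
      rw [← pow_add]
      exact (hEl' _).trans (pow_le_pow_right₀ hl.le (by omega))
    have := mul_le_mul_of_nonneg_left (add_le_add h1 h2) (hp s)
    simp only [hV]
    linarith
  have hbound : ∀ r, ∑' s, p s * V (max r s) ≤
      D * (m - m * π (r + 1) - gain r) + (m * E r + tail r) := by
    intro r
    have hfin : HasSum (fun s => if s ∈ Finset.range (r + 1) then p s * π r else 0)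
        (P r * π r) := by
      have : HasSum (fun s => if s ∈ Finset.range (r + 1) then p s * π r else 0)
          (∑ s ∈ Finset.range (r + 1), if s ∈ Finset.range (r + 1) then p s * π r else 0) :=
        hasSum_sum_of_ne_finset_zero fun b hb => by simp [hb]
      rwa [Finset.sum_congr rfl (g := fun s => p s * π r) (fun s hs => by simp [hs]),
        ← Finset.sum_mul] at this
    have h1 := ((hsp.hasSum.sub (hfin.add (hsg r).hasSum)).mul_left D).add
      ((hsp.hasSum.mul_right (E r)).add (hst r).hasSum)
    have h2 : D * (m - m * π (r + 1) - gain r) + (m * E r + tail r) =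
        D * (m - (P r * π r + gain r)) + (m * E r + tail r) := by rw [hπs]; ring
    rw [h2]
    refine hasSum_le (fun s => ?_) (hsV r).hasSum h1
    by_cases hrs : r < s
    · have h3 : s ∉ Finset.range (r + 1) := by simp; omega
      simp only [hV, max_eq_right hrs.le, hrs, h3, if_true, if_false]
      have := mul_nonneg (hp s) (hE0 r)
      nlinarith
    · have h3 : s ∈ Finset.range (r + 1) := by simp; omega
      simp only [hV, max_eq_left (not_lt.1 hrs), hrs, h3, if_true, if_false]
      nlinarith
  -- The remaining contraction is `m * η * l ^ r`, and `V (r + 1) ≤ (D + 1) * l ^ r` turns it into a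
  -- multiple of `V (r + 1)`.
  refine ⟨1 - η / (D + 1), ?_, ?_, V, ?_, ?_, fun r => ⟨hsV r, (hbound r).trans ?_⟩⟩
  · have : η / (D + 1) < 1 := by rw [div_lt_one (by linarith)]; linarith
    linarith
  · have : 0 < η / (D + 1) := by positivity
    linarith
  · simp [hV, hπ, E]
  · intro r
    have h1 : 0 ≤ D * (1 - π (r + 1)) := mul_nonneg hD0 (sub_nonneg.2 (hπ1 _))
    have h2 : 1 ≤ E (r + 1) := by simpa [E] using one_le_pow₀ hl.le
    simp only [hV]; linarith
  · have hEr : E (r + 1) = l ^ r := by simp [E]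
    have h1 := hdrift r
    have h2 := mul_le_mul_of_nonneg_left (hEl r) hm0.le
    have h3 : l⁻¹ = 1 - 2 * η := by rw [hη]; ring
    rw [h3] at h2
    set e := η / (D + 1) with he
    have h4 : e * (D + 1) = η := by rw [he]; field_simp
    have h5 : 1 ≤ l ^ r := one_le_pow₀ hl.le
    have he0 : 0 ≤ e := by positivity
    have h6 : e * (D * (1 - π (r + 1)) + l ^ r) ≤ η * l ^ r := by
      have h7 : D * (1 - π (r + 1)) ≤ D * l ^ r := by
        have := hπ0 (r + 1)
        gcongr
        linarith
      calc e * (D * (1 - π (r + 1)) + l ^ r) ≤ e * (D * l ^ r + l ^ r) := by gcongr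
        _ = η * l ^ r := by rw [← h4]; ring
    have h8 := mul_le_mul_of_nonneg_left h6 hm0.le
    simp only [hV, hEr]
    nlinarith

end Lyapunov

/-! ### The heights of the trees at the siblings of a child -/

section Siblings

/-- No child of the root other than the `j`-th one has a descendant `s` levels below itself. -/
def Others (s j : ℕ) (x : Marks) : Prop := ∀ i < offs x, i ≠ j → Ext s (child x i)

/-- The `j`-th child of the root exists, and `s` is the maximal height of the subtrees at its
siblings. -/
def Hgt (s j : ℕ) (x : Marks) : Prop :=
  j < offs x ∧ Others (s + 1) j x ∧ (s = 0 ∨ ¬ Others s j x)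

theorem Others.mono {s t j : ℕ} (hst : s ≤ t) {x : Marks} (hx : Others s j x) : Others t j x :=
  fun i hi hij => (hx i hi hij).mono hst

theorem measurableSet_lt_offs (j : ℕ) : MeasurableSet {x | j < offs x} :=
  measurable_offs measurableSet_Ioi

theorem measurableSet_others (s j : ℕ) : MeasurableSet {x | Others s j x} := by
  have : {x | Others s j x} =
      ⋂ i, {x : Marks | i < offs x ∧ i ≠ j}ᶜ ∪ {x | Ext s (child x i)} := by
    ext x
    simp [Others, imp_iff_not_or]
    grind
  rw [this]
  exact MeasurableSet.iInter fun i =>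
    ((measurableSet_lt_offs i).inter (MeasurableSet.const _)).compl.union
      (measurable_child i (measurableSet_ext s))

theorem measurableSet_hgt (s j : ℕ) : MeasurableSet {x | Hgt s j x} :=
  (measurableSet_lt_offs j).inter ((measurableSet_others _ j).inter
    ((MeasurableSet.const _).union (measurableSet_others s j).compl))

theorem offs_glue_setBias (j : ℕ) (x : Marks) (b : ℝ) (y : Marks) :
    offs (glue [j] (setBias x b) y) = offs x := by
  rw [offs_glue_cons, offs_setBias]

theorem others_glue_setBias (s j : ℕ) (x : Marks) (b : ℝ) (y : Marks) :
    Others s j (glue [j] (setBias x b) y) ↔ Others s j x := by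
  unfold Others
  rw [offs_glue_setBias]
  refine forall_congr' fun i => forall_congr' fun _ => forall_congr' fun hij => ?_
  rw [child_glue_cons_of_ne hij]
  rfl

theorem hgt_glue_setBias (s j : ℕ) (x : Marks) (b : ℝ) (y : Marks) :
    Hgt s j (glue [j] (setBias x b) y) ↔ Hgt s j x := by
  simp only [Hgt, offs_glue_setBias, others_glue_setBias]

theorem le_size_of_not_ext {s : ℕ} {x : Marks} (hx : ¬ Ext s x) : s ≤ size s x := by
  induction s generalizing x with
  | zero => exact Nat.zero_le _
  | succ s ih =>
    simp only [Ext, not_forall] at hx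
    obtain ⟨i, hi, hx⟩ := hx
    have h1 := ih hx
    have h2 : size s (child x i) ≤ ∑ j ∈ Finset.range (offs x), size s (child x j) :=
      Finset.single_le_sum (f := fun j => size s (child x j)) (fun _ _ => Nat.zero_le _)
        (Finset.mem_range.2 hi)
    simp only [size]
    omega

theorem ext_one_iff {x : Marks} : Ext 1 x ↔ offs x = 0 := by
  simp only [Ext, imp_false, not_lt]
  exact ⟨fun H => Nat.le_zero.1 (H 0), fun H i => by omega⟩

variable (h : PMF ℕ) (ν : Measure ℝ) [IsProbabilityMeasure ν]

/-- The expected number of children of the root whose siblings carry trees of maximal height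
`s`. -/
noncomputable def sibling (s : ℕ) : ℝ≥0∞ := ∑' j, law h ν {x | Hgt s j x}

/-- The expected number of children of the root whose siblings carry trees of height less than
`s`. -/
noncomputable def siblingLt (s : ℕ) : ℝ≥0∞ := ∑' j, law h ν {x | j < offs x ∧ Others s j x}

/-- Splits according to the exact maximal height. It shows that the weights of the lower bound are
partial sums of the jump weights of the upper bound, so that both grow at the same rate. -/
theorem siblingLt_succ (s : ℕ) :
    siblingLt h ν (s + 1) = ∑ i ∈ Finset.range (s + 1), sibling h ν i := by
  induction s with
  | zero => simp [siblingLt, sibling, Hgt]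
  | succ s ih =>
    rw [Finset.sum_range_succ, ← ih]
    simp only [siblingLt, sibling]
    rw [← ENNReal.tsum_add]
    refine tsum_congr fun j => ?_
    rw [← measure_union _ (measurableSet_hgt _ j)]
    · congr 1
      ext x
      simp only [Set.mem_ofPred_eq, Set.mem_union, Hgt]
      have : Others (s + 1) j x → Others (s + 1 + 1) j x := Others.mono (Nat.le_succ _)
      by_cases h1 : Others (s + 1) j x <;> simp [h1, this]
    · rw [Set.disjoint_left]
      rintro x ⟨-, h1⟩ ⟨-, -, h2⟩
      simp [h1] at h2

theorem law_offs (A : Set ℕ) : law h ν {x | offs x ∈ A} = h.toMeasure A := by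
  have h1 : MeasurePreserving (fun x : Marks => offs x) (law h ν) h.toMeasure :=
    (measurePreserving_fst (μ := h.toMeasure) (ν := ν)).comp
      (measurePreserving_eval_infinitePi (fun _ : List ℕ => h.toMeasure.prod ν) [])
  exact h1.measure_preimage (MeasurableSet.of_discrete (s := A)).nullMeasurableSet

theorem tsum_tsum_law_lt_offs :
    ∑' j, ∑' i, law h ν {x | j < offs x ∧ i < offs x} = ∑' n, h n * (n : ℝ≥0∞) ^ 2 := by
  classical
  have h0 : ∀ j i, law h ν {x | j < offs x ∧ i < offs x} =
      ∑' n, h n * ((if j < n then 1 else 0) * (if i < n then 1 else 0)) := by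
    intro j i
    rw [show {x : Marks | j < offs x ∧ i < offs x} = {x | offs x ∈ {n | j < n ∧ i < n}} from rfl,
      law_offs, PMF.toMeasure_apply_eq_tsum]
    refine tsum_congr fun n => ?_
    by_cases h1 : j < n <;> by_cases h2 : i < n <;> simp [h1, h2]
  have hsum : ∀ n : ℕ, ∑' j : ℕ, (if j < n then 1 else 0 : ℝ≥0∞) = n := by
    intro n
    rw [tsum_eq_sum (s := Finset.range n) (fun j hj => by simpa using hj),
      Finset.sum_congr rfl (g := fun _ => 1) fun j hj => by simpa using hj]
    simp
  simp only [h0]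
  have h1 : ∀ j : ℕ, ∑' i, ∑' n, h n * ((if j < n then 1 else 0) * (if i < n then 1 else 0)) =
      ∑' n, h n * n * (if j < n then 1 else 0) := by
    intro j
    rw [ENNReal.tsum_comm]
    refine tsum_congr fun n => ?_
    rw [ENNReal.tsum_mul_left, ENNReal.tsum_mul_left, hsum]
    ring
  simp only [h1]
  rw [ENNReal.tsum_comm]
  refine tsum_congr fun n => ?_
  rw [ENNReal.tsum_mul_left, hsum]
  ring

/-- A union bound over pairs of children `j`, `i` with a tall tree at `i`: this tree is independent
of the offspring number of the root, whose second moment counts the pairs. -/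
theorem sibling_le (s : ℕ) :
    sibling h ν s ≤ (∑' n, h n * (n : ℝ≥0∞) ^ 2) *
      (if s = 0 then 1 else law h ν {x | ¬ Ext s x}) := by
  classical
  rw [← tsum_tsum_law_lt_offs h ν, ← ENNReal.tsum_mul_right]
  refine ENNReal.tsum_le_tsum fun j => ?_
  rw [← ENNReal.tsum_mul_right]
  split_ifs with hs
  · simp only [mul_one]
    refine le_trans (measure_mono fun x hx => ?_) (ENNReal.le_tsum j)
    exact ⟨hx.1, hx.1⟩
  · have hsub : {x | Hgt s j x} ⊆ ⋃ i, {x | (j < offs x ∧ i < offs x) ∧ ¬ Ext s (child x i)} := by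
      rintro x ⟨hj, -, hx⟩
      have hx := hx.resolve_left hs
      simp only [Others, not_forall] at hx
      obtain ⟨i, hi, -, hx⟩ := hx
      exact Set.mem_iUnion.2 ⟨i, ⟨hj, hi⟩, hx⟩
    refine (measure_mono hsub).trans ((measure_iUnion_le _).trans
      (ENNReal.tsum_le_tsum fun i => ?_))
    have hK : MeasurableSet {x : Marks | j < offs x ∧ i < offs x} :=
      (measurableSet_lt_offs j).inter (measurableSet_lt_offs i)
    have hE : MeasurableSet {x : Marks | ¬ Ext s x} := (measurableSet_ext s).compl
    have := lintegral_indicator_bias_child h ν i hK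
      (fun x b y => by simp only [Set.mem_ofPred_eq, offs_glue_setBias])
      (g := fun p => {x : Marks | ¬ Ext s x}.indicator 1 p.2)
      ((measurable_one.indicator hE).comp measurable_snd)
    simp only [lintegral_const, measure_univ, mul_one, lintegral_indicator_one hE] at this
    have hKE : MeasurableSet {x | (j < offs x ∧ i < offs x) ∧ ¬ Ext s (child x i)} :=
      hK.inter (measurable_child i hE)
    rw [← this, ← lintegral_indicator_one hKE]
    refine lintegral_mono fun x => ?_
    by_cases h1 : j < offs x ∧ i < offs x <;> by_cases h2 : Ext s (child x i) <;>
      simp [Set.indicator_apply, h1, h2]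

variable {h}

theorem exists_pos_of_ne (h0 : h 0 ≠ 1) : ∃ k, k ≠ 0 ∧ h k ≠ 0 := by
  by_contra H
  push Not at H
  refine h0 ?_
  rw [← h.tsum_coe, tsum_eq_single 0 H]

theorem apply_zero_ne_zero (hmean : ∑' n : ℕ, (n : ℝ≥0∞) * h n < 1) : h 0 ≠ 0 := by
  intro H
  refine hmean.not_ge ?_
  rw [← h.tsum_coe]
  refine ENNReal.tsum_le_tsum fun n => ?_
  rcases Nat.eq_zero_or_pos n with rfl | hn
  · simp [H]
  · exact le_mul_of_one_le_left zero_le (by exact_mod_cast hn)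

/-- With positive probability the root has children and all of them are leaves. -/
theorem sibling_zero_ne_zero (hmean : ∑' n : ℕ, (n : ℝ≥0∞) * h n < 1) (h0 : h 0 ≠ 1) :
    sibling h ν 0 ≠ 0 := by
  classical
  obtain ⟨k, hk, hhk⟩ := exists_pos_of_ne h0
  set s : Finset (List ℕ) := insert [] ((Finset.range k).image fun i => [i])
  set t : List ℕ → Set (ℕ × ℝ) := fun w => if w = [] then {k} ×ˢ Set.univ else {0} ×ˢ Set.univ
  have ht : ∀ w, MeasurableSet (t w) := fun w => by
    simp only [t]
    split_ifs <;> exact (measurableSet_singleton _).prod MeasurableSet.univ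
  have hbox : law h ν (Set.pi s t) ≠ 0 := by
    rw [law_pi h ν s t ht, Finset.prod_ne_zero_iff]
    intro w _
    simp only [t]
    split_ifs
    · rw [Measure.prod_prod, PMF.toMeasure_apply_singleton h k (measurableSet_singleton _)]
      simpa using hhk
    · rw [Measure.prod_prod, PMF.toMeasure_apply_singleton h 0 (measurableSet_singleton _)]
      simpa using apply_zero_ne_zero hmean
  have hsub : Set.pi s t ⊆ {x | Hgt 0 0 x} := by
    intro x hx
    have h1 : offs x = k := by
      have := hx [] (by simp [s])
      simpa [t, offs] using this
    refine ⟨by omega, fun i hi _ => ?_, Or.inl rfl⟩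
    have := hx [i] (by simp [s]; omega)
    rw [ext_one_iff]
    simpa [t, offs, child] using this
  intro H
  exact hbox (measure_mono_null hsub (ENNReal.tsum_eq_zero.1 H 0))

theorem exists_law_not_ext_le {κ C : ℝ}
    (hκ : ∀ j : ℕ, ∑' v : List ℕ, law h ν {x | v ∈ vertices x ∧
      (j : ℕ∞) ≤ (vertices x).encard} ≤ ENNReal.ofReal (C * κ ^ j)) (s : ℕ) :
    law h ν {x | ¬ Ext s x} ≤ ENNReal.ofReal (C * κ ^ s) := by
  refine le_trans (measure_mono fun x hx => ?_) ((ENNReal.le_tsum []).trans (hκ s))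
  exact ⟨nil_mem_vertices x, le_trans (by exact_mod_cast le_size_of_not_ext hx)
    (size_le_encard s x)⟩

theorem exists_sibling_eq_ofReal (hmean : ∑' n : ℕ, (n : ℝ≥0∞) * h n < 1) (h0 : h 0 ≠ 1)
    (h2 : ∑' n, h n * (n : ℝ≥0∞) ^ 2 ≠ ⊤) {κ C : ℝ} (hκ0 : 0 < κ) (hκ1 : κ < 1) (hC : 0 < C)
    (hκ : ∀ j : ℕ, ∑' v : List ℕ, law h ν {x | v ∈ vertices x ∧
      (j : ℕ∞) ≤ (vertices x).encard} ≤ ENNReal.ofReal (C * κ ^ j)) :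
    ∃ p : ℕ → ℝ, (∀ s, sibling h ν s = ENNReal.ofReal (p s)) ∧ (∀ s, 0 ≤ p s) ∧ 0 < p 0 ∧
      ∃ l : ℝ, 1 < l ∧ Summable fun s => p s * l ^ s := by
  set M := (∑' n, h n * (n : ℝ≥0∞) ^ 2).toReal
  have hM0 : 0 ≤ M := ENNReal.toReal_nonneg
  have hM : ∑' n, h n * (n : ℝ≥0∞) ^ 2 = ENNReal.ofReal M := (ENNReal.ofReal_toReal h2).symm
  have hle : ∀ s, sibling h ν s ≤ ENNReal.ofReal (M * ((1 + C) * κ ^ s)) := by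
    intro s
    refine (sibling_le h ν s).trans ?_
    rw [hM, ENNReal.ofReal_mul hM0]
    gcongr
    split_ifs with hs
    · subst hs
      rw [← ENNReal.ofReal_one]
      exact ENNReal.ofReal_le_ofReal (by rw [pow_zero]; linarith)
    · refine (exists_law_not_ext_le ν hκ s).trans (ENNReal.ofReal_le_ofReal ?_)
      gcongr
      linarith
  have hne : ∀ s, sibling h ν s ≠ ⊤ := fun s => ne_top_of_le_ne_top ENNReal.ofReal_ne_top (hle s)
  refine ⟨fun s => (sibling h ν s).toReal, fun s => (ENNReal.ofReal_toReal (hne s)).symm,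
    fun s => ENNReal.toReal_nonneg,
    ENNReal.toReal_pos (sibling_zero_ne_zero ν hmean h0) (hne 0), ?_⟩
  -- The heights have tail of order `κ ^ s`; the choice `l = κ ^ (-1/2)` leaves a geometric series
  -- of ratio `√κ`.
  set b := Real.sqrt κ
  have hb0 : 0 < b := Real.sqrt_pos.2 hκ0
  have hb1 : b < 1 := by rw [Real.sqrt_lt' one_pos]; simpa using hκ1
  have hbb : b * b = κ := Real.mul_self_sqrt hκ0.le
  refine ⟨b⁻¹, (one_lt_inv₀ hb0).2 hb1, ?_⟩
  refine Summable.of_nonneg_of_le (fun s => by positivity) (fun s => ?_)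
    ((summable_geometric_of_lt_one hb0.le hb1).mul_left (M * (1 + C)))
  have h1 : (sibling h ν s).toReal ≤ M * ((1 + C) * κ ^ s) :=
    ENNReal.toReal_le_of_le_ofReal (by positivity) (hle s)
  calc (sibling h ν s).toReal * b⁻¹ ^ s ≤ M * ((1 + C) * κ ^ s) * b⁻¹ ^ s := by gcongr
    _ = M * (1 + C) * b ^ s := by
      rw [← hbb, mul_pow, inv_pow]; field_simp

end Siblings

/-! ### The effect of one random bias on a tail function -/

section Rescaling

/-- The mean of a function at a point that is divided by a random bias. -/
noncomputable def resc (ν : Measure ℝ) (g : ℝ≥0∞ → ℝ≥0∞) (t : ℝ≥0∞) : ℝ≥0∞ :=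
  ∫⁻ b, g (t / ENNReal.ofReal b) ∂ν

theorem resc_mono {ν : Measure ℝ} {g g' : ℝ≥0∞ → ℝ≥0∞} (hg : ∀ t, g t ≤ g' t) (t : ℝ≥0∞) :
    resc ν g t ≤ resc ν g' t :=
  lintegral_mono fun _ => hg _

theorem resc_const_mul (ν : Measure ℝ) {c : ℝ≥0∞} (hc : c ≠ ⊤) (g : ℝ≥0∞ → ℝ≥0∞) (t : ℝ≥0∞) :
    resc ν (fun t => c * g t) t = c * resc ν g t :=
  lintegral_const_mul' _ _ hc

theorem resc_iterate_mono {ν : Measure ℝ} {g g' : ℝ≥0∞ → ℝ≥0∞} (hg : ∀ t, g t ≤ g' t)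
    (n : ℕ) (t : ℝ≥0∞) :
    (resc ν)^[n] g t ≤ (resc ν)^[n] g' t := by
  induction n generalizing t with
  | zero => exact hg t
  | succ n ih =>
    rw [Function.iterate_succ_apply', Function.iterate_succ_apply']
    exact resc_mono ih t

theorem resc_iterate_const_mul (ν : Measure ℝ) {c : ℝ≥0∞} (hc : c ≠ ⊤)
    (g : ℝ≥0∞ → ℝ≥0∞) (n : ℕ) (t : ℝ≥0∞) :
    (resc ν)^[n] (fun t => c * g t) t = c * (resc ν)^[n] g t := by
  induction n generalizing t with
  | zero => rfl
  | succ n ih =>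
    rw [Function.iterate_succ_apply', Function.iterate_succ_apply', ← resc_const_mul ν hc]
    congr 1
    funext s
    exact ih s

end Rescaling

/-! ### Lower bounds for the tail of the planted weight -/

section Tail

variable (h : PMF ℕ) (ν : Measure ℝ) [IsProbabilityMeasure ν]

/-- The tail of the planted weight. -/
noncomputable def tailF (t : ℝ≥0∞) : ℝ≥0∞ := law h ν {x | t < planted x}

/-- The tail of the planted weight on the event that the root is not a leaf. -/
noncomputable def tailP (t : ℝ≥0∞) : ℝ≥0∞ := law h ν {x | t < planted x ∧ 0 < offs x}

/-- A recursively defined event on which exactly one vertex at level `n` is not a leaf. -/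
def Narrow : ℕ → Marks → Prop
  | 0, x => 0 < offs x
  | n + 1, x => ∃ j < offs x, Others (n + 1) j x ∧ Narrow n (child x j)

theorem measurableSet_narrow (n : ℕ) : MeasurableSet {x | Narrow n x} := by
  induction n with
  | zero => exact measurableSet_lt_offs 0
  | succ n ih =>
    have : {x | Narrow (n + 1) x} =
        ⋃ j, {x | j < offs x} ∩ ({x | Others (n + 1) j x} ∩ {x | Narrow n (child x j)}) := by
      ext x
      simp [Narrow]
    rw [this]
    exact MeasurableSet.iUnion fun j => (measurableSet_lt_offs j).inter
      ((measurableSet_others _ j).inter (measurable_child j ih))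

theorem Narrow.not_ext {n : ℕ} {x : Marks} (hx : Narrow n x) : ¬ Ext (n + 1) x := by
  induction n generalizing x with
  | zero => exact fun H => H 0 hx
  | succ n ih =>
    obtain ⟨j, hj, -, hx⟩ := hx
    exact fun H => ih hx (H j hj)

theorem measurableSet_lt_planted (t : ℝ≥0∞) : MeasurableSet {x | t < planted x} :=
  measurableSet_lt measurable_const measurable_planted

theorem tailF_antitone : Antitone (tailF h ν) := fun _ _ hst =>
  measure_mono fun _ hx => hst.trans_lt hx

/-- The integral of a sum over the children of the root. -/
theorem lintegral_tsum_child {K : ℕ → Set Marks} (hK : ∀ j, MeasurableSet (K j))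
    (hKb : ∀ j x b y, glue [j] (setBias x b) y ∈ K j ↔ x ∈ K j)
    {g : ℝ × Marks → ℝ≥0∞} (hg : Measurable g) :
    ∫⁻ x, ∑' j, (K j).indicator (fun x => g ((x []).2, child x j)) x ∂(law h ν) =
      (∑' j, law h ν (K j)) * ∫⁻ b, ∫⁻ y, g (b, y) ∂(law h ν) ∂ν := by
  rw [lintegral_tsum, ← ENNReal.tsum_mul_right]
  · exact tsum_congr fun j => lintegral_indicator_bias_child h ν j (hK j) (hKb j) hg
  · intro j
    have hmeas : Measurable fun x : Marks => g ((x []).2, child x j) :=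
      hg.comp ((measurable_snd.comp (measurable_pi_apply _)).prodMk (measurable_child j))
    exact (hmeas.indicator (hK j)).aemeasurable

theorem measurable_div_ofReal (t : ℝ≥0∞) : Measurable fun b : ℝ => t / ENNReal.ofReal b :=
  Measurable.div measurable_const ENNReal.measurable_ofReal

/-- At most one child can have a `Narrow n` subtree while the others have none of height `n + 1`. So
the expected number of suitable children is a probability, and the first moment is a genuine lower
bound. -/
theorem siblingLt_mul_resc_le {q Q : ℝ} (hq : 0 < q) (hν : ν (Set.Icc q Q)ᶜ = 0) (n : ℕ)
    (t : ℝ≥0∞) :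
    siblingLt h ν (n + 1) * resc ν (fun t => law h ν {x | Narrow n x ∧ t < planted x}) t ≤
      law h ν {x | Narrow (n + 1) x ∧ t < planted x} := by
  classical
  set S : Set (ℝ × Marks) := {p | Narrow n p.2 ∧ t / ENNReal.ofReal p.1 < planted p.2}
  have hS : MeasurableSet S := (measurable_snd (measurableSet_narrow n)).inter
    (measurableSet_lt ((measurable_div_ofReal t).comp measurable_fst)
      (measurable_planted.comp measurable_snd))
  have hR : MeasurableSet {x | Narrow (n + 1) x ∧ t < planted x} :=
    (measurableSet_narrow (n + 1)).inter (measurableSet_lt_planted t)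
  have h1 := lintegral_tsum_child h ν
    (K := fun j => {x | j < offs x ∧ Others (n + 1) j x})
    (fun j => (measurableSet_lt_offs j).inter (measurableSet_others _ j))
    (fun j x b y => by simp only [Set.mem_ofPred_eq, offs_glue_setBias, others_glue_setBias])
    (g := S.indicator 1) (measurable_one.indicator hS)
  have h2 : ∀ b : ℝ, ∫⁻ y, S.indicator (1 : ℝ × Marks → ℝ≥0∞) (b, y) ∂(law h ν) =
      law h ν {x | Narrow n x ∧ t / ENNReal.ofReal b < planted x} := by
    intro b
    have hb : MeasurableSet {x | Narrow n x ∧ t / ENNReal.ofReal b < planted x} :=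
      (measurableSet_narrow _).inter (measurableSet_lt_planted _)
    rw [← lintegral_indicator_one hb]
    rfl
  simp only [h2] at h1
  rw [siblingLt, resc, ← h1, ← lintegral_indicator_one hR]
  refine lintegral_mono_ae ?_
  filter_upwards [ae_biased h ν hν] with x hx
  have hb0 : bias x ≠ 0 := ((ENNReal.ofReal_pos.2 hq).trans_le hx.le_bias).ne'
  by_cases hex : ∃ j, j < offs x ∧ Others (n + 1) j x ∧ Narrow n (child x j) ∧
      t / bias x < planted (child x j)
  · obtain ⟨j, hj, hoj, hnj, htj⟩ := hex
    have hmem : x ∈ {x | Narrow (n + 1) x ∧ t < planted x} := by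
      refine ⟨⟨j, hj, hoj, hnj⟩, lt_of_lt_of_le ?_ (bias_mul_planted_child_le hj)⟩
      rw [ENNReal.div_lt_iff (Or.inl hb0) (Or.inl ENNReal.ofReal_ne_top), mul_comm] at htj
      exact htj
    rw [Set.indicator_of_mem hmem, tsum_eq_single j]
    · refine (Set.indicator_le_self _ _ _).trans ?_
      exact Set.indicator_le_self _ _ _
    · intro i hij
      refine Set.indicator_of_notMem ?_ _
      rintro ⟨hi, hoi⟩
      exact hnj.not_ext (hoi j hj hij.symm)
  · refine le_trans (le_of_eq ?_) zero_le
    rw [ENNReal.tsum_eq_zero]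
    intro j
    rw [Set.indicator_apply]
    split_ifs with hj
    · refine Set.indicator_of_notMem ?_ _
      rintro ⟨hn, ht⟩
      exact hex ⟨j, hj.1, hj.2, hn, ht⟩
    · rfl

theorem prod_siblingLt_mul_le {q Q : ℝ} (hq : 0 < q) (hν : ν (Set.Icc q Q)ᶜ = 0)
    (hfin : ∀ n, siblingLt h ν n ≠ ⊤) (n : ℕ) (t : ℝ≥0∞) :
    (∏ i ∈ Finset.range n, siblingLt h ν (i + 1)) * (resc ν)^[n] (tailP h ν) t ≤
      law h ν {x | Narrow n x ∧ t < planted x} := by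
  induction n generalizing t with
  | zero =>
    simp only [Finset.range_zero, Finset.prod_empty, one_mul, Function.iterate_zero, id]
    exact measure_mono fun x hx => ⟨hx.2, hx.1⟩
  | succ n ih =>
    refine le_trans ?_ (siblingLt_mul_resc_le h ν hq hν n t)
    rw [Finset.prod_range_succ, mul_right_comm, mul_comm, Function.iterate_succ_apply']
    gcongr
    rw [← resc_const_mul ν (ENNReal.prod_ne_top fun i _ => hfin _)]
    exact resc_mono ih t

theorem law_lt_bias_mul (t : ℝ≥0∞) :
    law h ν {x | t < bias x} * law h ν {x | 0 < offs x} =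
      law h ν {x | t < bias x ∧ 0 < offs x} := by
  have hev := measurePreserving_eval_infinitePi (fun _ : List ℕ => h.toMeasure.prod ν) []
  have hB : MeasurableSet {b : ℝ | t < ENNReal.ofReal b} :=
    ENNReal.measurable_ofReal measurableSet_Ioi
  have key : ∀ (A : Set ℕ) (B : Set ℝ), MeasurableSet B →
      law h ν {x | offs x ∈ A ∧ (x []).2 ∈ B} = h.toMeasure A * ν B := by
    intro A B hBm
    rw [← Measure.prod_prod]
    exact hev.measure_preimage
      ((MeasurableSet.of_discrete (s := A)).prod hBm).nullMeasurableSet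
  have h1 := key Set.univ _ hB
  have h2 := key (Set.Ioi 0) Set.univ MeasurableSet.univ
  have h3 := key (Set.Ioi 0) _ hB
  simp only [Set.mem_univ, true_and, measure_univ, one_mul, and_true, mul_one, Set.mem_Ioi,
    Set.mem_ofPred_eq] at h1 h2 h3
  have h4 : {x | t < bias x ∧ 0 < offs x} =
      {x : Marks | 0 < offs x ∧ t < ENNReal.ofReal (x []).2} := by
    ext x; exact and_comm
  rw [h4, h3, h2, mul_comm]
  unfold bias
  rw [h1]

/-- If the root is a leaf, the planted weight is just its bias, which is independent of the
offspring number; making the root a non-leaf costs a constant factor and only adds weight. -/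
theorem tailF_le_tailP {C : ℝ≥0∞} (hC : 1 ≤ C * law h ν {x | 0 < offs x}) (t : ℝ≥0∞) :
    tailF h ν t ≤ (1 + C) * tailP h ν t := by
  have h1 : {x | t < planted x} ⊆ {x | t < planted x ∧ 0 < offs x} ∪ {x | t < bias x} := by
    intro x hx
    rcases Nat.eq_zero_or_pos (offs x) with h0 | h0
    · right
      simpa [planted_eq x, h0] using hx
    · exact Or.inl ⟨hx, h0⟩
  refine (measure_mono h1).trans ((measure_union_le _ _).trans ?_)
  rw [add_mul, one_mul]
  refine add_le_add le_rfl ?_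
  calc law h ν {x | t < bias x}
      ≤ law h ν {x | t < bias x} * (C * law h ν {x | 0 < offs x}) :=
        le_mul_of_one_le_right zero_le hC
    _ = C * law h ν {x | t < bias x ∧ 0 < offs x} := by
        rw [← law_lt_bias_mul]; ring
    _ ≤ C * tailP h ν t := by
        gcongr
        exact measure_mono fun x hx => ⟨hx.1.trans_le (bias_le_planted x), hx.2⟩

/-- Division by a bias that is at least `q` lowers the threshold at least as much as division by
`q`. -/
theorem tailF_div_le_resc {q Q : ℝ} (hν : ν (Set.Icc q Q)ᶜ = 0) (t : ℝ≥0∞) :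
    tailF h ν (t / ENNReal.ofReal q) ≤ resc ν (tailF h ν) t := by
  have h1 : ∫⁻ _, tailF h ν (t / ENNReal.ofReal q) ∂ν = tailF h ν (t / ENNReal.ofReal q) := by
    simp
  rw [← h1]
  refine lintegral_mono_ae ?_
  have h2 : ∀ᵐ b ∂ν, b ∈ Set.Icc q Q := hν
  filter_upwards [h2] with b hb
  refine tailF_antitone h ν (ENNReal.div_le_div_left (ENNReal.ofReal_le_ofReal hb.1) _)

end Tail

/-! ### Upper bounds for long paths without cutpoints -/

section Cover

/-- A weighted count of the vertices `v` at level `n` such that `t < ω(v)` for the planted weight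
of the subtree at `v`, and such that none of the levels from `a` to `n - 1` has a single vertex that
is not a leaf. -/
noncomputable def cover : ℕ → ℕ → ℝ≥0∞ → Marks → ℝ≥0∞
  | 0, _, t, x => {x | t < planted x}.indicator 1 x
  | _ + 1, 0, _, _ => 0
  | n + 1, a + 1, t, x => ∑' s, ∑' j,
      {x | Hgt s j x}.indicator (fun x => cover n (max a s) (t / bias x) (child x j)) x

theorem measurable_cover (n a : ℕ) :
    Measurable fun p : ℝ≥0∞ × Marks => cover n a p.1 p.2 := by
  induction n generalizing a with
  | zero =>
    have hS : MeasurableSet {p : ℝ≥0∞ × Marks | p.1 < planted p.2} :=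
      measurableSet_lt measurable_fst (measurable_planted.comp measurable_snd)
    exact measurable_one.indicator hS
  | succ n ih =>
    cases a with
    | zero => exact measurable_const
    | succ a =>
      refine Measurable.tsum fun s => Measurable.tsum fun j => ?_
      have h1 : Measurable fun p : ℝ≥0∞ × Marks => (p.1 / bias p.2, child p.2 j) :=
        (measurable_fst.div (measurable_bias.comp measurable_snd)).prodMk
          ((measurable_child j).comp measurable_snd)
      have hS : MeasurableSet {p : ℝ≥0∞ × Marks | Hgt s j p.2} :=
        measurable_snd (measurableSet_hgt s j)
      exact ((ih (max a s)).comp h1).indicator hS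

variable (h : PMF ℕ) (ν : Measure ℝ) [IsProbabilityMeasure ν]

theorem lintegral_cover_succ (n a : ℕ) (t : ℝ≥0∞) :
    ∫⁻ x, cover (n + 1) (a + 1) t x ∂(law h ν) =
      ∑' s, sibling h ν s *
        resc ν (fun t => ∫⁻ x, cover n (max a s) t x ∂(law h ν)) t := by
  have hg : ∀ s, Measurable fun p : ℝ × Marks =>
      cover n (max a s) (t / ENNReal.ofReal p.1) p.2 := fun s =>
    (measurable_cover n (max a s)).comp
      (((measurable_div_ofReal t).comp measurable_fst).prodMk measurable_snd)
  simp only [cover]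
  rw [lintegral_tsum]
  · refine tsum_congr fun s => ?_
    exact lintegral_tsum_child h ν (K := fun j => {x | Hgt s j x})
      (fun j => measurableSet_hgt s j) (fun j x b y => hgt_glue_setBias s j x b y) (hg s)
  · intro s
    refine (Measurable.tsum fun j => ?_).aemeasurable
    have h1 : Measurable fun x : Marks => ((x []).2, child x j) :=
      (measurable_snd.comp (measurable_pi_apply _)).prodMk (measurable_child j)
    exact ((hg s).comp h1).indicator (measurableSet_hgt s j)

/-- In `cover n a`, the levels below `a` are already taken care of by off-path subtrees. One step
down the path lowers `a` by one, and siblings of height `s` raise it to at least `s`; at `a = 0`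
with levels remaining, the path is lost. Thus the expectation iterates the killed kernel of
`exists_drift`, and `V` contracts it by `ρ` relative to the total mass. The first step uses only `V
≥ 1`, whence the factor `ρ⁻¹`. -/
theorem lintegral_cover_le {p : ℕ → ℝ} (hp : ∀ s, sibling h ν s = ENNReal.ofReal (p s))
    (hp0 : ∀ s, 0 ≤ p s) (hps : Summable p) {ρ : ℝ} (hρ : 0 < ρ) {V : ℕ → ℝ}
    (hV0 : V 0 = 0) (hV1 : ∀ r, 1 ≤ V (r + 1))
    (hV : ∀ r, Summable (fun s => p s * V (max r s)) ∧
        ∑' s, p s * V (max r s) ≤ ρ * (∑' s, p s) * V (r + 1)) (n a : ℕ) (t : ℝ≥0∞) :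
    ∫⁻ x, cover (n + 1) a t x ∂(law h ν) ≤
      ENNReal.ofReal (ρ⁻¹ * ((∑' s, p s) * ρ) ^ (n + 1) * V a) *
        (resc ν)^[n + 1] (tailF h ν) t := by
  set m := ∑' s, p s with hm
  have hm0 : 0 ≤ m := tsum_nonneg hp0
  have hVnn : ∀ a, 0 ≤ V a := by
    intro a
    cases a with
    | zero => exact hV0.ge
    | succ a => linarith [hV1 a]
  induction n generalizing a t with
  | zero =>
    cases a with
    | zero => simp [cover]
    | succ a =>
      rw [lintegral_cover_succ]
      have h1 : (fun t => ∫⁻ x, cover 0 0 t x ∂(law h ν)) = tailF h ν := by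
        funext t
        exact lintegral_indicator_one (measurableSet_lt_planted t)
      have h2 : ∀ s, (fun t => ∫⁻ x, cover 0 (max a s) t x ∂(law h ν)) = tailF h ν := fun s => h1
      simp only [h2]
      rw [ENNReal.tsum_mul_right]
      simp only [hp]
      rw [← ENNReal.ofReal_tsum_of_nonneg hp0 hps]
      refine mul_le_mul' (ENNReal.ofReal_le_ofReal ?_) le_rfl
      have : ρ⁻¹ * (m * ρ) ^ (0 + 1) * V (a + 1) = m * V (a + 1) := by
        rw [zero_add, pow_one]; field_simp
      rw [this]
      exact le_mul_of_one_le_right hm0 (hV1 a)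
  | succ n ih =>
    cases a with
    | zero => simp [cover]
    | succ a =>
      rw [lintegral_cover_succ]
      have h1 : ∀ s, sibling h ν s *
          resc ν (fun t => ∫⁻ x, cover (n + 1) (max a s) t x ∂(law h ν)) t ≤
          ENNReal.ofReal (ρ⁻¹ * (m * ρ) ^ (n + 1) * (p s * V (max a s))) *
            (resc ν)^[n + 1 + 1] (tailF h ν) t := by
        intro s
        rw [Function.iterate_succ_apply', hp]
        refine (mul_le_mul_right (resc_mono (ih (max a s)) t) _).trans ?_
        rw [resc_const_mul ν ENNReal.ofReal_ne_top, ← mul_assoc, ← ENNReal.ofReal_mul (hp0 s)]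
        refine mul_le_mul' (ENNReal.ofReal_le_ofReal (le_of_eq (by ring))) le_rfl
      refine (ENNReal.tsum_le_tsum h1).trans ?_
      rw [ENNReal.tsum_mul_right, ← ENNReal.ofReal_tsum_of_nonneg _ ((hV a).1.mul_left _),
        tsum_mul_left]
      · refine mul_le_mul' (ENNReal.ofReal_le_ofReal ?_) le_rfl
        calc ρ⁻¹ * (m * ρ) ^ (n + 1) * ∑' s, p s * V (max a s)
            ≤ ρ⁻¹ * (m * ρ) ^ (n + 1) * (ρ * m * V (a + 1)) := by
              gcongr
              exact (hV a).2
          _ = _ := by ring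
      · intro s
        have := hp0 s
        have := hVnn (max a s)
        positivity

/-- Every level from `a` to `|v| - 1` has a vertex that is not a leaf and not a prefix of `v`. -/
def Cov (a : ℕ) (v : List ℕ) (x : Marks) : Prop :=
  ∀ l < v.length, a ≤ l → ∃ w i, w ++ [i] ∈ vertices x ∧ w.length = l ∧ w ≠ v.take l

theorem exists_hgt {x : Marks} {N j : ℕ} (hx : Ext N x) (hj : j < offs x) : ∃ s, Hgt s j x := by
  classical
  have hex : ∃ s, Others (s + 1) j x := by
    cases N with
    | zero => exact hx.elim
    | succ N => exact ⟨N, fun i hi _ => (hx i hi).succ⟩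
  refine ⟨Nat.find hex, hj, Nat.find_spec hex, ?_⟩
  rcases Nat.eq_zero_or_pos (Nat.find hex) with h0 | h0
  · exact Or.inl h0
  · refine Or.inr fun H => ?_
    have := Nat.find_min hex (m := Nat.find hex - 1) (by omega)
    rw [Nat.sub_add_cancel h0] at this
    exact this H

/-- The path to `v` itself contributes one to the count. The bounded height of the tree guarantees
that the siblings along the path have a maximal height. -/
theorem one_le_cover {N a : ℕ} {v : List ℕ} {t : ℝ≥0∞} {x : Marks} (hx : Ext N x)
    (hv : v ∈ vertices x) (hc : Cov a v x) (ht : t < pref v x * planted (sub x v)) :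
    1 ≤ cover v.length a t x := by
  induction v generalizing x a t N with
  | nil =>
    have ht : t < planted x := by simpa [pref, sub_nil] using ht
    rw [List.length_nil, cover, Set.indicator_of_mem (by exact ht)]
    rfl
  | cons j v ih =>
    obtain ⟨hj, hv⟩ := cons_mem_vertices.1 hv
    cases a with
    | zero =>
      -- Level 0 consists of the root alone, which lies on the path, so it can never be covered.
      obtain ⟨w, i, -, hw, hne⟩ := hc 0 (by simp) le_rfl
      exact absurd (List.length_eq_zero_iff.1 hw) (by simpa using hne)
    | succ a =>
      obtain ⟨s, hs⟩ := exists_hgt hx hj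
      have hxj : Ext N (child x j) := by
        cases N with
        | zero => exact hx.elim
        | succ N => exact (hx j hj).succ
      -- A covering vertex at level at least `s` of the subtree cannot sit below a sibling, whose
      -- tree has height at most `s` and hence only leaves there; it must sit below `j`.
      have hcj : Cov (max a s) v (child x j) := by
        intro l hl hal
        obtain ⟨w, i, hw, hwl, hne⟩ := hc (l + 1) (by simpa using hl)
          (Nat.succ_le_succ ((le_max_left _ _).trans hal))
        obtain ⟨k, w, rfl⟩ := List.exists_cons_of_length_eq_add_one hwl
        rw [List.cons_append] at hw
        obtain ⟨hk, hw⟩ := cons_mem_vertices.1 hw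
        have hwl' : w.length = l := by simpa using hwl
        have hkj : k = j := by
          by_contra hkj
          have h1 := (hs.2.1 k hk hkj).length_lt hw
          have h2 := (le_max_right a s).trans hal
          simp only [List.length_append, List.length_singleton, hwl'] at h1
          omega
        subst hkj
        refine ⟨w, i, hw, hwl', fun H => hne ?_⟩
        rw [List.take_succ_cons, ← H]
      have htj : t / bias x < pref v (child x j) * planted (sub (child x j) v) := by
        refine ENNReal.div_lt_of_lt_mul' ?_
        rw [← mul_assoc]
        exact ht
      have h1 := ih hxj hv hcj htj
      rw [List.length_cons, cover]
      refine le_trans ?_ (ENNReal.le_tsum s)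
      refine le_trans ?_ (ENNReal.le_tsum j)
      rw [Set.indicator_of_mem (by exact hs)]
      exact h1

end Cover

/-! ### Elementary comparisons of exponential rates -/

section Growth

/-- Only the finitely many factors before `L` can fall short of `b`; the constant is the product of
their deficits. -/
theorem exists_mul_pow_le_prod {P : ℕ → ℝ} (hP : ∀ l, 0 < P l) {b : ℝ} (hb : 0 < b) {L : ℕ}
    (hL : ∀ l, L ≤ l → b ≤ P l) :
    ∃ c : ℝ, 0 < c ∧ ∀ n, c * b ^ n ≤ ∏ l ∈ Finset.range n, P l := by
  have hmin : ∀ l, 0 < min 1 (P l / b) := fun l => lt_min one_pos (div_pos (hP l) hb)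
  refine ⟨∏ l ∈ Finset.range L, min 1 (P l / b), Finset.prod_pos fun l _ => hmin l, fun n => ?_⟩
  have h1 : ∀ n, (∏ l ∈ Finset.range L, min 1 (P l / b)) ≤
      ∏ l ∈ Finset.range n, min 1 (P l / b) := by
    intro n
    rcases le_total n L with hn | hn
    · obtain ⟨d, rfl⟩ := Nat.exists_eq_add_of_le hn
      rw [Finset.prod_range_add]
      exact mul_le_of_le_one_right (Finset.prod_nonneg fun i _ => (hmin i).le)
        (Finset.prod_le_one (fun i _ => (hmin _).le) fun i _ => min_le_left _ _)
    · obtain ⟨d, rfl⟩ := Nat.exists_eq_add_of_le hn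
      rw [Finset.prod_range_add]
      refine le_of_eq ?_
      rw [Finset.prod_eq_one (s := Finset.range d), mul_one]
      intro i _
      exact min_eq_left ((one_le_div hb).2 (hL _ (by omega)))
  calc _ ≤ (∏ l ∈ Finset.range n, min 1 (P l / b)) * b ^ n :=
        mul_le_mul_of_nonneg_right (h1 n) (by positivity)
    _ = ∏ l ∈ Finset.range n, (min 1 (P l / b) * b) := by
        rw [Finset.prod_mul_distrib]; simp
    _ ≤ _ := Finset.prod_le_prod (fun i _ => mul_nonneg (hmin i).le hb.le) fun i _ => by
        rw [← le_div_iff₀ hb]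
        exact min_le_right _ _

theorem exists_growth {z B : ℝ} (hz0 : 0 < z) (hz1 : z < 1) (hB : 1 ≤ B) :
    ∃ β : ℝ, ∃ D : ℕ, 1 < β ∧ z * β < 1 ∧ 1 ≤ D ∧ ∀ j : ℕ, B ^ (j / D) ≤ β ^ j := by
  obtain ⟨β, hβ1, hβ2⟩ := exists_between ((one_lt_inv₀ hz0).2 hz1)
  obtain ⟨D, hD⟩ := pow_unbounded_of_one_lt B hβ1
  refine ⟨β, D, hβ1, ?_, ?_, fun j => ?_⟩
  · have := mul_lt_mul_of_pos_left hβ2 hz0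
    rwa [mul_inv_cancel₀ hz0.ne'] at this
  · by_contra H
    have : D = 0 := by omega
    subst this
    simp only [pow_zero] at hD
    linarith
  · calc B ^ (j / D) ≤ (β ^ D) ^ (j / D) := pow_le_pow_left₀ (by linarith) hD.le _
      _ = β ^ (D * (j / D)) := (pow_mul _ _ _).symm
      _ ≤ β ^ j := pow_le_pow_right₀ hβ1.le (Nat.mul_div_le j D)

theorem exists_decay {z : ℝ} (hz0 : 0 < z) (hz1 : z < 1) {D : ℕ} (hD : 1 ≤ D) :
    ∃ θ C : ℝ, 0 < θ ∧ θ < 1 ∧ 0 < C ∧ ∀ j : ℕ, z ^ (j / D) ≤ C * θ ^ j := by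
  have hD' : (1 : ℝ) ≤ D := by exact_mod_cast hD
  set θ := 1 - (1 - z) / D with hθ
  have hdiv : (1 - z) / D ≤ 1 - z := div_le_self (by linarith) hD'
  have hdiv0 : 0 < (1 - z) / D := div_pos (by linarith) (by linarith)
  have hθ0 : 0 < θ := by rw [hθ]; linarith
  have hθ1 : θ < 1 := by rw [hθ]; linarith
  have hzθ : z ≤ θ ^ D := by
    have h1 := one_add_mul_le_pow (a := -((1 - z) / D)) (by linarith) D
    have h2 : 1 + (D : ℝ) * -((1 - z) / D) = z := by field_simp; ring
    rw [h2] at h1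
    exact h1
  refine ⟨θ, (θ ^ D)⁻¹, hθ0, hθ1, by positivity, fun j => ?_⟩
  rw [← div_eq_inv_mul, le_div_iff₀ (by positivity)]
  calc z ^ (j / D) * θ ^ D ≤ (θ ^ D) ^ (j / D) * θ ^ D := by gcongr
    _ = θ ^ (D * (j / D) + D) := by rw [← pow_mul, pow_add]
    _ ≤ θ ^ j := by
      refine pow_le_pow_of_le_one hθ0.le hθ1.le ?_
      have := Nat.div_add_mod j D
      have := Nat.mod_lt j hD
      omega

theorem exists_two_mul_le_pow {q : ℝ} (hq : 1 < q) {D : ℕ} (hD : 1 ≤ D) :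
    ∃ K : ℕ, ∀ j : ℕ, 2 * (j : ℝ) ≤ q ^ (K + j / D) := by
  obtain ⟨C, hC, hCi⟩ := exists_nat_le_mul_pow hq
  obtain ⟨K, hK⟩ := pow_unbounded_of_one_lt (2 * D * C * q) hq
  refine ⟨K, fun j => ?_⟩
  have h1 : (j : ℝ) ≤ D * ((j / D + 1 : ℕ) : ℝ) := by
    have h2 : j ≤ D * (j / D + 1) := by
      have := Nat.div_add_mod j D
      have := Nat.mod_lt j hD
      rw [mul_add]
      omega
    exact_mod_cast h2
  have h3 := hCi (j / D + 1)
  have hq0 : 0 < q := by linarith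
  calc 2 * (j : ℝ) ≤ 2 * (D * (C * q ^ (j / D + 1))) := by
        refine mul_le_mul_of_nonneg_left (h1.trans ?_) (by norm_num)
        gcongr
    _ = (2 * D * C * q) * q ^ (j / D) := by ring
    _ ≤ q ^ K * q ^ (j / D) := by gcongr
    _ = _ := by rw [pow_add]

/-- A choice of a scale `D` for which the exponential decay beats the exponential growth. -/
theorem exists_scale {τ κ B q C₁ C₂ : ℝ} (hτ0 : 0 < τ) (hτ1 : τ < 1) (hκ0 : 0 < κ) (hκ1 : κ < 1)
    (hB : 1 ≤ B) (hq : 1 < q) (hC₁ : 0 ≤ C₁) (hC₂ : 0 ≤ C₂) (M : ℕ) :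
    ∃ D : ℕ, ∃ e : ℕ → ℕ, (∀ j : ℕ, 2 * (j : ℝ) ≤ q ^ e j) ∧
      ∃ θ C : ℝ, 0 < θ ∧ θ < 1 ∧ 0 < C ∧ ∀ j : ℕ,
        C₁ * τ ^ (j / D) * B ^ e j + C₂ * κ ^ j * B ^ (e j + M * (j / D + 1)) ≤ C * θ ^ j := by
  -- The order matters: `D₁` is fixed so that `κ ^ j` beats the powers of `B` caused by the biases
  -- up to level `j / D₁`; this fixes the rate `θ` of `τ ^ (j / D₁)`; then `D₂` makes `B ^ e j` grow
  -- more slowly than `θ ^ j` decays. A linear `e` of slope `1 / (D₁ * D₂)` replaces the logarithm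
  -- of `2 * j`.
  obtain ⟨β₁, D₁, hβ₁, hκβ, hD₁, hβ₁D⟩ := exists_growth hκ0 hκ1 (one_le_pow₀ hB (n := M + 1))
  obtain ⟨θ, C, hθ0, hθ1, hC, hθ⟩ := exists_decay hτ0 hτ1 hD₁
  obtain ⟨β₂, D₂, hβ₂, hθβ, hD₂, hβ₂D⟩ := exists_growth hθ0 hθ1 hB
  obtain ⟨K, hK⟩ := exists_two_mul_le_pow hq (D := D₁ * D₂) (Nat.mul_pos hD₁ hD₂)
  refine ⟨D₁, fun j => K + j / (D₁ * D₂), hK, max (κ * β₁) (θ * β₂),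
    C₁ * C * B ^ K + C₂ * B ^ (K + M) + 1, lt_max_of_lt_left (by positivity), max_lt hκβ hθβ,
    by positivity, fun j => ?_⟩
  have hj1 : j / (D₁ * D₂) ≤ j / D₁ := Nat.div_le_div_left (Nat.le_mul_of_pos_right _ hD₂) hD₁
  have hj2 : j / (D₁ * D₂) ≤ j / D₂ := Nat.div_le_div_left (Nat.le_mul_of_pos_left _ hD₁) hD₂
  have hB0 : 0 < B := by linarith
  have h1 : C₁ * τ ^ (j / D₁) * B ^ (K + j / (D₁ * D₂)) ≤
      C₁ * C * B ^ K * max (κ * β₁) (θ * β₂) ^ j := by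
    calc C₁ * τ ^ (j / D₁) * B ^ (K + j / (D₁ * D₂))
        ≤ C₁ * (C * θ ^ j) * (B ^ K * β₂ ^ j) := by
          rw [pow_add]
          have h2 : B ^ (j / (D₁ * D₂)) ≤ β₂ ^ j := (pow_le_pow_right₀ hB hj2).trans (hβ₂D j)
          have := hθ j
          gcongr
      _ = C₁ * C * B ^ K * (θ * β₂) ^ j := by rw [mul_pow]; ring
      _ ≤ _ := by
          have := le_max_right (κ * β₁) (θ * β₂)
          gcongr
  have h2 : C₂ * κ ^ j * B ^ (K + j / (D₁ * D₂) + M * (j / D₁ + 1)) ≤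
      C₂ * B ^ (K + M) * max (κ * β₁) (θ * β₂) ^ j := by
    calc C₂ * κ ^ j * B ^ (K + j / (D₁ * D₂) + M * (j / D₁ + 1))
        ≤ C₂ * κ ^ j * (B ^ (K + M) * β₁ ^ j) := by
          have h3 : B ^ (K + j / (D₁ * D₂) + M * (j / D₁ + 1)) ≤
              B ^ (K + M) * (B ^ (M + 1)) ^ (j / D₁) := by
            rw [← pow_mul, ← pow_add]
            refine pow_le_pow_right₀ hB ?_
            have : (M + 1) * (j / D₁) = M * (j / D₁) + j / D₁ := by ring
            have : M * (j / D₁ + 1) = M * (j / D₁) + M := by ring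
            omega
          have h4 := hβ₁D j
          have h5 : B ^ (K + M) * (B ^ (M + 1)) ^ (j / D₁) ≤ B ^ (K + M) * β₁ ^ j := by gcongr
          have h6 := h3.trans h5
          gcongr
      _ = C₂ * B ^ (K + M) * (κ * β₁) ^ j := by rw [mul_pow]; ring
      _ ≤ _ := by
          have := le_max_left (κ * β₁) (θ * β₂)
          gcongr
  have h3 : 0 ≤ max (κ * β₁) (θ * β₂) ^ j :=
    pow_nonneg (le_max_of_le_left (by positivity)) j
  calc _ ≤ _ := add_le_add h1 h2
    _ ≤ _ := by linarith

end Growth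

/-! ### Regularity of the tail, uniformly in the threshold -/

section Regularity

variable {h : PMF ℕ} {ν : Measure ℝ} [IsProbabilityMeasure ν]

/-- The mass of the `Narrow n` construction is a product of partial sums `P l` of `p`. They are
positive and converge to the full sum, so the product is at least a constant times the n-th power of
`σ` times that sum. -/
theorem exists_tailF_ge {q Q : ℝ} (hq : 0 < q) (hν : ν (Set.Icc q Q)ᶜ = 0) (h0 : h 0 ≠ 1)
    {p : ℕ → ℝ} (hp : ∀ s, sibling h ν s = ENNReal.ofReal (p s)) (hp0 : ∀ s, 0 ≤ p s)
    (hp1 : 0 < p 0) (hps : Summable p) {σ : ℝ} (hσ0 : 0 < σ) (hσ1 : σ < 1) :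
    (∃ C : ℝ, 0 < C ∧ ∀ t, tailF h ν t ≤ ENNReal.ofReal C * tailP h ν t) ∧
    ∃ C : ℝ, 0 < C ∧ ∀ n t, ENNReal.ofReal (((∑' s, p s) * σ) ^ n) *
      (resc ν)^[n] (tailF h ν) t ≤ ENNReal.ofReal C * tailF h ν t := by
  have hm0 : 0 < ∑' s, p s := hps.tsum_pos hp0 0 hp1
  set P : ℕ → ℝ := fun l => ∑ s ∈ Finset.range (l + 1), p s
  have hP0 : ∀ l, 0 < P l := fun l => hp1.trans_le
    (Finset.single_le_sum (fun s _ => hp0 s) (Finset.mem_range.2 (Nat.succ_pos l)))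
  have hPs : ∀ l, siblingLt h ν (l + 1) = ENNReal.ofReal (P l) := by
    intro l
    rw [siblingLt_succ, ENNReal.ofReal_sum_of_nonneg fun s _ => hp0 s]
    exact Finset.sum_congr rfl fun s _ => hp s
  have hlim : Filter.Tendsto P Filter.atTop (nhds (∑' s, p s)) :=
    hps.hasSum.tendsto_sum_nat.comp (Filter.tendsto_add_atTop_nat 1)
  obtain ⟨L, hL⟩ := Filter.eventually_atTop.1
    (hlim.eventually (lt_mem_nhds (mul_lt_of_lt_one_right hm0 hσ1)))
  obtain ⟨c, hc, hcP⟩ := exists_mul_pow_le_prod hP0 (mul_pos hm0 hσ0) fun l hl => (hL l hl).le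
  have hpos : law h ν {x | 0 < offs x} ≠ 0 := by
    obtain ⟨k, hk, hhk⟩ := exists_pos_of_ne h0
    intro H
    have h1 := law_offs h ν {k}
    rw [PMF.toMeasure_apply_singleton h k (measurableSet_singleton k)] at h1
    refine hhk (h1.symm.trans (measure_mono_null (fun x hx => ?_) H))
    have : offs x = k := hx
    change 0 < offs x
    omega
  set A := ((law h ν {x | 0 < offs x})⁻¹).toReal
  have hA : ENNReal.ofReal A = (law h ν {x | 0 < offs x})⁻¹ :=
    ENNReal.ofReal_toReal (ENNReal.inv_ne_top.2 hpos)
  have hA0 : 0 ≤ A := ENNReal.toReal_nonneg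
  have hFP : ∀ t, tailF h ν t ≤ ENNReal.ofReal (1 + A) * tailP h ν t := by
    intro t
    rw [ENNReal.ofReal_add zero_le_one hA0, ENNReal.ofReal_one, hA]
    exact tailF_le_tailP h ν (ENNReal.inv_mul_cancel hpos (measure_ne_top _ _)).ge t
  refine ⟨⟨1 + A, by positivity, hFP⟩, (1 + A) * c⁻¹, by positivity, fun n t => ?_⟩
  have hfin : ∀ n, siblingLt h ν n ≠ ⊤ := by
    intro n
    cases n with
    | zero =>
      refine ne_top_of_le_ne_top (ENNReal.ofReal_ne_top (r := P 0)) ?_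
      rw [← hPs 0]
      exact ENNReal.tsum_le_tsum fun j => measure_mono fun x hx =>
        ⟨hx.1, hx.2.mono (Nat.zero_le _)⟩
    | succ n => rw [hPs]; exact ENNReal.ofReal_ne_top
  have h1 := prod_siblingLt_mul_le h ν hq hν hfin n t
  have h2 : law h ν {x | Narrow n x ∧ t < planted x} ≤ tailF h ν t :=
    measure_mono fun x hx => hx.2
  have h3 := h1.trans h2
  simp only [hPs] at h3
  rw [← ENNReal.ofReal_prod_of_nonneg fun l _ => (hP0 l).le] at h3
  have h4 : (resc ν)^[n] (tailF h ν) t ≤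
      ENNReal.ofReal (1 + A) * (resc ν)^[n] (tailP h ν) t := by
    rw [← resc_iterate_const_mul ν ENNReal.ofReal_ne_top]
    exact resc_iterate_mono hFP n t
  calc ENNReal.ofReal (((∑' s, p s) * σ) ^ n) * (resc ν)^[n] (tailF h ν) t
      ≤ ENNReal.ofReal (c⁻¹ * ∏ l ∈ Finset.range n, P l) *
          (ENNReal.ofReal (1 + A) * (resc ν)^[n] (tailP h ν) t) := by
        refine mul_le_mul' (ENNReal.ofReal_le_ofReal ?_) h4
        rw [← div_eq_inv_mul, le_div_iff₀ hc, mul_comm]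
        exact hcP n
    _ = ENNReal.ofReal ((1 + A) * c⁻¹) * (ENNReal.ofReal (∏ l ∈ Finset.range n, P l) *
          (resc ν)^[n] (tailP h ν) t) := by
        rw [ENNReal.ofReal_mul (by positivity), ENNReal.ofReal_mul (by positivity)]
        ring
    _ ≤ _ := by gcongr

/-- A single generation suffices: F(t/q) is at most the rescaled tail at t, which the case `n = 1`
of `hbC` bounds by a multiple of F(t). The rest is iteration. -/
theorem exists_tailF_div_le {q Q : ℝ} (hq : 0 < q) (hν : ν (Set.Icc q Q)ᶜ = 0) {b C : ℝ}
    (hb : 0 < b)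
    (hbC : ∀ n t, ENNReal.ofReal (b ^ n) * (resc ν)^[n] (tailF h ν) t ≤
      ENNReal.ofReal C * tailF h ν t) :
    ∃ B : ℝ, 1 ≤ B ∧ ∀ n t, tailF h ν (t / ENNReal.ofReal (q ^ n)) ≤
      ENNReal.ofReal (B ^ n) * tailF h ν t := by
  set B := max 1 (b⁻¹ * C)
  have h1 : ∀ t, tailF h ν (t / ENNReal.ofReal q) ≤ ENNReal.ofReal B * tailF h ν t := by
    intro t
    have h2 := hbC 1 t
    simp only [pow_one, Function.iterate_one] at h2
    calc tailF h ν (t / ENNReal.ofReal q) ≤ resc ν (tailF h ν) t := tailF_div_le_resc h ν hν t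
      _ = ENNReal.ofReal b⁻¹ * (ENNReal.ofReal b * resc ν (tailF h ν) t) := by
          rw [← mul_assoc, ← ENNReal.ofReal_mul (by positivity), inv_mul_cancel₀ hb.ne',
            ENNReal.ofReal_one, one_mul]
      _ ≤ ENNReal.ofReal b⁻¹ * (ENNReal.ofReal C * tailF h ν t) := by gcongr
      _ = ENNReal.ofReal (b⁻¹ * C) * tailF h ν t := by
          rw [← mul_assoc, ← ENNReal.ofReal_mul (by positivity)]
      _ ≤ _ := mul_le_mul' (ENNReal.ofReal_le_ofReal (le_max_right _ _)) le_rfl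
  refine ⟨B, le_max_left _ _, fun n t => ?_⟩
  have hB0 : 0 ≤ B := zero_le_one.trans (le_max_left _ _)
  induction n generalizing t with
  | zero => simp
  | succ n ih =>
    have h2 : t / ENNReal.ofReal (q ^ (n + 1)) =
        t / ENNReal.ofReal q / ENNReal.ofReal (q ^ n) := by
      rw [pow_succ', ENNReal.ofReal_mul hq.le, div_eq_mul_inv, div_eq_mul_inv, div_eq_mul_inv,
        ENNReal.mul_inv (Or.inr ENNReal.ofReal_ne_top) (Or.inl ENNReal.ofReal_ne_top), mul_assoc]
    rw [h2]
    refine (ih _).trans ?_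
    rw [pow_succ, ENNReal.ofReal_mul (by positivity), mul_assoc]
    gcongr
    exact h1 t

end Regularity

/-! ### The size of the first component of the planted tree -/

section Early

/-- The vertices that are not further away from the root than any cutpoint. -/
def early (x : Marks) : Set (List ℕ) :=
  {w | w ∈ vertices x ∧ ∀ v, IsCutpoint (vertices x) v → w.length ≤ v.length}

theorem measurableSet_isLeaf (v : List ℕ) : MeasurableSet {x | IsLeaf (vertices x) v} := by
  have : {x | IsLeaf (vertices x) v} =
      {x | v ∈ vertices x} ∩ ⋂ j : ℕ, {x | v ++ [j] ∈ vertices x}ᶜ := by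
    ext x; simp [IsLeaf]
  rw [this]
  exact (measurableSet_mem_vertices v).inter
    (MeasurableSet.iInter fun j => (measurableSet_mem_vertices _).compl)

theorem measurableSet_isCutpoint (v : List ℕ) :
    MeasurableSet {x | IsCutpoint (vertices x) v} := by
  have : {x | IsCutpoint (vertices x) v} = ({x | v ∈ vertices x} ∩ {_x | v ≠ []} ∩
      {x | IsLeaf (vertices x) v}ᶜ) ∩
      ⋂ w : List ℕ, ({x | w ∈ vertices x} ∩ {_x | w.length = v.length ∧ w ≠ v})ᶜ ∪
        {x | IsLeaf (vertices x) w} := by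
    ext x
    simp only [IsCutpoint, Set.mem_ofPred_eq, Set.mem_inter_iff, Set.mem_compl_iff,
      Set.mem_iInter, Set.mem_union]
    grind
  rw [this]
  refine MeasurableSet.inter (MeasurableSet.inter ((measurableSet_mem_vertices v).inter
    (MeasurableSet.const _)) (measurableSet_isLeaf v).compl) (MeasurableSet.iInter fun w => ?_)
  exact ((measurableSet_mem_vertices w).inter (MeasurableSet.const _)).compl.union
    (measurableSet_isLeaf w)

theorem measurableSet_mem_early (w : List ℕ) : MeasurableSet {x | w ∈ early x} := by
  have : {x | w ∈ early x} = {x | w ∈ vertices x} ∩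
      ⋂ v, {x | IsCutpoint (vertices x) v}ᶜ ∪ {_x | w.length ≤ v.length} := by
    ext x
    simp [early, imp_iff_not_or]
  rw [this]
  exact (measurableSet_mem_vertices w).inter (MeasurableSet.iInter fun v =>
    (measurableSet_isCutpoint v).compl.union (MeasurableSet.const _))

theorem early_subset_vertices (x : Marks) : early x ⊆ vertices x := fun _ hw => hw.1

theorem take_append_mem_vertices {x : Marks} {v : List ℕ} (hv : v ∈ vertices x) {l : ℕ}
    (hl : l < v.length) : v.take l ++ [v[l]] ∈ vertices x := by
  rw [← List.take_succ_eq_append_getElem hl]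
  exact mem_vertices_of_prefix (List.take_prefix _ _) hv

/-- At an uncovered level, the ancestor of `v` would be a cutpoint closer to the root than `v`.
Level 0 is exempt because the root never counts as a cutpoint. -/
theorem cov_of_mem_early {x : Marks} {v : List ℕ} (hv : v ∈ early x) : Cov 1 v x := by
  intro l hl hl1
  by_contra H
  push Not at H
  have hchild := take_append_mem_vertices hv.1 hl
  have hlen : (v.take l).length = l := by simp [hl.le]
  have hcut : IsCutpoint (vertices x) (v.take l) := by
    refine ⟨mem_vertices_of_prefix (List.take_prefix _ _) hv.1, ?_, fun hleaf => hleaf.2 _ hchild,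
      fun w hw hwl hne => ⟨hw, fun i hi => hne (H w i hi (hwl.trans hlen))⟩⟩
    intro h0
    rw [h0, List.length_nil] at hlen
    omega
  have := hv.2 _ hcut
  omega

theorem prefix_of_isCutpoint {x : Marks} {v u : List ℕ} (hv : IsCutpoint (vertices x) v)
    (hu : u ∈ vertices x) (hvu : v.length < u.length) : v <+: u := by
  have hchild := take_append_mem_vertices hu hvu
  have hlen : (u.take v.length).length = v.length := by simp [hvu.le]
  have : u.take v.length = v := by
    by_contra hne
    exact (hv.2.2.2 _ (mem_vertices_of_prefix (List.take_prefix _ _) hu) hlen hne).2 _ hchild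
  exact this ▸ List.take_prefix _ _

theorem exists_first_isCutpoint {x : Marks} (hex : ∃ v, IsCutpoint (vertices x) v) :
    ∃ v, IsCutpoint (vertices x) v ∧
      early x = {w | w ∈ vertices x ∧ w.length ≤ v.length} := by
  classical
  have hex' : ∃ n, ∃ v, IsCutpoint (vertices x) v ∧ v.length = n := by
    obtain ⟨v, hv⟩ := hex
    exact ⟨_, v, hv, rfl⟩
  obtain ⟨v, hv, hvn⟩ := Nat.find_spec hex'
  refine ⟨v, hv, ?_⟩
  ext w
  constructor
  · exact fun hw => ⟨hw.1, hw.2 v hv⟩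
  · rintro ⟨hw, hwv⟩
    refine ⟨hw, fun u hu => hwv.trans ?_⟩
    rw [hvn]
    exact Nat.find_min' hex' ⟨u, hu, rfl⟩

/-- Every vertex is early or lies below the first cutpoint. If both alternatives failed, the early
vertices and the subtree would contribute at most `t / 2` each. -/
theorem lt_planted_cases {x : Marks} {j : ℕ} (hj : j ≠ 0) (hcard : (early x).encard = j)
    {t : ℝ≥0∞} (ht : t < planted x) :
    (∃ v ∈ early x, t / ENNReal.ofReal (2 * j) < plantedWeight v x) ∨
    ∃ v, IsCutpoint (vertices x) v ∧ early x = {w | w ∈ vertices x ∧ w.length ≤ v.length} ∧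
      t / 2 < pref v x * planted (sub x v) := by
  classical
  by_contra H
  push Not at H
  obtain ⟨H1, H2⟩ := H
  have h2j : ENNReal.ofReal (2 * j) = 2 * j := by
    rw [ENNReal.ofReal_mul (by norm_num), ENNReal.ofReal_natCast, ENNReal.ofReal_ofNat]
  have hsum : ∑' u, (early x).indicator (fun u => plantedWeight u x) u ≤ t / 2 := by
    rw [← tsum_subtype]
    calc ∑' u : early x, plantedWeight u x ≤ ∑' _ : early x, t / ENNReal.ofReal (2 * j) :=
          ENNReal.tsum_le_tsum fun u => H1 u u.2
      _ = (j : ℝ≥0∞) * (t / (2 * j)) := by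
          rw [ENNReal.tsum_const, h2j]
          congr 1
          rw [Set.encard] at hcard
          simp [hcard]
      _ = t / 2 := by
          rw [← mul_div_assoc, mul_comm (j : ℝ≥0∞) t]
          exact ENNReal.mul_div_mul_right _ _ (by exact_mod_cast hj) (ENNReal.natCast_ne_top j)
  refine ht.not_ge ?_
  by_cases hex : ∃ v, IsCutpoint (vertices x) v
  · obtain ⟨v, hv, hev⟩ := exists_first_isCutpoint hex
    have h2 := H2 v hv hev
    rw [pref_mul_planted_sub hv.1] at h2
    calc planted x ≤ ∑' u, ((early x).indicator (fun u => plantedWeight u x) u +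
          if v <+: u then (if u ∈ vertices x then plantedWeight u x else 0) else 0) := by
          refine ENNReal.tsum_le_tsum fun u => ?_
          by_cases hu : u ∈ vertices x
          · by_cases hue : u ∈ early x
            · rw [if_pos hu, Set.indicator_of_mem hue]
              exact le_self_add
            · have hvu : v <+: u := by
                refine prefix_of_isCutpoint hv hu ?_
                by_contra hlen
                exact hue (hev ▸ ⟨hu, not_lt.1 hlen⟩)
              rw [if_pos hvu]
              exact le_add_self
          · simp [hu]
      _ ≤ t / 2 + t / 2 := by
          rw [ENNReal.tsum_add]
          exact add_le_add hsum h2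
      _ = t := ENNReal.add_halves t
  · have hall : ∀ u, u ∈ vertices x ↔ u ∈ early x := fun u =>
      ⟨fun hu => ⟨hu, fun v hv => absurd ⟨v, hv⟩ hex⟩, fun hu => hu.1⟩
    calc planted x = ∑' u, (early x).indicator (fun u => plantedWeight u x) u := by
          refine tsum_congr fun u => ?_
          rw [Set.indicator_apply]
          exact if_congr (hall u) rfl rfl
      _ ≤ t / 2 := hsum
      _ ≤ t := ENNReal.half_le_self

theorem mem_vertices_glue_iff {v w : List ℕ} {x y : Marks} (hw : w = v ∨ ¬ v <+: w) :
    w ∈ vertices (glue v x y) ↔ w ∈ vertices x := by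
  rcases hw with rfl | hw
  · exact mem_vertices_glue_self
  · induction v generalizing x w with
    | nil => exact absurd List.nil_prefix hw
    | cons j v ih =>
      cases w with
      | nil => simp [nil_mem_vertices]
      | cons i w =>
        rw [cons_mem_vertices, cons_mem_vertices, offs_glue_cons]
        by_cases hij : i = j
        · subst hij
          rw [child_glue_cons_self, ih]
          intro hvw
          exact hw (by simpa using hvw)
        · rw [child_glue_cons_of_ne hij]

theorem eq_or_not_prefix_of_length_le {v w : List ℕ} (hw : w.length ≤ v.length) :
    w = v ∨ ¬ v <+: w := by
  by_cases hvw : v <+: w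
  · exact Or.inl (hvw.eq_of_length_le hw).symm
  · exact Or.inr hvw

variable {h : PMF ℕ} {ν : Measure ℝ} [IsProbabilityMeasure ν]

theorem law_le_of_glue (v : List ℕ) {E A B : Set Marks} (hE : MeasurableSet E)
    (hAB : ∀ x y, glue v x y ∈ E → x ∈ A ∧ y ∈ B) :
    law h ν E ≤ law h ν A * law h ν B := by
  conv_lhs => rw [← map_glue h ν v]
  rw [Measure.map_apply (measurable_glue v) hE, ← Measure.prod_prod]
  exact measure_mono fun p hp => hAB p.1 p.2 hp

theorem measurableSet_biased (q Q : ℝ) : MeasurableSet {x | Biased q Q x} := by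
  unfold Biased
  rw [Set.ofPred_forall]
  refine MeasurableSet.iInter fun w => ?_
  have : Measurable fun x : Marks => (x w).2 := measurable_snd.comp (measurable_pi_apply w)
  exact this measurableSet_Icc

theorem tailF_eq_one {q Q : ℝ} (hq : 1 < q) (hν : ν (Set.Icc q Q)ᶜ = 0) {t : ℝ≥0∞} (ht : t ≤ 1) :
    tailF h ν t = 1 := by
  refine le_antisymm prob_le_one ?_
  rw [← measure_univ (μ := law h ν)]
  refine measure_mono_ae ?_
  filter_upwards [ae_biased h ν hν] with x hx _
  calc t ≤ 1 := ht
    _ < ENNReal.ofReal q := by rwa [ENNReal.one_lt_ofReal]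
    _ ≤ bias x := hx.le_bias
    _ ≤ planted x := bias_le_planted x

theorem ae_finite_vertices {κ C : ℝ} (hκ0 : 0 < κ) (hκ1 : κ < 1)
    (hκ : ∀ j : ℕ, ∑' v : List ℕ, law h ν {x | v ∈ vertices x ∧
      (j : ℕ∞) ≤ (vertices x).encard} ≤ ENNReal.ofReal (C * κ ^ j)) :
    ∀ᵐ x ∂(law h ν), (vertices x).Finite := by
  rw [ae_iff]
  have h1 : ∀ j : ℕ, law h ν {x | ¬ (vertices x).Finite} ≤ ENNReal.ofReal (C * κ ^ j) := by
    intro j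
    refine (measure_mono fun x hx => ?_).trans ((ENNReal.le_tsum []).trans (hκ j))
    have hx : (vertices x).Infinite := hx
    exact ⟨nil_mem_vertices x, by rw [hx.encard_eq]; exact le_top⟩
  have h2 : Filter.Tendsto (fun j : ℕ => ENNReal.ofReal (C * κ ^ j)) Filter.atTop (nhds 0) := by
    have := (tendsto_pow_atTop_nhds_zero_of_lt_one hκ0.le hκ1).const_mul C
    rw [mul_zero] at this
    simpa using ENNReal.tendsto_ofReal this
  exact le_antisymm (ge_of_tendsto' h2 h1) zero_le

theorem exists_ext_of_finite {x : Marks} (hx : (vertices x).Finite) : ∃ N, Ext N x := by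
  obtain ⟨n, hn⟩ := (hx.image List.length).bddAbove
  exact ⟨n + 1, ext_of_forall_length_lt fun w hw => Nat.lt_succ_of_le (hn ⟨w, hw, rfl⟩)⟩

/-- The three ways in which the tree can have a large weight when its first component has `j`
vertices: through a subtree at a high level, through the first component, or through the subtree at
a first cutpoint at a low level. -/
theorem law_early_le {q Q : ℝ} (hq : 1 < q) (hqQ : q ≤ Q) (hν : ν (Set.Icc q Q)ᶜ = 0)
    {κ C K τ : ℝ} (hκ0 : 0 < κ) (hκ1 : κ < 1) (hK : 0 ≤ K) (hτ0 : 0 < τ) (hτ1 : τ < 1)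
    (hκ : ∀ j : ℕ, ∑' v : List ℕ, law h ν {x | v ∈ vertices x ∧
      (j : ℕ∞) ≤ (vertices x).encard} ≤ ENNReal.ofReal (C * κ ^ j))
    (hcov : ∀ n t, ∫⁻ x, cover (n + 1) 1 t x ∂(law h ν) ≤
      ENNReal.ofReal (K * τ ^ n) * tailF h ν t) {j : ℕ} (hj : j ≠ 0) (n : ℕ) (t : ℝ≥0∞) :
    law h ν {x | (early x).encard = j ∧ t < planted x} ≤
      ENNReal.ofReal (K / (1 - τ) * τ ^ n) * tailF h ν (t / ENNReal.ofReal (2 * j)) +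
      ENNReal.ofReal (2 * C * κ ^ j) *
        tailF h ν (t / ENNReal.ofReal (2 * j * Q ^ (n + 1))) := by
  classical
  have hQ : 1 < Q := hq.trans_le hqQ
  have hj1 : (1 : ℝ) ≤ j := by exact_mod_cast Nat.one_le_iff_ne_zero.2 hj
  set t₁ := t / ENNReal.ofReal (2 * j) with ht₁
  set t₂ := t / ENNReal.ofReal (2 * j * Q ^ (n + 1)) with ht₂
  have ht₁2 : t₁ ≤ t / 2 := by
    refine ENNReal.div_le_div_left ?_ _
    rw [← ENNReal.ofReal_ofNat]
    exact ENNReal.ofReal_le_ofReal (by linarith)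
  set B₁ : Set Marks := ⋃ i, {x | 1 ≤ cover (n + i + 1) 1 t₁ x}
  -- A vertex of level at most `n` has planted weight at most `Q ^ (n + 1)`, so a heavy one forces
  -- `t₂ ≤ 1`. This is deterministic, and then the tail at `t₂` equals one.
  set B₂ : Set Marks := {x | (j : ℕ∞) ≤ (vertices x).encard ∧ t₂ ≤ 1}
  set G : List ℕ → Set Marks := fun v => {x | v ∈ vertices x ∧ (j : ℕ∞) ≤ (vertices x).encard}
  -- The count stops at the level of `v` so as not to involve the subtree there. The bounds on the
  -- biases are part of the event, so that `pref v` can be bounded pointwise after grafting.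
  set E : List ℕ → Set Marks := fun v => {x | (v ∈ vertices x ∧
    (j : ℕ∞) ≤ {w | w ∈ vertices x ∧ w.length ≤ v.length}.encard) ∧
    (t / 2 < pref v x * planted (sub x v) ∧ Biased q Q x)}
  set B₃ : Set Marks := ⋃ v, {x | x ∈ E v ∧ v.length ≤ n}
  have hsub : ∀ᵐ x ∂(law h ν), x ∈ {x | (early x).encard = j ∧ t < planted x} →
      x ∈ B₁ ∪ (B₂ ∪ B₃) := by
    filter_upwards [ae_biased h ν hν, ae_finite_vertices hκ0 hκ1 hκ] with x hx hfin hmem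
    obtain ⟨hcard, ht⟩ := hmem
    obtain ⟨N, hN⟩ := exists_ext_of_finite hfin
    have hhigh : ∀ v ∈ early x, n < v.length → t₁ < pref v x * planted (sub x v) → x ∈ B₁ := by
      intro v hv hnv hlt
      have h1 := one_le_cover hN hv.1 (cov_of_mem_early hv) hlt
      refine Set.mem_iUnion.2 ⟨v.length - n - 1, ?_⟩
      have h2 : n + (v.length - n - 1) + 1 = v.length := by omega
      rw [Set.mem_ofPred_eq, h2]
      exact h1
    rcases lt_planted_cases hj hcard ht with ⟨v, hv, hlt⟩ | ⟨v, hv, hev, hlt⟩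
    · rcases lt_or_ge n v.length with hnv | hnv
      · exact Or.inl (hhigh v hv hnv (hlt.trans_le (plantedWeight_le v x)))
      · refine Or.inr (Or.inl ⟨?_, ?_⟩)
        · rw [← hcard]
          exact Set.encard_le_encard (early_subset_vertices x)
        · have h1 : t₁ ≤ ENNReal.ofReal (Q ^ (n + 1)) := by
            rw [ENNReal.ofReal_pow (by linarith)]
            refine hlt.le.trans ((hx.plantedWeight_le v).trans ?_)
            refine pow_le_pow_right₀ ?_ (by omega)
            rw [ENNReal.one_le_ofReal]
            exact hQ.le
          have h2 : t₂ = t₁ / ENNReal.ofReal (Q ^ (n + 1)) := by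
            rw [ht₁, ht₂, ENNReal.ofReal_mul (by positivity), div_eq_mul_inv, div_eq_mul_inv,
              div_eq_mul_inv, ENNReal.mul_inv (Or.inr ENNReal.ofReal_ne_top)
              (Or.inl ENNReal.ofReal_ne_top), mul_assoc]
          rw [h2]
          exact ENNReal.div_le_of_le_mul (by rwa [one_mul])
    · rcases lt_or_ge n v.length with hnv | hnv
      · refine Or.inl (hhigh v ?_ hnv (ht₁2.trans_lt hlt))
        rw [hev]
        exact ⟨hv.1, le_rfl⟩
      · refine Or.inr (Or.inr (Set.mem_iUnion.2 ⟨v, ⟨⟨⟨hv.1, ?_⟩, hlt, hx⟩, hnv⟩⟩))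
        rw [← hev, hcard]
  have hB₁ : law h ν B₁ ≤ ENNReal.ofReal (K / (1 - τ) * τ ^ n) * tailF h ν t₁ := by
    refine (measure_iUnion_le _).trans ?_
    have h1 : ∀ i, law h ν {x | 1 ≤ cover (n + i + 1) 1 t₁ x} ≤
        ENNReal.ofReal (K * τ ^ n * τ ^ i) * tailF h ν t₁ := by
      intro i
      have hm : Measurable fun x => cover (n + i + 1) 1 t₁ x :=
        (measurable_cover (n + i + 1) 1).comp (measurable_const.prodMk measurable_id)
      have h2 := mul_meas_ge_le_lintegral (μ := law h ν) hm 1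
      rw [one_mul] at h2
      refine h2.trans ((hcov _ _).trans (le_of_eq ?_))
      rw [pow_add, mul_assoc]
    refine (ENNReal.tsum_le_tsum h1).trans (le_of_eq ?_)
    rw [ENNReal.tsum_mul_right, ← ENNReal.ofReal_tsum_of_nonneg (fun i => by positivity)
      ((summable_geometric_of_lt_one hτ0.le hτ1).mul_left _), tsum_mul_left,
      tsum_geometric_of_lt_one hτ0.le hτ1]
    congr 2
    rw [div_eq_mul_inv]
    ring
  have hCk : ENNReal.ofReal (2 * C * κ ^ j) =
      ENNReal.ofReal (C * κ ^ j) + ENNReal.ofReal (C * κ ^ j) := by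
    rw [← two_mul, ← ENNReal.ofReal_ofNat, ← ENNReal.ofReal_mul (by norm_num), mul_assoc]
  have hB₂ : law h ν B₂ ≤ ENNReal.ofReal (C * κ ^ j) * tailF h ν t₂ := by
    by_cases h1 : t₂ ≤ 1
    · rw [tailF_eq_one hq hν h1, mul_one]
      refine (measure_mono fun x hx => ?_).trans ((ENNReal.le_tsum []).trans (hκ j))
      exact ⟨nil_mem_vertices x, hx.1⟩
    · simp [B₂, h1]
  have hB₃ : law h ν B₃ ≤ ENNReal.ofReal (C * κ ^ j) * tailF h ν t₂ := by
    refine (measure_iUnion_le _).trans ?_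
    refine le_trans (ENNReal.tsum_le_tsum fun v => ?_) (le_of_eq_of_le
      (ENNReal.tsum_mul_right (f := fun v => law h ν (G v))) (mul_le_mul' (hκ j) le_rfl))
    by_cases hnv : v.length ≤ n
    · have hEm : MeasurableSet (E v) := by
        refine MeasurableSet.inter ?_ (MeasurableSet.inter ?_ (measurableSet_biased q Q))
        · refine (measurableSet_mem_vertices v).inter (measurableSet_le_encard (fun w => ?_) j)
          exact (measurableSet_mem_vertices w).inter (MeasurableSet.const _)
        · exact measurableSet_lt measurable_const ((measurable_pref v).mul
            (measurable_planted.comp (measurable_sub v)))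
      simp only [hnv, and_true, Set.ofPred_mem_eq]
      refine law_le_of_glue v hEm fun x y hxy => ?_
      obtain ⟨⟨hv, hcard⟩, hlt, hb⟩ := hxy
      have hset : {w | w ∈ vertices (glue v x y) ∧ w.length ≤ v.length} ⊆ vertices x :=
        fun w hw => (mem_vertices_glue_iff (eq_or_not_prefix_of_length_le hw.2)).1 hw.1
      refine ⟨⟨mem_vertices_glue_self.1 hv, hcard.trans (Set.encard_le_encard hset)⟩, ?_⟩
      have hp := hb.pref_le v
      rw [sub_glue] at hlt
      have h1 : t / 2 < ENNReal.ofReal (Q ^ n) * planted y := by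
        refine hlt.trans_le (mul_le_mul' (hp.trans ?_) le_rfl)
        rw [ENNReal.ofReal_pow (by linarith)]
        refine pow_le_pow_right₀ ?_ hnv
        rw [ENNReal.one_le_ofReal]
        exact hQ.le
      have h2 := ENNReal.div_lt_of_lt_mul' h1
      refine lt_of_le_of_lt ?_ h2
      have h3 : t / 2 / ENNReal.ofReal (Q ^ n) = t / ENNReal.ofReal (2 * Q ^ n) := by
        rw [ENNReal.ofReal_mul (by norm_num), ENNReal.ofReal_ofNat, div_eq_mul_inv,
          div_eq_mul_inv, div_eq_mul_inv, ENNReal.mul_inv (Or.inr ENNReal.ofReal_ne_top)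
          (Or.inl (by norm_num)), mul_assoc]
      rw [h3]
      refine ENNReal.div_le_div_left (ENNReal.ofReal_le_ofReal ?_) _
      have h4 : Q ^ n ≤ Q ^ (n + 1) := pow_le_pow_right₀ hQ.le (Nat.le_succ n)
      have h5 : 0 ≤ Q ^ n := by positivity
      nlinarith
    · simp [hnv]
  refine (measure_mono_ae hsub).trans ((measure_union_le _ _).trans (add_le_add hB₁ ?_))
  rw [hCk, add_mul]
  exact (measure_union_le _ _).trans (add_le_add hB₂ hB₃)

/-- The size of the first component of a tree of large planted weight has an exponential tail,
uniformly in the level that the weight is required to exceed. -/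
theorem exists_law_early_le (hmean : ∑' n : ℕ, (n : ℝ≥0∞) * h n < 1) {a : ℝ} (ha : 0 < a)
    (htail : ∀ n : ℕ, h.toMeasure (Set.Ici n) ≤ ENNReal.ofReal (Real.exp (-(a * n))))
    {q Q : ℝ} (hq : 1 < q) (hqQ : q ≤ Q) (hν : ν (Set.Icc q Q)ᶜ = 0) (h0 : h 0 ≠ 1) :
    ∃ θ C B : ℝ, 0 < θ ∧ θ < 1 ∧ 0 < C ∧ 1 ≤ B ∧
      (∀ᵐ x ∂(law h ν), (vertices x).Finite) ∧
      (∀ n t, tailF h ν (t / ENNReal.ofReal (q ^ n)) ≤ ENNReal.ofReal (B ^ n) * tailF h ν t) ∧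
      ∀ (k : ℕ) t, law h ν {x | (k : ℕ∞) ≤ (early x).encard ∧ t < planted x} ≤
        ENNReal.ofReal (C * θ ^ k) * tailP h ν t := by
  have hq0 : 0 < q := by linarith
  have hQ0 : 0 < Q := by linarith
  obtain ⟨L, Y, hL, hY, hLY⟩ := exists_generating_le hmean ha htail
  obtain ⟨κ, C, hκ0, hκ1, hC, hκ⟩ := exists_tsum_measure_le h ν hL hY hLY
  obtain ⟨p, hp, hp0, hp1, l, hl, hpl⟩ := exists_sibling_eq_ofReal ν hmean h0
    (tsum_sq_ne_top ha htail) hκ0 hκ1 hC hκ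
  have hps : Summable p := hpl.of_nonneg_of_le hp0 fun s =>
    le_mul_of_one_le_right (hp0 s) (one_le_pow₀ hl.le)
  have hm0 : 0 < ∑' s, p s := hps.tsum_pos hp0 0 hp1
  obtain ⟨ρ, hρ0, hρ1, V, hV0, hV1, hV⟩ := exists_drift hp0 hp1 hl hpl
  -- The upper bound has rate `m * ρ = (m * τ) * τ`; the lower bound with `σ = τ` absorbs `m * τ`
  -- and leaves `τ`.
  set τ := Real.sqrt ρ
  have hτ0 : 0 < τ := Real.sqrt_pos.2 hρ0
  have hτ1 : τ < 1 := by rw [Real.sqrt_lt' one_pos]; simpa using hρ1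
  have hττ : τ * τ = ρ := Real.mul_self_sqrt hρ0.le
  obtain ⟨⟨A, hA, hFP⟩, F, hF, hFn⟩ := exists_tailF_ge hq0 hν h0 hp hp0 hp1 hps hτ0 hτ1
  obtain ⟨B, hB1, hB⟩ := exists_tailF_div_le hq0 hν (mul_pos hm0 hτ0) hFn
  have hV1' : 0 < V 1 := zero_lt_one.trans_le (hV1 0)
  set K := ρ⁻¹ * V 1 * F * τ with hK
  have hK0 : 0 < K := by positivity
  have hcov : ∀ n t, ∫⁻ x, cover (n + 1) 1 t x ∂(law h ν) ≤
      ENNReal.ofReal (K * τ ^ n) * tailF h ν t := by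
    intro n t
    refine (lintegral_cover_le h ν hp hp0 hps hρ0 hV0 hV1 hV n 1 t).trans ?_
    calc ENNReal.ofReal (ρ⁻¹ * ((∑' s, p s) * ρ) ^ (n + 1) * V 1) *
          (resc ν)^[n + 1] (tailF h ν) t
        = ENNReal.ofReal (ρ⁻¹ * V 1 * τ ^ (n + 1)) *
            (ENNReal.ofReal (((∑' s, p s) * τ) ^ (n + 1)) *
              (resc ν)^[n + 1] (tailF h ν) t) := by
          rw [← mul_assoc, ← ENNReal.ofReal_mul (by positivity), ← hττ]
          congr 2
          ring
      _ ≤ ENNReal.ofReal (ρ⁻¹ * V 1 * τ ^ (n + 1)) * (ENNReal.ofReal F * tailF h ν t) := by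
          exact mul_le_mul_right (hFn _ _) _
      _ = _ := by
          rw [← mul_assoc, ← ENNReal.ofReal_mul (by positivity), hK]
          congr 2
          ring
  -- Expresses thresholds involving `Q` through powers of `q`, for which the regularity of the tail
  -- is available.
  obtain ⟨M, hM⟩ := pow_unbounded_of_one_lt Q hq
  obtain ⟨D, e, he, θ, C', hθ0, hθ1, hC', hθ⟩ := exists_scale (C₁ := K / (1 - τ))
    (C₂ := 2 * C) hτ0 hτ1 hκ0 hκ1 hB1 hq (div_nonneg hK0.le (by linarith)) (by positivity) M
  have hfin := ae_finite_vertices hκ0 hκ1 hκ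
  have hcard : ∀ j t, law h ν {x | (early x).encard = (j : ℕ) ∧ t < planted x} ≤
      ENNReal.ofReal (C' * θ ^ j) * tailF h ν t := by
    intro j t
    rcases eq_or_ne j 0 with rfl | hj
    · refine le_trans (le_of_eq ?_) zero_le
      have : {x | (early x).encard = (0 : ℕ) ∧ t < planted x} = ∅ := by
        refine Set.eq_empty_of_forall_notMem fun x hx => ?_
        have h1 : early x = ∅ := by simpa using hx.1
        have h2 : [] ∈ early x := ⟨nil_mem_vertices x, fun v _ => by simp⟩
        rw [h1] at h2
        exact h2
      rw [this, measure_empty]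
    · refine (law_early_le hq hqQ hν hκ0 hκ1 hK0.le hτ0 hτ1 hκ hcov hj (j / D) t).trans ?_
      have h1 : tailF h ν (t / ENNReal.ofReal (2 * j)) ≤
          ENNReal.ofReal (B ^ e j) * tailF h ν t :=
        (tailF_antitone h ν (ENNReal.div_le_div_left (ENNReal.ofReal_le_ofReal (he j)) _)).trans
          (hB _ _)
      have h2 : tailF h ν (t / ENNReal.ofReal (2 * j * Q ^ (j / D + 1))) ≤
          ENNReal.ofReal (B ^ (e j + M * (j / D + 1))) * tailF h ν t := by
        refine (tailF_antitone h ν (ENNReal.div_le_div_left (ENNReal.ofReal_le_ofReal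
          (q := q ^ (e j + M * (j / D + 1))) ?_) _)).trans (hB _ _)
        have h3 : q ^ (e j + M * (j / D + 1)) = q ^ e j * (q ^ M) ^ (j / D + 1) := by
          rw [pow_add, pow_mul]
        rw [h3]
        have := he j
        gcongr
      calc _ ≤ ENNReal.ofReal (K / (1 - τ) * τ ^ (j / D)) *
            (ENNReal.ofReal (B ^ e j) * tailF h ν t) + ENNReal.ofReal (2 * C * κ ^ j) *
            (ENNReal.ofReal (B ^ (e j + M * (j / D + 1))) * tailF h ν t) := by gcongr
        _ = ENNReal.ofReal (K / (1 - τ) * τ ^ (j / D) * B ^ e j +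
            2 * C * κ ^ j * B ^ (e j + M * (j / D + 1))) * tailF h ν t := by
          have hτ2 : 0 < 1 - τ := by linarith
          rw [← mul_assoc, ← mul_assoc, ← ENNReal.ofReal_mul (by positivity),
            ← ENNReal.ofReal_mul (by positivity), ← add_mul,
            ← ENNReal.ofReal_add (by positivity) (by positivity)]
        _ ≤ _ := mul_le_mul' (ENNReal.ofReal_le_ofReal (hθ j)) le_rfl
  refine ⟨θ, C' / (1 - θ) * A, B, hθ0, hθ1,
    mul_pos (div_pos hC' (by linarith)) hA, hB1, hfin, hB, fun k t => ?_⟩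
  have hsub : ∀ᵐ x ∂(law h ν), x ∈ {x | (k : ℕ∞) ≤ (early x).encard ∧ t < planted x} →
      x ∈ ⋃ i : ℕ, {x | (early x).encard = (k + i : ℕ) ∧ t < planted x} := by
    filter_upwards [hfin] with x hx hmem
    have hfe : (early x).Finite := hx.subset (early_subset_vertices x)
    have h1 := hfe.encard_eq_coe
    rw [h1] at hmem
    have h2 : k ≤ ENat.toNat (early x).encard := by exact_mod_cast hmem.1
    obtain ⟨i, hi⟩ := Nat.exists_eq_add_of_le h2
    exact Set.mem_iUnion.2 ⟨i, by rw [← hi]; exact h1, hmem.2⟩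
  refine (measure_mono_ae hsub).trans ((measure_iUnion_le _).trans ?_)
  refine (ENNReal.tsum_le_tsum fun i => hcard (k + i) t).trans ?_
  have h1 : ∀ i, C' * θ ^ (k + i) = C' * θ ^ k * θ ^ i := fun i => by rw [pow_add, mul_assoc]
  simp only [h1]
  rw [ENNReal.tsum_mul_right, ← ENNReal.ofReal_tsum_of_nonneg (fun i => by positivity)
      ((summable_geometric_of_lt_one hθ0.le hθ1).mul_left _), tsum_mul_left,
      tsum_geometric_of_lt_one hθ0.le hθ1]
  refine (mul_le_mul_right (hFP t) _).trans (le_of_eq ?_)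
  have hθ2 : 0 < 1 - θ := by linarith
  rw [← mul_assoc, ← ENNReal.ofReal_mul (by positivity)]
  congr 2
  rw [div_eq_mul_inv]
  ring

end Early

/-! ### Components and the vertices at which they start -/

section Cut

/-- There is a cutpoint at distance `n` from the root. -/
def CutLevel (x : Marks) (n : ℕ) : Prop := ∃ u, IsCutpoint (vertices x) u ∧ u.length = n

open Classical in
/-- `v` is a vertex such that any other vertex at the same level is a leaf, and there are `m`
cutpoints closer to the root. -/
def IsLone (m : ℕ) (v : List ℕ) (x : Marks) : Prop :=
  v ∈ vertices x ∧ v ≠ [] ∧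
    (∀ w ∈ vertices x, w.length = v.length → w ≠ v → IsLeaf (vertices x) w) ∧
    Nat.count (CutLevel x) v.length = m

/-- `v` is the vertex at which the component `m + 1` starts. -/
def IsStart : ℕ → List ℕ → Marks → Prop
  | 0, v, _ => v = []
  | m + 1, v, x => IsLone m v x ∧ 0 < offs (sub x v)

theorem isLeaf_iff_offs {x : Marks} {v : List ℕ} (hv : v ∈ vertices x) :
    IsLeaf (vertices x) v ↔ offs (sub x v) = 0 := by
  simp only [IsLeaf, append_mem_vertices, hv, true_and, singleton_mem_vertices, not_lt]
  exact ⟨fun H => Nat.le_zero.1 (H 0), fun H j => by omega⟩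

theorem IsStart.isCutpoint {m : ℕ} {v : List ℕ} {x : Marks} (hv : IsStart (m + 1) v x) :
    IsCutpoint (vertices x) v := by
  refine ⟨hv.1.1, hv.1.2.1, ?_, hv.1.2.2.1⟩
  rw [isLeaf_iff_offs hv.1.1]
  exact hv.2.ne'

theorem IsStart.mem_vertices {m : ℕ} {v : List ℕ} {x : Marks} (hv : IsStart m v x) :
    v ∈ vertices x := by
  cases m with
  | zero => exact hv ▸ nil_mem_vertices x
  | succ m => exact hv.1.1

theorem IsStart.prefix {m : ℕ} {v w : List ℕ} {x : Marks} (hv : IsStart m v x)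
    (hw : w ∈ vertices x) (hvw : v.length < w.length) : v <+: w := by
  cases m with
  | zero => exact hv ▸ List.nil_prefix
  | succ m => exact prefix_of_isCutpoint hv.isCutpoint hw hvw

theorem isLeaf_append_iff {x : Marks} {v w : List ℕ} :
    IsLeaf (vertices x) (v ++ w) ↔ v ∈ vertices x ∧ IsLeaf (vertices (sub x v)) w := by
  simp only [IsLeaf, List.append_assoc, append_mem_vertices]
  by_cases hv : v ∈ vertices x <;> simp [hv]

theorem IsStart.isCutpoint_append {m : ℕ} {v u : List ℕ} {x : Marks} (hv : IsStart m v x)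
    (hu : IsCutpoint (vertices (sub x v)) u) : IsCutpoint (vertices x) (v ++ u) := by
  refine ⟨append_mem_vertices.2 ⟨hv.mem_vertices, hu.1⟩, by simp [hu.2.1], ?_, ?_⟩
  · rw [isLeaf_append_iff]
    exact fun H => hu.2.2.1 H.2
  · intro w hw hwl hne
    have hpos := List.length_pos_iff.2 hu.2.1
    rw [List.length_append] at hwl
    obtain ⟨w', rfl⟩ := hv.prefix hw (by omega)
    rw [isLeaf_append_iff]
    refine ⟨hv.mem_vertices, hu.2.2.2 w' (append_mem_vertices.1 hw).2 ?_ fun h => hne (h ▸ rfl)⟩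
    simpa using hwl

theorem finite_cutLevel {x : Marks} (hx : (vertices x).Finite) :
    (Set.ofPred (CutLevel x)).Finite := by
  refine (hx.image List.length).subset ?_
  rintro n ⟨u, hu, rfl⟩
  exact ⟨u, hu.1, rfl⟩

theorem numComponents_eq {x : Marks} (hx : (vertices x).Finite) :
    numComponents (vertices x) = (finite_cutLevel hx).toFinset.card + 1 := by
  have hinj : Set.InjOn List.length {v | IsCutpoint (vertices x) v} :=
    fun v hv w hw hvw => IsCutpoint.eq_of_length_eq hv hw hvw
  rw [numComponents, ← hinj.ncard_image, ← Set.ncard_coe_finset, Set.Finite.coe_toFinset]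
  rfl

open Classical in
theorem exists_isStart {x : Marks} (hx : (vertices x).Finite) {m : ℕ}
    (hm : m < numComponents (vertices x)) :
    ∃ v, IsStart m v x ∧ v.length = cutDepth (vertices x) m := by
  cases m with
  | zero => exact ⟨[], rfl, by simp [cutDepth]⟩
  | succ m =>
    have hd : cutDepth (vertices x) (m + 1) = Nat.nth (CutLevel x) m := by
      rw [cutDepth, if_neg (by omega), if_pos hm]
      rfl
    rw [numComponents_eq hx] at hm
    have hcard : m < (finite_cutLevel hx).toFinset.card := by omega
    obtain ⟨v, hv, hvl⟩ := Nat.nth_mem_of_lt_card (finite_cutLevel hx) hcard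
    refine ⟨v, ⟨⟨hv.1, hv.2.1, hv.2.2.2, ?_⟩, ?_⟩, hvl.trans hd.symm⟩
    · rw [hvl]
      exact Nat.count_nth_of_lt_card_finite _ hcard
    · refine Nat.pos_of_ne_zero fun h0 => hv.2.2.1 ((isLeaf_iff_offs hv.1).2 h0)

open Classical in
-- `Nat.count` looks at levels strictly less than `n`, so beyond its level the start itself is
-- counted along with its predecessors.
theorem IsStart.le_count {m n : ℕ} {v : List ℕ} {x : Marks} (hv : IsStart m v x)
    (hn : v.length < n) : m ≤ Nat.count (CutLevel x) n := by
  cases m with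
  | zero => exact Nat.zero_le _
  | succ m =>
    have h1 := Nat.count_succ (p := CutLevel x) v.length
    rw [hv.1.2.2.2, if_pos ⟨v, hv.isCutpoint, rfl⟩] at h1
    exact h1 ▸ Nat.count_monotone _ hn

/-- A cutpoint of the subtree at a start is a cutpoint of the whole tree, so the current component
ends there or before. In the last component no such cutpoint exists, by counting. -/
theorem IsStart.cutDepth_le {m : ℕ} {v u : List ℕ} {x : Marks} (hx : (vertices x).Finite)
    (hm : m < numComponents (vertices x)) (hv : IsStart m v x)
    (hu : IsCutpoint (vertices (sub x v)) u) :
    cutDepth (vertices x) (m + 1) ≤ (v ++ u).length := by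
  classical
  have hp : CutLevel x (v ++ u).length := ⟨_, hv.isCutpoint_append hu, rfl⟩
  have hle : m ≤ Nat.count (CutLevel x) (v ++ u).length := by
    refine hv.le_count ?_
    have hpos := List.length_pos_iff.2 hu.2.1
    rw [List.length_append]
    omega
  rw [cutDepth, if_neg (by omega)]
  split_ifs with h1
  · rcases hle.eq_or_lt with h2 | h2
    · rw [Nat.add_sub_cancel, h2]
      exact (Nat.nth_count hp).le
    · exact (Nat.nth_lt_of_lt_count h2).le
  · have h2 := Nat.count_lt_card (finite_cutLevel hx) hp
    rw [numComponents_eq hx] at h1 hm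
    omega

theorem IsStart.mem_image_early {m : ℕ} {v w : List ℕ} {x : Marks} (hx : (vertices x).Finite)
    (hm : m < numComponents (vertices x)) (hv : IsStart m v x) (hw : w ∈ vertices x)
    (hvw : v <+: w) (hwd : w.length ≤ cutDepth (vertices x) (m + 1)) :
    w ∈ (fun u => v ++ u) '' early (sub x v) := by
  obtain ⟨w, rfl⟩ := hvw
  refine ⟨w, ⟨(append_mem_vertices.1 hw).2, fun u hu => ?_⟩, rfl⟩
  have := hwd.trans (hv.cutDepth_le hx hm hu)
  simpa using this

/-- The vertices of a component below its start are early in the subtree there. The others lie at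
the level of the start, hence at the lower end of the preceding component, and are early in the
subtree at the preceding start. -/
theorem exists_component_subset {x : Marks} (hx : (vertices x).Finite) {m : ℕ}
    (hm : m < numComponents (vertices x)) :
    ∃ v m' v', IsStart m v x ∧ (m' = m ∨ m' + 1 = m) ∧ IsStart m' v' x ∧
      component (vertices x) (m + 1) ⊆
        (fun u => v ++ u) '' early (sub x v) ∪ (fun u => v' ++ u) '' early (sub x v') := by
  classical
  obtain ⟨v, hv, hvd⟩ := exists_isStart hx hm
  cases m with
  | zero =>
    -- The first component has no predecessor; its own start is listed twice.
    refine ⟨v, 0, v, hv, Or.inl rfl, hv, fun w hw => Or.inl ?_⟩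
    exact hv.mem_image_early hx hm hw.1 (hv ▸ List.nil_prefix) hw.2.2.2.2
  | succ m =>
    obtain ⟨v', hv', hvd'⟩ := exists_isStart hx (Nat.lt_of_succ_lt hm)
    refine ⟨v, m, v', hv, Or.inr rfl, hv', fun w hw => ?_⟩
    have hle : v.length ≤ w.length := hvd.trans_le hw.2.2.2.1
    by_cases hvw : v <+: w
    · exact Or.inl (hv.mem_image_early hx hm hw.1 hvw hw.2.2.2.2)
    · have hlen : w.length = v.length := by
        by_contra hne
        exact hvw (hv.prefix hw.1 (by omega))
      refine Or.inr (hv'.mem_image_early hx (Nat.lt_of_succ_lt hm) hw.1 (hv'.prefix hw.1 ?_)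
        (hlen.trans hvd).le)
      rw [hlen]
      cases m with
      | zero =>
        rw [show v' = [] from hv']
        exact List.length_pos_iff.2 hv.1.2.1
      | succ m =>
        by_contra H
        have h1 := Nat.count_monotone (CutLevel x) (not_lt.1 H)
        rw [hv.1.2.2.2, hv'.1.2.2.2] at h1
        omega

/-- The starting point of a large component, or that of the preceding one, is the root of a subtree
with a large first component. -/
theorem exists_le_encard_early {x : Marks} (hx : (vertices x).Finite) {m k : ℕ} (hk : k ≠ 0)
    (hcard : (k : ℕ∞) ≤ (component (vertices x) (m + 1)).encard) :
    ∃ m', (m' = m ∨ m' + 1 = m) ∧ ∃ v, IsStart m' v x ∧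
      ((k / 2 : ℕ) : ℕ∞) ≤ (early (sub x v)).encard := by
  have hne : (component (vertices x) (m + 1)).Nonempty := by
    rw [← Set.encard_ne_zero]
    intro h0
    rw [h0] at hcard
    exact hk (by simpa using hcard)
  obtain ⟨w, hw⟩ := hne
  obtain ⟨v, m', v', hv, hm', hv', hsub⟩ := exists_component_subset hx hw.2.2.1
  by_contra! H
  have h1 := H m (Or.inl rfl) v hv
  have h2 := H m' hm' v' hv'
  have h3 : (k : ℕ∞) ≤ (early (sub x v)).encard + (early (sub x v')).encard := by
    refine hcard.trans ((Set.encard_le_encard hsub).trans ((Set.encard_union_le _ _).trans ?_))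
    exact add_le_add (Set.encard_image_le _ _) (Set.encard_image_le _ _)
  generalize (early (sub x v)).encard = a at h1 h3
  generalize (early (sub x v')).encard = b at h2 h3
  lift a to ℕ using h1.ne_top
  lift b to ℕ using h2.ne_top
  norm_cast at h1 h2 h3
  omega

end Cut

/-! ### Renewal at the start of a component -/

section Start

theorem setBias_glue {v : List ℕ} (hv : v ≠ []) (x y : Marks) (b : ℝ) :
    setBias (glue v x y) b = glue v (setBias x b) y := by
  obtain ⟨j, v, rfl⟩ := List.exists_cons_of_ne_nil hv
  funext w
  cases w with
  | nil => simp [setBias, build, glue]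
  | cons i w => rfl

theorem isLeaf_glue_iff {v w : List ℕ} {x y : Marks} (hw : w.length ≤ v.length) (hne : w ≠ v) :
    IsLeaf (vertices (glue v x y)) w ↔ IsLeaf (vertices x) w := by
  have h : ∀ j, w ++ [j] ∈ vertices (glue v x y) ↔ w ++ [j] ∈ vertices x := fun j => by
    refine mem_vertices_glue_iff ?_
    by_cases hvw : v <+: w ++ [j]
    · refine Or.inl ?_
      rcases List.prefix_concat_iff.1 hvw with h1 | h1
      · exact h1.symm
      · exact absurd (h1.eq_of_length_le hw).symm hne
    · exact Or.inr hvw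
  simp only [IsLeaf, h, mem_vertices_glue_iff (eq_or_not_prefix_of_length_le hw)]

theorem isCutpoint_glue_iff {v u : List ℕ} {x y : Marks} (hu : u.length < v.length) :
    IsCutpoint (vertices (glue v x y)) u ↔ IsCutpoint (vertices x) u := by
  have hne : ∀ w : List ℕ, w.length = u.length → w ≠ v := by
    rintro w hw rfl
    omega
  have h1 : ∀ w : List ℕ, w.length = u.length →
      (w ∈ vertices (glue v x y) ↔ w ∈ vertices x) := fun w hw =>
    mem_vertices_glue_iff (eq_or_not_prefix_of_length_le (by omega))
  have h2 : ∀ w : List ℕ, w.length = u.length →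
      (IsLeaf (vertices (glue v x y)) w ↔ IsLeaf (vertices x) w) := fun w hw =>
    isLeaf_glue_iff (by omega) (hne w hw)
  unfold IsCutpoint
  rw [h1 u rfl, h2 u rfl]
  grind

/-- `IsLone` leaves open whether `v` is a leaf, and counts cutpoints only strictly above it. This
makes it independent of the subtree at `v`; being a start adds just one condition on that subtree,
namely a root with offspring. -/
theorem isLone_glue_iff {m : ℕ} {v : List ℕ} {x y : Marks} :
    IsLone m v (glue v x y) ↔ IsLone m v x := by
  classical
  have h1 : ∀ w : List ℕ, w.length = v.length →
      (w ∈ vertices (glue v x y) ↔ w ∈ vertices x) := fun w hw =>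
    mem_vertices_glue_iff (eq_or_not_prefix_of_length_le hw.le)
  have h2 : ∀ w : List ℕ, w.length = v.length → w ≠ v →
      (IsLeaf (vertices (glue v x y)) w ↔ IsLeaf (vertices x) w) := fun w hw =>
    isLeaf_glue_iff hw.le
  have h3 : Nat.count (CutLevel (glue v x y)) v.length = Nat.count (CutLevel x) v.length := by
    rw [Nat.count_eq_card_filter_range, Nat.count_eq_card_filter_range]
    congr 1
    refine Finset.filter_congr fun n hn => ?_
    rw [Finset.mem_range] at hn
    refine exists_congr fun u => ⟨?_, ?_⟩ <;> rintro ⟨hu, rfl⟩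
    · exact ⟨(isCutpoint_glue_iff hn).1 hu, rfl⟩
    · exact ⟨(isCutpoint_glue_iff hn).2 hu, rfl⟩
  unfold IsLone
  rw [h1 v rfl, h3]
  grind

theorem measurableSet_cutLevel (n : ℕ) : MeasurableSet {x | CutLevel x n} := by
  have : {x | CutLevel x n} = ⋃ u, {x | IsCutpoint (vertices x) u} ∩ {_x | u.length = n} := by
    ext x
    simp [CutLevel]
  rw [this]
  exact MeasurableSet.iUnion fun u => (measurableSet_isCutpoint u).inter (MeasurableSet.const _)

open Classical in
theorem measurable_count_cutLevel (n : ℕ) : Measurable fun x => Nat.count (CutLevel x) n := by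
  induction n with
  | zero => simp
  | succ n ih =>
    simp only [Nat.count_succ]
    exact ih.add (Measurable.ite (measurableSet_cutLevel n) measurable_const measurable_const)

theorem measurableSet_isLone (m : ℕ) (v : List ℕ) : MeasurableSet {x | IsLone m v x} := by
  classical
  have : {x | IsLone m v x} = ({x | v ∈ vertices x} ∩ {_x | v ≠ []}) ∩
      ((⋂ w, ({x | w ∈ vertices x} ∩ {_x | w.length = v.length ∧ w ≠ v})ᶜ ∪
        {x | IsLeaf (vertices x) w}) ∩ {x | Nat.count (CutLevel x) v.length = m}) := by
    ext x
    simp only [IsLone, Set.mem_ofPred_eq, Set.mem_inter_iff, Set.mem_compl_iff,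
      Set.mem_iInter, Set.mem_union]
    grind
  rw [this]
  refine ((measurableSet_mem_vertices v).inter (MeasurableSet.const _)).inter
    ((MeasurableSet.iInter fun w => ?_).inter
      (measurable_count_cutLevel _ (measurableSet_singleton m)))
  exact ((measurableSet_mem_vertices w).inter (MeasurableSet.const _)).compl.union
    (measurableSet_isLeaf w)

theorem IsStart.eq {m : ℕ} {v w : List ℕ} {x : Marks} (hv : IsStart m v x) (hw : IsStart m w x) :
    v = w := by
  classical
  cases m with
  | zero => exact hv.trans hw.symm
  | succ m =>
    refine hv.isCutpoint.eq_of_length_eq hw.isCutpoint ?_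
    exact Nat.count_injective ⟨v, hv.isCutpoint, rfl⟩ ⟨w, hw.isCutpoint, rfl⟩
      (hv.1.2.2.2.trans hw.1.2.2.2.symm)

variable {h : PMF ℕ} {ν : Measure ℝ} [IsProbabilityMeasure ν]

theorem law_eq_lintegral_glue (v : List ℕ) {E : Set Marks} (hE : MeasurableSet E) :
    law h ν E = ∫⁻ x, law h ν {y | glue v x y ∈ E} ∂(law h ν) := by
  conv_lhs => rw [← map_glue h ν v]
  rw [Measure.map_apply (measurable_glue v) hE, Measure.prod_apply (measurable_glue v hE)]
  rfl

theorem measurable_planted_setBias : Measurable fun x => planted (setBias x 1) :=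
  measurable_planted.comp (measurable_setBias.comp (measurable_id.prodMk measurable_const))

theorem planted_pos {q Q : ℝ} (hq : 0 < q) {x : Marks} (hx : Biased q Q x) : 0 < planted x :=
  (ENNReal.ofReal_pos.2 hq).trans_le (hx.le_bias.trans (bias_le_planted x))

/-- The event that the component `m + 1` starts at `v` with a subtree whose first component has at
least `k` vertices. -/
def startEvent (m k : ℕ) (t : ℝ≥0∞) (v : List ℕ) : Set Marks :=
  {x | (IsLone m v x ∧ 0 < offs (sub x v)) ∧ (k : ℕ∞) ≤ (early (sub x v)).encard ∧
    t < planted (setBias x 1)}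

theorem measurableSet_startEvent (m k : ℕ) (t : ℝ≥0∞) (v : List ℕ) :
    MeasurableSet (startEvent m k t v) := by
  refine ((measurableSet_isLone m v).inter
    ((measurable_offs.comp (measurable_sub v)) measurableSet_Ioi)).inter (.inter ?_ ?_)
  · exact measurableSet_le_encard (fun w => measurable_sub v (measurableSet_mem_early w)) k
  · exact measurable_planted_setBias measurableSet_Ioi

/-- With the surroundings of `v` frozen, both events concern a fresh tree above a common threshold,
and `hearly` compares them. Its right side must be `tailP`, since a start has offspring. -/
theorem law_startEvent_le {q Q c : ℝ} {k : ℕ} (hq : 1 < q) (hν : ν (Set.Icc q Q)ᶜ = 0)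
    (hearly : ∀ t, law h ν {x | (k : ℕ∞) ≤ (early x).encard ∧ t < planted x} ≤
        ENNReal.ofReal c * tailP h ν t) (m : ℕ) (t : ℝ≥0∞) (v : List ℕ) :
    law h ν (startEvent m k t v) ≤ ENNReal.ofReal c * law h ν (startEvent m 0 t v) := by
  rw [law_eq_lintegral_glue v (measurableSet_startEvent m k t v),
    law_eq_lintegral_glue v (measurableSet_startEvent m 0 t v),
    ← lintegral_const_mul' _ _ ENNReal.ofReal_ne_top]
  refine lintegral_mono_ae ?_
  filter_upwards [ae_biased h ν hν] with x hx
  by_cases hL : IsLone m v x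
  · have hv : v ∈ vertices (setBias x 1) := by rw [vertices_setBias]; exact hL.1
    obtain ⟨A, hA⟩ := exists_planted_glue hv
    have hP0 : pref v (setBias x 1) ≠ 0 := by
      refine Biased.pref_pos (q := 1) (Q := max 1 Q) one_pos (fun w => ?_) v
      cases w with
      | nil => simp [setBias, build]
      | cons j w => exact ⟨hq.le.trans (hx _).1, (hx _).2.trans (le_max_right _ _)⟩
    have hmem : ∀ (j : ℕ) (y : Marks), glue v x y ∈ startEvent m j t v ↔
        0 < offs y ∧ (j : ℕ∞) ≤ (early y).encard ∧
          t < A + pref v (setBias x 1) * planted y := by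
      intro j y
      rw [startEvent, Set.mem_ofPred_eq, isLone_glue_iff, sub_glue, setBias_glue hL.2.1, hA]
      tauto
    -- The threshold is `(t - A) / pref`. If the surroundings alone already exceed `t`, zero serves,
    -- because planted weights are almost surely positive.
    have hex : ∃ s : ℝ≥0∞, ∀ᵐ y ∂(law h ν),
        (t < A + pref v (setBias x 1) * planted y ↔ s < planted y) := by
      rcases lt_or_ge t A with htA | htA
      · refine ⟨0, ?_⟩
        filter_upwards [ae_biased h ν hν] with y hy
        exact iff_of_true (htA.trans_le le_self_add) (planted_pos (by linarith) hy)
      · rcases eq_or_ne t ⊤ with rfl | ht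
        · exact ⟨⊤, Filter.Eventually.of_forall fun y => by simp⟩
        refine ⟨(t - A) / pref v (setBias x 1), Filter.Eventually.of_forall fun y => ?_⟩
        have hA' : AddLECancellable A := ENNReal.cancel_of_ne (ne_top_of_le_ne_top ht htA)
        rw [ENNReal.div_lt_iff (Or.inl hP0) (Or.inl (pref_ne_top _ _)), mul_comm (planted y),
          ← not_le, ← not_le, hA'.le_tsub_iff_left htA]
    obtain ⟨s, hs⟩ := hex
    refine (measure_mono_ae (t := {y | (k : ℕ∞) ≤ (early y).encard ∧ s < planted y}) ?_).trans
      ((hearly s).trans (mul_le_mul_right (measure_mono_ae ?_) _))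
    · filter_upwards [hs] with y hy hmem'
      obtain ⟨-, h1, h2⟩ := (hmem k y).1 hmem'
      exact ⟨h1, hy.1 h2⟩
    · filter_upwards [hs] with y hy hmem'
      exact (hmem 0 y).2 ⟨hmem'.2, by simp, hy.2 hmem'.1⟩
  · have : {y | glue v x y ∈ startEvent m k t v} = ∅ := by
      refine Set.eq_empty_of_forall_notMem fun y hy => hL ?_
      exact isLone_glue_iff.1 hy.1.1
    rw [this, measure_empty]
    exact zero_le

theorem ae_totalWeight_eq {q Q : ℝ} (hq : 0 < q) (hν : ν (Set.Icc q Q)ᶜ = 0) :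
    ∀ᵐ x ∂(law h ν), totalWeight x = planted (setBias x 1) := by
  filter_upwards [ae_biased h ν hν] with x hx
  exact totalWeight_eq fun w => hq.le.trans (hx w).1

/-- A tree has at most one start of given index, so the events on the right of `law_startEvent_le`
are disjoint in `v` and no combinatorial factor arises. -/
theorem law_isStart_succ_le {q Q c : ℝ} {k : ℕ} (hq : 1 < q) (hν : ν (Set.Icc q Q)ᶜ = 0)
    (hearly : ∀ t, law h ν {x | (k : ℕ∞) ≤ (early x).encard ∧ t < planted x} ≤
        ENNReal.ofReal c * tailP h ν t) (m : ℕ) (t : ℝ≥0∞) :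
    law h ν {x | (∃ v, IsStart (m + 1) v x ∧ (k : ℕ∞) ≤ (early (sub x v)).encard) ∧
      t < planted (setBias x 1)} ≤
      ENNReal.ofReal c * law h ν {x | t < planted (setBias x 1)} := by
  have h1 : {x | (∃ v, IsStart (m + 1) v x ∧ (k : ℕ∞) ≤ (early (sub x v)).encard) ∧
      t < planted (setBias x 1)} ⊆ ⋃ v, startEvent m k t v := by
    rintro x ⟨⟨v, hv, hk⟩, ht⟩
    exact Set.mem_iUnion.2 ⟨v, hv, hk, ht⟩
  refine (measure_mono h1).trans ((measure_iUnion_le _).trans ?_)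
  refine (ENNReal.tsum_le_tsum fun v => law_startEvent_le hq hν hearly m t v).trans ?_
  rw [ENNReal.tsum_mul_left, ← measure_iUnion ?_ fun v => measurableSet_startEvent m 0 t v]
  · refine mul_le_mul_right (measure_mono (Set.iUnion_subset fun v x hx => hx.2.2)) _
  · intro v w hvw
    refine Set.disjoint_left.2 fun x hxv hxw => hvw ?_
    exact IsStart.eq (m := m + 1) hxv.1 hxw.1

/-- The planted weight is the true weight times a bias in `[q, Q]`. Passing to it only raises the
weight since `q > 1`; passing back moves the threshold by a factor at most `Q ≤ q ^ M`, which costs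
`B ^ M`. -/
theorem law_isStart_zero_le {q Q c B : ℝ} {k M : ℕ} (hq : 1 < q) (hqQ : q ≤ Q)
    (hν : ν (Set.Icc q Q)ᶜ = 0) (hM : Q ≤ q ^ M) (hc : 0 ≤ c)
    (hB : ∀ n t, tailF h ν (t / ENNReal.ofReal (q ^ n)) ≤ ENNReal.ofReal (B ^ n) * tailF h ν t)
    (hearly : ∀ t, law h ν {x | (k : ℕ∞) ≤ (early x).encard ∧ t < planted x} ≤
        ENNReal.ofReal c * tailP h ν t) (t : ℝ≥0∞) :
    law h ν {x | (∃ v, IsStart 0 v x ∧ (k : ℕ∞) ≤ (early (sub x v)).encard) ∧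
      t < planted (setBias x 1)} ≤
      ENNReal.ofReal (B ^ M * c) * law h ν {x | t < planted (setBias x 1)} := by
  have hQ0 : ENNReal.ofReal Q ≠ 0 := (ENNReal.ofReal_pos.2 (by linarith)).ne'
  have h1 : law h ν {x | (∃ v, IsStart 0 v x ∧ (k : ℕ∞) ≤ (early (sub x v)).encard) ∧
      t < planted (setBias x 1)} ≤ law h ν {x | (k : ℕ∞) ≤ (early x).encard ∧ t < planted x} := by
    refine measure_mono_ae ?_
    filter_upwards [ae_biased h ν hν] with x hx hmem
    obtain ⟨⟨v, hv, hk⟩, ht⟩ := hmem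
    rw [show v = [] from hv, sub_nil] at hk
    refine ⟨hk, ht.trans_le ?_⟩
    rw [planted_eq_bias_mul (x := x)]
    refine le_mul_of_one_le_left zero_le (le_trans ?_ hx.le_bias)
    rw [ENNReal.one_le_ofReal]
    exact hq.le
  have h2 : tailF h ν (t * ENNReal.ofReal Q) ≤ law h ν {x | t < planted (setBias x 1)} := by
    refine measure_mono_ae ?_
    filter_upwards [ae_biased h ν hν] with x hx hmem
    have h3 : t * ENNReal.ofReal Q < planted x := hmem
    rw [planted_eq_bias_mul (x := x), mul_comm t] at h3
    exact lt_of_mul_lt_mul_left' (h3.trans_le (mul_le_mul' hx.bias_le le_rfl))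
  calc _ ≤ ENNReal.ofReal c * tailP h ν t := h1.trans (hearly t)
    _ ≤ ENNReal.ofReal c * tailF h ν (t * ENNReal.ofReal Q / ENNReal.ofReal (q ^ M)) := by
        refine mul_le_mul_right (le_trans (measure_mono fun x hx => hx.1)
          (tailF_antitone h ν ?_)) _
        calc t * ENNReal.ofReal Q / ENNReal.ofReal (q ^ M) ≤
              t * ENNReal.ofReal Q / ENNReal.ofReal Q :=
              ENNReal.div_le_div_left (ENNReal.ofReal_le_ofReal hM) _
          _ = t := ENNReal.mul_div_cancel_right hQ0 ENNReal.ofReal_ne_top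
    _ ≤ ENNReal.ofReal c * (ENNReal.ofReal (B ^ M) *
          law h ν {x | t < planted (setBias x 1)}) :=
        mul_le_mul_right ((hB M _).trans (mul_le_mul_right h2 _)) _
    _ = _ := by
        rw [← mul_assoc, ← ENNReal.ofReal_mul hc, mul_comm c]

end Start

/-! ### From the unconditioned estimates to the conditional law -/

section Conclusion

variable {h : PMF ℕ} {ν : Measure ℝ} [IsProbabilityMeasure ν]

theorem measurable_totalWeight : Measurable totalWeight := by
  classical
  have h1 : totalWeight = fun x =>
      ∑' v, if v ∈ vertices x then ENNReal.ofReal (weight x v) else 0 := by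
    funext x
    rw [totalWeight, tsum_subtype (vertices x) fun v => ENNReal.ofReal (weight x v)]
    rfl
  rw [h1]
  refine Measurable.tsum fun v =>
    Measurable.ite (measurableSet_mem_vertices v) (ENNReal.measurable_ofReal.comp ?_)
      measurable_const
  exact Finset.measurable_prod _ fun n _ => measurable_snd.comp (measurable_pi_apply _)

/-- If the conditioning event is null, the conditional law is the zero measure and the bound
persists. -/
theorem condLaw_le {u : ℝ} {S : Set Marks} {c : ℝ≥0∞}
    (hS : law h ν {x | x ∈ S ∧ ENNReal.ofReal u < totalWeight x} ≤
      c * law h ν {x | ENNReal.ofReal u < totalWeight x}) : condLaw h ν u S ≤ c := by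
  have hm : MeasurableSet {x | ENNReal.ofReal u < totalWeight x} :=
    measurable_totalWeight measurableSet_Ioi
  rw [condLaw, ProbabilityTheory.cond_apply hm, Set.inter_comm]
  refine (mul_le_mul_right hS _).trans ?_
  rw [mul_comm c, ← mul_assoc]
  exact mul_le_of_le_one_left zero_le (ENNReal.inv_mul_le_one _)

theorem le_of_measure_compl_Icc_eq_zero {q Q : ℝ} (hν : ν (Set.Icc q Q)ᶜ = 0) : q ≤ Q := by
  by_contra hqQ
  rw [Set.Icc_eq_empty hqQ, Set.compl_empty, measure_univ] at hν
  exact one_ne_zero hν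

/-- Here the tree is almost surely a single vertex; this case is separate because the main argument
needs a root that has offspring with positive probability. -/
theorem condLaw_component_eq_zero (h0 : h 0 = 1) (u : ℝ) (i : ℕ) {k : ℕ} (hk : 2 ≤ k) :
    condLaw h ν u {x | (k : ℕ∞) ≤ (component (vertices x) i).encard} = 0 := by
  refine (ProbabilityTheory.cond_absolutelyContinuous (s := _) (μ := law h ν)) ?_
  have hoffs : law h ν {x | offs x ∈ ({0} : Set ℕ)ᶜ} = 0 := by
    rw [law_offs, prob_compl_eq_zero_iff (measurableSet_singleton 0),
      PMF.toMeasure_apply_singleton _ _ (measurableSet_singleton 0), h0]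
  refine measure_mono_null (fun x hx => ?_) hoffs
  intro hx0
  have hx0 : offs x = 0 := hx0
  have h1 : component (vertices x) i ⊆ {[]} := by
    rintro (_ | ⟨j, w⟩) hw
    · rfl
    · have := (cons_mem_vertices.1 hw.1).1
      omega
  have h2 : (k : ℕ∞) ≤ (1 : ℕ) := hx.trans (by simpa using Set.encard_le_encard h1)
  have := Nat.cast_le.1 h2
  omega

theorem law_component_le {c : ℝ≥0∞} (hfin : ∀ᵐ x ∂(law h ν), (vertices x).Finite)
    (htot : ∀ᵐ x ∂(law h ν), totalWeight x = planted (setBias x 1)) {k : ℕ} (hk : k ≠ 0)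
    (hstart : ∀ m t, law h ν {x | (∃ v, IsStart m v x ∧
      ((k / 2 : ℕ) : ℕ∞) ≤ (early (sub x v)).encard) ∧ t < planted (setBias x 1)} ≤
      c * law h ν {x | t < planted (setBias x 1)}) (m : ℕ) (t : ℝ≥0∞) :
    law h ν {x | (k : ℕ∞) ≤ (component (vertices x) (m + 1)).encard ∧ t < totalWeight x} ≤
      2 * c * law h ν {x | t < totalWeight x} := by
  set S : ℕ → Set Marks := fun m => {x | (∃ v, IsStart m v x ∧
    ((k / 2 : ℕ) : ℕ∞) ≤ (early (sub x v)).encard) ∧ t < planted (setBias x 1)}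
  have h1 : law h ν {x | (k : ℕ∞) ≤ (component (vertices x) (m + 1)).encard ∧ t < totalWeight x} ≤
      law h ν (S m ∪ S (m - 1)) := by
    refine measure_mono_ae ?_
    filter_upwards [hfin, htot] with x hx hxt hmem
    obtain ⟨m', hm', v, hv, hcard⟩ := exists_le_encard_early hx hk hmem.1
    have h2 : x ∈ S m' := ⟨⟨v, hv, hcard⟩, hxt ▸ hmem.2⟩
    rcases hm' with rfl | rfl
    · exact Or.inl h2
    · exact Or.inr h2
  have h2 : law h ν {x | t < planted (setBias x 1)} = law h ν {x | t < totalWeight x} := by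
    refine measure_congr ?_
    filter_upwards [htot] with x hx
    exact congrArg (t < ·) hx.symm
  calc _ ≤ law h ν (S m) + law h ν (S (m - 1)) := h1.trans (measure_union_le _ _)
    _ ≤ c * law h ν {x | t < planted (setBias x 1)} +
        c * law h ν {x | t < planted (setBias x 1)} := add_le_add (hstart _ _) (hstart _ _)
    _ = _ := by rw [h2, mul_assoc, two_mul]

theorem exists_exp_of_pow_le {θ C : ℝ} (hθ0 : 0 < θ) (hθ1 : θ < 1) (hC : 0 < C) :
    ∃ c : ℝ, 0 < c ∧ ∃ k₀ : ℕ, ∀ k : ℕ, k₀ ≤ k → C * θ ^ k ≤ Real.exp (-(c * k)) := by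
  set s := Real.sqrt θ
  have hs0 : 0 < s := Real.sqrt_pos.2 hθ0
  have hs1 : s < 1 := by rw [Real.sqrt_lt' one_pos]; simpa using hθ1
  have hss : s * s = θ := Real.mul_self_sqrt hθ0.le
  obtain ⟨k₀, hk₀⟩ := exists_pow_lt_of_lt_one (inv_pos.2 hC) hs1
  refine ⟨-Real.log s, neg_pos.2 (Real.log_neg hs0 hs1), k₀, fun k hk => ?_⟩
  have h1 : Real.exp (-(-Real.log s * k)) = s ^ k := by
    rw [neg_mul, neg_neg, mul_comm, Real.exp_nat_mul, Real.exp_log hs0]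
  have h2 : C * s ^ k ≤ 1 := by
    have h3 : s ^ k ≤ C⁻¹ := (pow_le_pow_of_le_one hs0.le hs1.le hk).trans hk₀.le
    calc C * s ^ k ≤ C * C⁻¹ := by gcongr
      _ = 1 := mul_inv_cancel₀ hC.ne'
  rw [h1, ← hss, mul_pow, ← mul_assoc]
  exact mul_le_of_le_one_left (by positivity) h2

/-- Under the conditioning on a large weight, the sizes of the components have exponential tails,
uniformly in the component and in the level that the weight is required to exceed. -/
theorem exists_condLaw_component_le (hmean : ∑' n : ℕ, (n : ℝ≥0∞) * h n < 1) {a : ℝ} (ha : 0 < a)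
    (htail : ∀ n : ℕ, h.toMeasure (Set.Ici n) ≤ ENNReal.ofReal (Real.exp (-(a * n))))
    {q Q : ℝ} (hq : 1 < q) (hν : ν (Set.Icc q Q)ᶜ = 0) :
    ∃ c : ℝ, 0 < c ∧ ∃ k₀ : ℕ, ∀ u : ℝ, 0 < u → ∀ i : ℕ, 1 ≤ i → ∀ k : ℕ, k₀ ≤ k →
      condLaw h ν u {x | (k : ℕ∞) ≤ (component (vertices x) i).encard} ≤
        ENNReal.ofReal (Real.exp (-(c * k))) := by
  by_cases h0 : h 0 = 1
  · refine ⟨1, one_pos, 2, fun u _ i _ k hk => ?_⟩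
    rw [condLaw_component_eq_zero h0 u i hk]
    exact zero_le
  have hqQ := le_of_measure_compl_Icc_eq_zero hν
  obtain ⟨θ, C, B, hθ0, hθ1, hC, hB1, hfin, hB, hearly⟩ :=
    exists_law_early_le hmean ha htail hq hqQ hν h0
  obtain ⟨M, hM⟩ := pow_unbounded_of_one_lt Q hq
  -- Converts decay in `k / 2`, due to the two starts that share a component, into decay in `k`.
  obtain ⟨θ', C', hθ'0, hθ'1, hC', hθ'⟩ := exists_decay hθ0 hθ1 (D := 2) (by norm_num)
  have hBM : 1 ≤ B ^ M := one_le_pow₀ hB1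
  obtain ⟨c, hc, k₀, hk₀⟩ := exists_exp_of_pow_le (C := 2 * (B ^ M * (C * C'))) hθ'0 hθ'1
    (by positivity)
  refine ⟨c, hc, k₀ + 1, fun u _ i hi k hk => condLaw_le ?_⟩
  obtain ⟨m, rfl⟩ := Nat.exists_eq_add_of_le' hi
  have hstart : ∀ m t, law h ν {x | (∃ v, IsStart m v x ∧
      ((k / 2 : ℕ) : ℕ∞) ≤ (early (sub x v)).encard) ∧ t < planted (setBias x 1)} ≤
      ENNReal.ofReal (B ^ M * (C * θ ^ (k / 2))) * law h ν {x | t < planted (setBias x 1)} := by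
    intro m t
    cases m with
    | zero => exact law_isStart_zero_le hq hqQ hν hM.le (by positivity) hB (hearly (k / 2)) t
    | succ m =>
      refine (law_isStart_succ_le hq hν (hearly (k / 2)) m t).trans
        (mul_le_mul' (ENNReal.ofReal_le_ofReal ?_) le_rfl)
      exact le_mul_of_one_le_left (by positivity) hBM
  refine (law_component_le hfin (ae_totalWeight_eq (by linarith) hν) (by omega) hstart m _).trans
    (mul_le_mul' ?_ le_rfl)
  rw [← ENNReal.ofReal_ofNat, ← ENNReal.ofReal_mul (by norm_num)]
  refine ENNReal.ofReal_le_ofReal (le_trans ?_ (hk₀ k (by omega)))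
  have h1 := mul_le_mul_of_nonneg_left (hθ' k) (by positivity : 0 ≤ 2 * (B ^ M * C))
  calc 2 * (B ^ M * (C * θ ^ (k / 2))) = 2 * (B ^ M * C) * θ ^ (k / 2) := by ring
    _ ≤ 2 * (B ^ M * C) * (C' * θ' ^ k) := h1
    _ = _ := by ring

end Conclusion

end RenewalTree

theorem mainTheorem8 (h : PMF ℕ)
    (hmean : ∑' n : ℕ, (n : ℝ≥0∞) * h n < 1)
    (htail : ∃ a : ℝ, 0 < a ∧
      ∀ n : ℕ, h.toMeasure (Set.Ici n) ≤ ENNReal.ofReal (Real.exp (-(a * n))))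
    (ν : Measure ℝ) [IsProbabilityMeasure ν] (q Q : ℝ) (hq : 1 < q)
    (hν : ν (Set.Icc q Q)ᶜ = 0) :
    ∃ c : ℝ, 0 < c ∧ ∃ k₀ : ℕ, ∀ u : ℝ, 0 < u → ∀ i : ℕ, 1 ≤ i → ∀ k : ℕ, k₀ ≤ k →
      RenewalTree.condLaw h ν u
          {x | (k : ℕ∞) ≤ (RenewalTree.component (RenewalTree.vertices x) i).encard} ≤
        ENNReal.ofReal (Real.exp (-(c * k))) := by
  obtain ⟨a, ha, htail⟩ := htail
  exact RenewalTree.exists_condLaw_component_le hmean ha htail hq hν
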